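/- Let $\mathbb H^3=\{\Omega=(\cosh r,\sinh r\,\omega)\in\mathbb R\times\mathbb R^3:\ r\ge 0,\ \omega\in\mathbb S^2\}$ be hyperbolic space (the upper sheet of the hyperboloid, with the Riemannian metric induced by the Lorentz form), $r=r(\Omega)$ the hyperbolic distance from the origin $(1,0)$, and $L^2(\mathbb H^3)$ the complex $L^2$ space of its Riemannian volume. Let $\Delta$ be the (self-adjoint) Laplacian on $L^2(\mathbb H^3)$, that is, the closure of the Laplace--Beltrami operator on $C_c^\infty(\mathbb H^3)$. For $u_0\in L^2(\mathbb H^3)$ we write $e^{it\Delta}u_0$ for the mild solution of $i\partial_t u+\Delta u=0$, $u(0)=u_0$, i.e. the function $u\in C(\mathbb R;L^2(\mathbb H^3))$ with $u(0)=u_0$ such that, for all $t\in\mathbb R$, $\int_0^t u(s)\,ds$ belongs to the domain of $\Delta$ and $u(t)=u_0+i\Delta\int_0^t u(s)\,ds$. Fix a normalization constant $C\in\mathbb C\setminus\{0\}$. For $u_0\in L^2(\mathbb H^3)$ radial (that is, $u_0(\Omega)=f(r(\Omega))$ for almost every $\Omega$, for some $f$), its radial Fourier transform is $$\widehat{u_0}(\lambda)=\frac{C}{\lambda}\int_0^\infty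 \sin(\lambda r)\,f(r)\,\sinh r\,dr,\qquad \lambda>0,$$ where the integral is understood as the limit, as $R\to\infty$, of the integrals over $(0,R)$ in the space $L^2((0,\infty),\lambda^2d\lambda)$. Then there is a constant $c\in\mathbb C\setminus\{0\}$, depending only on $C$, such that for every radial $u_0\in L^2(\mathbb H^3)$ the free evolution $e^{it\Delta}u_0$ exists and is unique, $\widehat{u_0}$ exists, and, with $$u_{\rm asym}(t,r)=c\,\frac{e^{-it+i\frac{r^2}{4t}}}{t^{3/2}}\,\frac{r}{\sinh r}\,\widehat{u_0}\Big(\frac{r}{2t}\Big)\qquad(t>0),$$ one has $$\big\|e^{it\Delta}u_0-u_{\rm asym}(t)\big\|_{L^2(\mathbb H^3)}\longrightarrow 0\qquad\text{as } t\to+\infty .$$ -/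

import Mathlib

open MeasureTheory Filter Topology
open scoped ContDiff

noncomputable section

/-- Euclidean three-space. -/
abbrev E3 : Type := EuclideanSpace ℝ (Fin 3)

/-- The Lorentz form `-x₀ y₀ + x' · y'` on `ℝ × ℝ³`. -/
def lorentzForm (p q : ℝ × E3) : ℝ := inner ℝ p.2 q.2 - p.1 * q.1

/-- Hyperbolic three-space: the upper sheet `x₀ > 0` of the hyperboloid `x₀² - |x'|² = 1`,
that is, the set of points `(cosh r, (sinh r) ω)` with `r ≥ 0` and `ω` in the unit sphere. -/
abbrev Hyp3 : Type := {p : ℝ × E3 // 0 < p.1 ∧ lorentzForm p p = -1}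

/-- The global parametrization `x ↦ (√(1 + |x|²), x)` of the hyperboloid, in the ambient space. -/
def hypEmb (x : E3) : ℝ × E3 := (Real.sqrt (1 + ‖x‖ ^ 2), x)

/-- The global parametrization of `Hyp3` by `ℝ³`; its inverse is `Ω ↦ Ω.1.2`. -/
def hypParam (x : E3) : Hyp3 :=
  ⟨hypEmb x, by
    have h : (0 : ℝ) < 1 + ‖x‖ ^ 2 := by positivity
    refine ⟨Real.sqrt_pos.2 h, ?_⟩
    simp only [lorentzForm, hypEmb, real_inner_self_eq_norm_sq]
    rw [Real.mul_self_sqrt h.le]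
    ring⟩

/-- The hyperbolic distance `r` from the origin `(1, 0)` of the hyperboloid: `|x'| = sinh r`. -/
def hypRadius (Ω : Hyp3) : ℝ := Real.arsinh ‖Ω.1.2‖

/-- The `i`-th partial derivative of a function on `ℝ³`. -/
def partialDeriv {V : Type*} [NormedAddCommGroup V] [NormedSpace ℝ V]
    (i : Fin 3) (h : E3 → V) (x : E3) : V :=
  fderiv ℝ h x (EuclideanSpace.single i 1)

/-- The Riemannian metric `g` of `Hyp3` in the global chart: the Lorentz form restricted to the
tangent vectors of the parametrization. -/
def hypMetric (x : E3) : Matrix (Fin 3) (Fin 3) ℝ :=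
  Matrix.of fun i j => lorentzForm (partialDeriv i hypEmb x) (partialDeriv j hypEmb x)

/-- The Riemannian volume density `√(det g)` in the global chart. -/
def hypDensity (x : E3) : ℝ := Real.sqrt (hypMetric x).det

/-- The Riemannian volume measure of `Hyp3`. -/
def hypVol : Measure Hyp3 :=
  Measure.map hypParam ((volume : Measure E3).withDensity fun x => ENNReal.ofReal (hypDensity x))

/-- The Hilbert space `L²(ℍ³)` of complex-valued functions. -/
abbrev L2Hyp3 : Type := Lp ℂ 2 hypVol

/-- The Laplace--Beltrami operator in the global chart:
`(1/√(det g)) ∑ᵢ ∂ᵢ (√(det g) ∑ⱼ gⁱʲ ∂ⱼ h)`. -/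
def chartLaplacian (h : E3 → ℂ) (x : E3) : ℂ :=
  ((hypDensity x)⁻¹ : ℝ) *
    ∑ i, partialDeriv i
      (fun y => (hypDensity y : ℂ) * ∑ j, (((hypMetric y)⁻¹ i j : ℝ) : ℂ) * partialDeriv j h y) x

/-- The Laplace--Beltrami operator of `Hyp3` on (smooth) functions. -/
def laplaceBeltrami (φ : Hyp3 → ℂ) (Ω : Hyp3) : ℂ :=
  chartLaplacian (fun x => φ (hypParam x)) Ω.1.2

/-- Test functions: smooth compactly supported complex functions on `Hyp3`. -/
def IsTestFunction (φ : Hyp3 → ℂ) : Prop :=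
  ContDiff ℝ ∞ (fun x => φ (hypParam x)) ∧ HasCompactSupport φ

/-- The graph of the Laplacian as an unbounded operator on `L²(ℍ³)`: the closure in
`L² × L²` of the graph of the Laplace--Beltrami operator on test functions. `(v, w)` belongs to it
when `v` lies in the domain of the (self-adjoint) operator and `w = Δ v`. -/
def laplacianGraph : Set (L2Hyp3 × L2Hyp3) :=
  closure {p | ∃ φ : Hyp3 → ℂ, IsTestFunction φ ∧
    p.1 =ᵐ[hypVol] φ ∧ p.2 =ᵐ[hypVol] laplaceBeltrami φ}

/-- `u(t) = e^{itΔ} u₀`: `u` is the mild solution in `C(ℝ; L²(ℍ³))` of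
`i ∂ₜ u + Δ u = 0`, `u(0) = u₀`, that is, for every `t` the integral `∫₀ᵗ u(s) ds` is in the domain
of `Δ` and `u(t) = u₀ + i Δ ∫₀ᵗ u(s) ds`. -/
structure IsFreeEvolution (u₀ : L2Hyp3) (u : ℝ → L2Hyp3) : Prop where
  continuous : Continuous u
  initial : u 0 = u₀
  mild : ∀ t : ℝ, ((∫ s in (0 : ℝ)..t, u s), (-Complex.I) • (u t - u₀)) ∈ laplacianGraph

/-- The truncated radial Fourier integral `(C / ξ) ∫₀ᴿ sin(ξ r) f(r) sinh r dr`. -/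
def truncRadialFourier (C : ℂ) (f : ℝ → ℂ) (R ξ : ℝ) : ℂ :=
  C / (ξ : ℂ) * ∫ r in (0 : ℝ)..R, (Real.sin (ξ * r) : ℂ) * f r * (Real.sinh r : ℂ)

/-- `F` is the radial Fourier transform (with normalization constant `C`) of the radial function
with profile `f`. For square-integrable radial functions the integral
`(C / ξ) ∫₀^∞ sin(ξ r) f(r) sinh r dr` is understood as usual as the limit of the truncated
integrals in `L²((0, ∞), ξ² dξ)`. -/
def IsRadialFourier (C : ℂ) (f F : ℝ → ℂ) : Prop :=
  AEStronglyMeasurable F (volume.restrict (Set.Ioi (0 : ℝ))) ∧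
  Tendsto
    (fun R : ℝ => ∫⁻ ξ in Set.Ioi (0 : ℝ),
      ‖truncRadialFourier C f R ξ - F ξ‖ₑ ^ 2 * ENNReal.ofReal (ξ ^ 2))
    atTop (𝓝 0)

/-- The asymptotic profile `c e^{-it + i r²/(4t)} t^{-3/2} (r / sinh r) F(r / (2t))`. -/
def asymptoticProfile (c : ℂ) (F : ℝ → ℂ) (t : ℝ) (Ω : Hyp3) : ℂ :=
  c * (Complex.exp (-Complex.I * t + Complex.I * ((hypRadius Ω : ℂ) ^ 2 / (4 * t))) /
      ((t ^ (3 / 2 : ℝ) : ℝ) : ℂ)) *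
    ((hypRadius Ω / Real.sinh (hypRadius Ω) : ℝ) : ℂ) *
    F (hypRadius Ω / (2 * t))

end

noncomputable section

/-! On radial functions the Laplacian of `ℍ³` is `(sinh r)⁻¹ (∂ᵣ² - 1) sinh r`. Multiplication by
`sinh r` therefore turns the radial evolution into the one-dimensional free Schrödinger equation for
odd functions, up to the phase `e^{-it}`, and the radial Fourier transform into a sine transform.
The data `a^{-3/2} e^{-r²/(4a)} r / sinh r` evolve explicitly: `a` becomes `a + it` and a factor
`e^{-it}` appears (`isStrongSolution_gaussianWave`). Their transform is `2√π C e^{-aξ²}`, with an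
amplitude independent of `a` (`isRadialFourier_gaussianProfile`). After the substitution `ρ = r/t`
the error of the asymptotic formula tends to zero pointwise under a fixed Gaussian bound, provided
that `c = i^{-3/2} / (2√π C)` (`tendsto_gaussianWave`).

The general case follows by density. Weierstrass approximation in the variable `e^{-r²}` shows that
the Gaussian profiles span a dense subspace of radial `L²` (`gaussianSpan_dense`). The evolution is
isometric, and the norm of the asymptotic profile does not depend on `t`
(`eLpNorm_asymptoticProfile_sq`) and is controlled by the data through Plancherel
(`IsRadialFourier.eLpNorm_le`). A three-epsilon argument concludes
(`tendsto_sub_asymptoticProfile`).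

No spectral theorem is used for existence and uniqueness. Green's identity makes `Δ` symmetric
(`inner_laplacian_symm`). Symmetry gives uniqueness, since the time integral of the difference of
two solutions has constant norm, and it makes strong solutions isometric. Uniform limits of strong
solutions then produce an evolution for every radial datum (`exists_isFreeEvolution`). That the
Gaussians lie in the domain of `Δ` is shown with cutoffs (`mem_laplacianGraph_of_radial`). The
computations use the variable `s = |x|² = sinh² r`, in which the radial functions at hand are smooth
through the origin. -/

/-! ### Metric and volume density in the global chart. -/

theorem hasFDerivAt_hypEmb (x : E3) :
    HasFDerivAt hypEmb
      (((Real.sqrt (1 + ‖x‖ ^ 2))⁻¹ • innerSL ℝ x).prod (ContinuousLinearMap.id ℝ E3)) x := by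
  have h : (0 : ℝ) < 1 + ‖x‖ ^ 2 := by positivity
  have h1 : HasFDerivAt (fun y : E3 => 1 + ‖y‖ ^ 2) (2 • innerSL ℝ x) x := by
    simpa using ((hasStrictFDerivAt_norm_sq x).hasFDerivAt).const_add (1 : ℝ)
  have h2 := h1.sqrt h.ne'
  refine HasFDerivAt.prodMk ?_ (hasFDerivAt_id x)
  convert! h2 using 1
  ext v
  simp
  field_simp

theorem partialDeriv_hypEmb (i : Fin 3) (x : E3) :
    partialDeriv i hypEmb x = (x i / Real.sqrt (1 + ‖x‖ ^ 2), EuclideanSpace.single i 1) := by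
  simp [partialDeriv, (hasFDerivAt_hypEmb x).fderiv, EuclideanSpace.inner_single_right]
  ring

theorem hypMetric_apply (x : E3) (i j : Fin 3) :
    hypMetric x i j = (if i = j then 1 else 0) - x i * x j / (1 + ‖x‖ ^ 2) := by
  have h : (0 : ℝ) < 1 + ‖x‖ ^ 2 := by positivity
  have h2 : Real.sqrt (1 + ‖x‖ ^ 2) ^ 2 = 1 + ‖x‖ ^ 2 := Real.sq_sqrt h.le
  have h3 := Real.sqrt_pos.2 h
  simp only [hypMetric, Matrix.of_apply, lorentzForm, partialDeriv_hypEmb,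
    EuclideanSpace.inner_single_left]
  congr 1
  · simp
  · rw [div_mul_div_comm, ← sq, h2]

theorem norm_sq_E3 (x : E3) : ‖x‖ ^ 2 = x 0 ^ 2 + x 1 ^ 2 + x 2 ^ 2 := by
  simp [EuclideanSpace.norm_sq_eq, Fin.sum_univ_three]

/-- The metric is the rank-one perturbation `1 - x xᵀ / (1 + |x|²)` of the identity, which explains
this determinant and the inverse `1 + x xᵀ` below. -/
theorem det_hypMetric (x : E3) : (hypMetric x).det = (1 + ‖x‖ ^ 2)⁻¹ := by
  have h : (1 + ‖x‖ ^ 2) ≠ 0 := by positivity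
  rw [Matrix.det_fin_three]
  simp only [hypMetric_apply]
  simp
  field_simp
  rw [norm_sq_E3]
  ring

theorem inv_hypMetric (x : E3) :
    (hypMetric x)⁻¹ = Matrix.of fun i j => (if i = j then 1 else 0) + x i * x j := by
  have h : (1 + ‖x‖ ^ 2) ≠ 0 := by positivity
  apply Matrix.inv_eq_right_inv
  have h' := norm_sq_E3 x
  ext i j
  simp only [Matrix.mul_apply, Fin.sum_univ_three, hypMetric_apply, Matrix.of_apply,
    Matrix.one_apply]
  fin_cases i <;> fin_cases j <;> simp <;> field_simp <;> rw [h'] <;> ring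

theorem hypDensity_eq (x : E3) : hypDensity x = (Real.sqrt (1 + ‖x‖ ^ 2))⁻¹ := by
  rw [hypDensity, det_hypMetric, Real.sqrt_inv]

theorem hypDensity_pos (x : E3) : 0 < hypDensity x := by
  rw [hypDensity_eq]; positivity

theorem contDiff_hypDensity : ContDiff ℝ ∞ hypDensity := by
  rw [show hypDensity = fun x => (Real.sqrt (1 + ‖x‖ ^ 2))⁻¹ from funext hypDensity_eq]
  refine ContDiff.inv (ContDiff.sqrt (contDiff_const.add (contDiff_norm_sq ℝ)) ?_) ?_
  · intro x; positivity
  · intro x; positivity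

theorem hypDensity_hasFDerivAt (x : E3) :
    HasFDerivAt hypDensity (-(hypDensity x ^ 3) • innerSL ℝ x) x := by
  have h : (0 : ℝ) < 1 + ‖x‖ ^ 2 := by positivity
  rw [show hypDensity = fun x => (Real.sqrt (1 + ‖x‖ ^ 2))⁻¹ from funext hypDensity_eq]
  have h1 : HasFDerivAt (fun y : E3 => Real.sqrt (1 + ‖y‖ ^ 2)) _ x := (hasFDerivAt_hypEmb x).fst
  have h2 := (hasDerivAt_inv (Real.sqrt_pos.2 h).ne').comp_hasFDerivAt x h1
  convert! h2 using 1
  ext v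
  simp
  ring

/-! ### The Laplacian in the chart and its action on radial functions. -/

/-- The flux `√(det g) ∑ⱼ gⁱʲ ∂ⱼ h` whose divergence is the Laplacian density. -/
def hypFlux (h : E3 → ℂ) (i : Fin 3) (y : E3) : ℂ :=
  (hypDensity y : ℂ) * ∑ j, (((hypMetric y)⁻¹ i j : ℝ) : ℂ) * partialDeriv j h y

theorem chartLaplacian_eq (h : E3 → ℂ) (x : E3) :
    chartLaplacian h x = ((hypDensity x)⁻¹ : ℝ) * ∑ i, partialDeriv i (hypFlux h i) x := rfl

theorem contDiff_partialDeriv {V : Type*} [NormedAddCommGroup V] [NormedSpace ℝ V] {h : E3 → V}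
    (hh : ContDiff ℝ ∞ h) (i : Fin 3) : ContDiff ℝ ∞ (partialDeriv i h) :=
  (hh.fderiv_right (m := ∞) (by simp)).clm_apply contDiff_const

theorem contDiff_inv_hypMetric (i j : Fin 3) : ContDiff ℝ ∞ fun x => (hypMetric x)⁻¹ i j := by
  simp only [inv_hypMetric, Matrix.of_apply]
  fun_prop

theorem contDiff_ofReal_comp {f : E3 → ℝ} (hf : ContDiff ℝ ∞ f) :
    ContDiff ℝ ∞ fun x => (f x : ℂ) :=
  Complex.ofRealCLM.contDiff.comp hf

theorem contDiff_hypFlux {h : E3 → ℂ} (hh : ContDiff ℝ ∞ h) (i : Fin 3) :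
    ContDiff ℝ ∞ (hypFlux h i) := by
  refine (contDiff_ofReal_comp contDiff_hypDensity).mul (ContDiff.sum fun j _ => ?_)
  exact (contDiff_ofReal_comp (contDiff_inv_hypMetric i j)).mul (contDiff_partialDeriv hh j)

theorem contDiff_chartLaplacian {h : E3 → ℂ} (hh : ContDiff ℝ ∞ h) :
    ContDiff ℝ ∞ (chartLaplacian h) := by
  refine ContDiff.mul ?_ (ContDiff.sum fun i _ => contDiff_partialDeriv (contDiff_hypFlux hh i) i)
  exact contDiff_ofReal_comp (contDiff_hypDensity.inv fun x => (hypDensity_pos x).ne')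

/-- The radial part of the Laplacian in the variable `s = |x|²`. -/
theorem chartLaplacian_radial {φ φ' φ'' : ℝ → ℂ}
    (h1 : ∀ s, 0 ≤ s → HasDerivAt φ (φ' s) s) (h2 : ∀ s, 0 ≤ s → HasDerivAt φ' (φ'' s) s) (x : E3) :
    chartLaplacian (fun y => φ (‖y‖ ^ 2)) x =
      (6 + 8 * (‖x‖ ^ 2 : ℝ)) * φ' (‖x‖ ^ 2) +
        4 * (‖x‖ ^ 2 : ℝ) * (1 + (‖x‖ ^ 2 : ℝ)) * φ'' (‖x‖ ^ 2) := by
  have hn (y : E3) : HasFDerivAt (fun y : E3 => ‖y‖ ^ 2) (2 • innerSL ℝ y) y :=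
    (hasStrictFDerivAt_norm_sq y).hasFDerivAt
  have hp (j : Fin 3) (y : E3) :
      partialDeriv j (fun y => φ (‖y‖ ^ 2)) y = (2 * y j : ℝ) * φ' (‖y‖ ^ 2) := by
    have := ((h1 (‖y‖ ^ 2) (by positivity)).hasFDerivAt.comp y (hn y)).fderiv
    simp only [partialDeriv]
    erw [this]
    simp [EuclideanSpace.inner_single_right]
    ring
  -- The gradient of a radial function is parallel to `y`, an eigenvector of the inverse metric with
  -- eigenvalue `1 + |y|²`.
  have hf (i : Fin 3) (y : E3) : hypFlux (fun y => φ (‖y‖ ^ 2)) i y =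
      (hypDensity y * (1 + ‖y‖ ^ 2) * (2 * y i) : ℝ) * φ' (‖y‖ ^ 2) := by
    simp only [hypFlux, hp, inv_hypMetric, Matrix.of_apply, Fin.sum_univ_three]
    rw [norm_sq_E3 y]
    fin_cases i <;> simp <;> ring
  have hd (i : Fin 3) : partialDeriv i (hypFlux (fun y => φ (‖y‖ ^ 2)) i) x =
      (hypDensity x : ℂ) * (((2 * (1 + ‖x‖ ^ 2) + 2 * x i ^ 2 : ℝ) : ℂ) * φ' (‖x‖ ^ 2)
        + ((4 * x i ^ 2 * (1 + ‖x‖ ^ 2) : ℝ) : ℂ) * φ'' (‖x‖ ^ 2)) := by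
    rw [show hypFlux (fun y => φ (‖y‖ ^ 2)) i = _ from funext (hf i)]
    have hr : HasFDerivAt (fun y : E3 => hypDensity y * (1 + ‖y‖ ^ 2) * (2 * y i)) _ x :=
      ((hypDensity_hasFDerivAt x).mul ((hn x).const_add 1)).mul
        (((EuclideanSpace.proj i : E3 →L[ℝ] ℝ).hasFDerivAt).const_mul 2)
    have hc := (Complex.ofRealCLM.hasFDerivAt.comp x hr).mul
      ((h2 (‖x‖ ^ 2) (by positivity)).hasFDerivAt.comp x (hn x))
    simp only [partialDeriv]
    erw [hc.fderiv]
    have h : (0 : ℝ) < 1 + ‖x‖ ^ 2 := by positivity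
    have hD : hypDensity x ^ 2 * (1 + ‖x‖ ^ 2) = 1 := by
      rw [hypDensity_eq, inv_pow, Real.sq_sqrt h.le, inv_mul_cancel₀ h.ne']
    simp [EuclideanSpace.inner_single_right]
    have hD' : (hypDensity x : ℂ) ^ 2 * (1 + (‖x‖ : ℂ) ^ 2) = 1 := by exact_mod_cast hD
    linear_combination (-2 * (hypDensity x : ℂ) * (x i : ℂ) ^ 2 * φ' (‖x‖ ^ 2)) * hD'
  rw [chartLaplacian_eq]
  simp only [hd]
  rw [← Finset.mul_sum, ← mul_assoc, Fin.sum_univ_three]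
  have : ((hypDensity x)⁻¹ : ℝ) * (hypDensity x : ℂ) = 1 := by
    push_cast
    exact inv_mul_cancel₀ (by exact_mod_cast (hypDensity_pos x).ne')
  rw [this, one_mul]
  have h' := norm_sq_E3 x
  rw [show (x 0) ^ 2 = ‖x‖ ^ 2 - x 1 ^ 2 - x 2 ^ 2 by linarith]
  push_cast
  ring

/-! ### Integration on hyperbolic space and polar coordinates. -/

/-- The global chart of `Hyp3` as a homeomorphism. -/
def hypHomeo : E3 ≃ₜ Hyp3 where
  toFun := hypParam
  invFun Ω := Ω.1.2
  left_inv x := rfl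
  right_inv Ω := by
    apply Subtype.ext
    have h := Ω.2
    simp only [lorentzForm, real_inner_self_eq_norm_sq] at h
    refine Prod.ext ?_ rfl
    simp only [hypParam, hypEmb]
    rw [show 1 + ‖Ω.1.2‖ ^ 2 = Ω.1.1 ^ 2 by nlinarith [h.2], Real.sqrt_sq h.1.le]
  continuous_toFun := by
    refine Continuous.subtype_mk ?_ _
    unfold hypEmb
    fun_prop
  continuous_invFun := by fun_prop

theorem measurableEmbedding_hypParam : MeasurableEmbedding hypParam :=
  hypHomeo.measurableEmbedding

theorem lintegral_hypVol (f : Hyp3 → ENNReal) :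
    ∫⁻ Ω, f Ω ∂hypVol = ∫⁻ x, ENNReal.ofReal (hypDensity x) * f (hypParam x) := by
  rw [hypVol, measurableEmbedding_hypParam.lintegral_map]
  have hm : Measurable fun x => ENNReal.ofReal (hypDensity x) :=
    contDiff_hypDensity.continuous.measurable.ennreal_ofReal
  rw [lintegral_withDensity_eq_lintegral_mul_non_measurable _ hm (by simp)]
  rfl

theorem ae_hypVol_iff {p : Hyp3 → Prop} : (∀ᵐ Ω ∂hypVol, p Ω) ↔ ∀ᵐ x : E3, p (hypParam x) := by
  have hm : Measurable fun x => ENNReal.ofReal (hypDensity x) :=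
    contDiff_hypDensity.continuous.measurable.ennreal_ofReal
  rw [hypVol, measurableEmbedding_hypParam.ae_map_iff, ae_withDensity_iff hm]
  simp [hypDensity_pos]

theorem integral_hypVol (f : Hyp3 → ℂ) :
    ∫ Ω, f Ω ∂hypVol = ∫ x, (hypDensity x : ℂ) * f (hypParam x) := by
  have hm : Measurable fun x => ENNReal.ofReal (hypDensity x) :=
    contDiff_hypDensity.continuous.measurable.ennreal_ofReal
  rw [hypVol, measurableEmbedding_hypParam.integral_map,
    integral_withDensity_eq_integral_toReal_smul hm (by simp)]
  simp [ENNReal.toReal_ofReal (hypDensity_pos _).le]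

theorem hypRadius_hypParam (x : E3) : hypRadius (hypParam x) = Real.arsinh ‖x‖ := rfl

theorem continuous_hypRadius : Continuous hypRadius := by
  unfold hypRadius
  exact Real.continuous_arsinh.comp (by fun_prop)

/-- Area of the unit sphere. -/
def sphereArea : ENNReal := (volume : Measure E3).toSphere Set.univ

theorem sphereArea_ne_zero : sphereArea ≠ 0 := by
  simp [sphereArea, Real.pi_pos]

theorem sphereArea_ne_top : sphereArea ≠ ⊤ := measure_ne_top _ _

/-- The origin is a null set, and its complement is the product of the unit sphere and the half-line
with measure `s² ds`. -/
theorem lintegral_fun_norm_E3 {f : ℝ → ENNReal} (hf : Measurable f) :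
    ∫⁻ x : E3, f ‖x‖ = sphereArea * ∫⁻ s in Set.Ioi (0 : ℝ), ENNReal.ofReal (s ^ 2) * f s := by
  have hs : MeasurableSet ({0}ᶜ : Set E3) := (measurableSet_singleton _).compl
  calc ∫⁻ x : E3, f ‖x‖ = ∫⁻ x in ({0}ᶜ : Set E3), f ‖x‖ := by
        rw [restrict_compl_singleton]
    _ = ∫⁻ x : ({0}ᶜ : Set E3), f ‖x.1‖ ∂(Measure.comap Subtype.val volume) :=
        (lintegral_subtype_comap hs fun x => f ‖x‖).symm
    _ = ∫⁻ p, f p.2 ∂((volume : Measure E3).toSphere.prod (Measure.volumeIoiPow 2)) := by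
        have := (volume : Measure E3).measurePreserving_homeomorphUnitSphereProd
        rw [finrank_euclideanSpace, Fintype.card_fin] at this
        rw [← this.lintegral_comp_emb (Homeomorph.measurableEmbedding _)]
        simp only [homeomorphUnitSphereProd_apply_snd_coe]
    _ = sphereArea * ∫⁻ s, f s ∂(Measure.volumeIoiPow 2) := by
        rw [lintegral_prod _ (by fun_prop)]
        simp [sphereArea, mul_comm]
    _ = _ := by
        congr 1
        rw [Measure.volumeIoiPow, lintegral_withDensity_eq_lintegral_mul _ (by fun_prop)
          (by fun_prop)]
        exact lintegral_subtype_comap measurableSet_Ioi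
          fun s : ℝ => ENNReal.ofReal (s ^ 2) * f s

theorem sqrt_one_add_sinh_sq (r : ℝ) : Real.sqrt (1 + Real.sinh r ^ 2) = Real.cosh r := by
  rw [show 1 + Real.sinh r ^ 2 = Real.cosh r ^ 2 by rw [Real.cosh_sq]; ring,
    Real.sqrt_sq (Real.cosh_pos r).le]

/-- Substitute `s = sinh r` in Euclidean polar coordinates: the Jacobian `cosh r` cancels the
density `(1 + s²)^{-1/2}`. -/
theorem lintegral_comp_hypRadius {f : ℝ → ENNReal} (hf : Measurable f) :
    ∫⁻ Ω, f (hypRadius Ω) ∂hypVol =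
      sphereArea * ∫⁻ r in Set.Ioi (0 : ℝ), ENNReal.ofReal (Real.sinh r ^ 2) * f r := by
  rw [lintegral_hypVol]
  simp only [hypRadius_hypParam, hypDensity_eq]
  have hm : Measurable fun s : ℝ =>
      ENNReal.ofReal (Real.sqrt (1 + s ^ 2))⁻¹ * f (Real.arsinh s) :=
    (Measurable.ennreal_ofReal (by fun_prop)).mul
      (hf.comp Real.continuous_arsinh.measurable)
  rw [lintegral_fun_norm_E3 hm]
  congr 1
  have himg : Real.sinh '' Set.Ioi 0 = Set.Ioi 0 := by
    ext s
    constructor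
    · rintro ⟨r, hr, rfl⟩
      exact Real.sinh_pos_iff.2 hr
    · intro hs
      exact ⟨Real.arsinh s, Real.arsinh_pos_iff.2 hs, Real.sinh_arsinh s⟩
  rw [← himg, lintegral_image_eq_lintegral_abs_deriv_mul measurableSet_Ioi
    (fun r _ => (Real.hasDerivAt_sinh r).hasDerivWithinAt) Real.sinh_injective.injOn, himg]
  refine lintegral_congr fun r => ?_
  rw [Real.arsinh_sinh, sqrt_one_add_sinh_sq, abs_of_pos (Real.cosh_pos r), ← mul_assoc,
    ← mul_assoc, ← ENNReal.ofReal_mul (Real.cosh_pos r).le, ← ENNReal.ofReal_mul (by positivity)]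
  congr 2
  field_simp [(Real.cosh_pos r).ne']

/-- The radial measure `4π sinh² r dr` on the half-line. -/
def radialMeasure : Measure ℝ :=
  sphereArea • (volume.restrict (Set.Ioi 0)).withDensity fun r => ENNReal.ofReal (Real.sinh r ^ 2)

theorem measurable_ofReal_sinh_sq : Measurable fun r => ENNReal.ofReal (Real.sinh r ^ 2) :=
  Measurable.ennreal_ofReal (by fun_prop)

theorem measurePreserving_hypRadius : MeasurePreserving hypRadius hypVol radialMeasure := by
  refine ⟨continuous_hypRadius.measurable, ?_⟩
  ext s hs
  rw [← lintegral_indicator_one hs, ← lintegral_indicator_one hs,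
    lintegral_map (measurable_one.indicator hs) continuous_hypRadius.measurable,
    lintegral_comp_hypRadius (measurable_one.indicator hs), radialMeasure, lintegral_smul_measure,
    lintegral_withDensity_eq_lintegral_mul _ measurable_ofReal_sinh_sq (measurable_one.indicator hs)]
  rfl

theorem ae_radialMeasure_iff {p : ℝ → Prop} :
    (∀ᵐ r ∂radialMeasure, p r) ↔ ∀ᵐ r ∂(volume.restrict (Set.Ioi (0 : ℝ))), p r := by
  rw [radialMeasure, Measure.ae_ennreal_smul_measure_eq sphereArea_ne_zero,
    ae_withDensity_iff measurable_ofReal_sinh_sq]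
  have : ∀ᵐ r ∂(volume.restrict (Set.Ioi (0 : ℝ))), 0 < r := ae_restrict_mem measurableSet_Ioi
  constructor <;> intro h <;> filter_upwards [h, this] with r h1 h2
  · apply h1
    have := Real.sinh_pos_iff.2 h2
    simp [this.ne']
  · exact fun _ => h1

/-- A profile of a measurable radial function is measurable. -/
theorem aestronglyMeasurable_profile {g : Hyp3 → ℂ} (hg : AEStronglyMeasurable g hypVol)
    {f : ℝ → ℂ} (h : g =ᵐ[hypVol] fun Ω => f (hypRadius Ω)) :
    AEStronglyMeasurable f radialMeasure := by
  have h1 : AEStronglyMeasurable (fun Ω => f (hypRadius Ω)) hypVol := hg.congr h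
  -- The profile `f` is an arbitrary function, so its measurability has to be extracted from that of
  -- `f ∘ hypRadius`. In polar coordinates the latter is a function on a product that depends on the
  -- second factor only.
  have h2 : AEStronglyMeasurable (fun x : E3 => f (Real.arsinh ‖x‖)) := by
    obtain ⟨k, hk, hk'⟩ := h1
    refine ⟨fun x => k (hypParam x), hk.comp_measurable measurableEmbedding_hypParam.measurable, ?_⟩
    exact ae_hypVol_iff.1 hk'
  have hs : MeasurableSet ({0}ᶜ : Set E3) := (measurableSet_singleton _).compl
  have h3 : AEStronglyMeasurable (fun x : ({0}ᶜ : Set E3) => f (Real.arsinh ‖x.1‖))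
      (Measure.comap Subtype.val volume) := by
    refine h2.comp_quasiMeasurePreserving (f := Subtype.val) ⟨measurable_subtype_coe, ?_⟩
    rw [(MeasurableEmbedding.subtype_coe hs).map_comap]
    exact Measure.absolutelyContinuous_of_le Measure.restrict_le_self
  have hmp := (volume : Measure E3).measurePreserving_homeomorphUnitSphereProd
  rw [finrank_euclideanSpace, Fintype.card_fin] at hmp
  have h4 : AEStronglyMeasurable (fun p => f (Real.arsinh p.2))
      ((volume : Measure E3).toSphere.prod (Measure.volumeIoiPow 2)) := by
    refine (hmp.aestronglyMeasurable_comp_iff (Homeomorph.measurableEmbedding _)).1 ?_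
    simpa only [Function.comp_def, homeomorphUnitSphereProd_apply_snd_coe] using h3
  have h5 : AEStronglyMeasurable (fun s : Set.Ioi (0 : ℝ) => f (Real.arsinh s))
      (Measure.volumeIoiPow 2) :=
    AEStronglyMeasurable.of_comp_snd (f := fun s : Set.Ioi (0 : ℝ) => f (Real.arsinh s)) h4
      (by simp)
  obtain ⟨k, hk, hk'⟩ := h5
  have h6 : ∀ᵐ s : ℝ ∂(volume.restrict (Set.Ioi (0 : ℝ))),
      ∀ hs : s ∈ Set.Ioi (0 : ℝ), f (Real.arsinh s) = k ⟨s, hs⟩ := by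
    rw [Filter.EventuallyEq, Measure.volumeIoiPow, ae_withDensity_iff (by fun_prop)] at hk'
    refine (ae_restrict_iff_subtype (μ := (volume : Measure ℝ))
      (measurableSet_Ioi (a := (0 : ℝ)))).2 ?_
    filter_upwards [hk'] with s hs _
    apply hs
    have : (0:ℝ) < s := s.2
    simp [this.ne']
  classical
  -- To pass from the variable `s` to `r`, preimages of null sets under `sinh` must be null; they
  -- are images under the differentiable function `arsinh`.
  have hsinh : Measure.QuasiMeasurePreserving Real.sinh (volume.restrict (Set.Ioi (0 : ℝ)))
      (volume.restrict (Set.Ioi (0 : ℝ))) := by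
    refine ⟨Real.continuous_sinh.measurable, ?_⟩
    refine Measure.AbsolutelyContinuous.mk fun t ht h0 => ?_
    rw [Measure.map_apply Real.continuous_sinh.measurable ht,
      Measure.restrict_apply (Real.continuous_sinh.measurable ht)]
    rw [Measure.restrict_apply ht] at h0
    have : Real.sinh ⁻¹' t ∩ Set.Ioi 0 ⊆ Real.arsinh '' (t ∩ Set.Ioi 0) := fun r hr =>
      ⟨Real.sinh r, ⟨hr.1, Real.sinh_pos_iff.2 hr.2⟩, Real.arsinh_sinh r⟩
    refine measure_mono_null this ?_
    exact addHaar_image_eq_zero_of_differentiableOn_of_addHaar_eq_zero volume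
      Real.differentiable_arsinh.differentiableOn h0
  let K : ℝ → ℂ := fun s => if hs : s ∈ Set.Ioi (0 : ℝ) then k ⟨s, hs⟩ else 0
  have hK : StronglyMeasurable K :=
    (hk.measurable.dite (f := fun s : Set.Ioi (0:ℝ) => k s) (g := fun _ => (0 : ℂ))
      measurable_const measurableSet_Ioi).stronglyMeasurable
  refine ⟨fun r => K (Real.sinh r), hK.comp_measurable Real.continuous_sinh.measurable, ?_⟩
  refine ae_radialMeasure_iff.2 ?_
  filter_upwards [hsinh.ae h6, ae_restrict_mem measurableSet_Ioi] with r hr hr0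
  have h0 : Real.sinh r ∈ Set.Ioi (0 : ℝ) := Real.sinh_pos_iff.2 hr0
  have := hr h0
  rw [Real.arsinh_sinh] at this
  rw [this]
  simp only [K, dif_pos h0]

/-! ### Linearity and symmetry of the Laplacian. -/

theorem partialDeriv_add {h k : E3 → ℂ} (hh : ContDiff ℝ ∞ h) (hk : ContDiff ℝ ∞ k) (i : Fin 3)
    (x : E3) : partialDeriv i (h + k) x = partialDeriv i h x + partialDeriv i k x := by
  rw [partialDeriv, fderiv_add (hh.differentiable (by simp) x) (hk.differentiable (by simp) x)]
  rfl

theorem partialDeriv_smul (c : ℂ) {h : E3 → ℂ} (hh : ContDiff ℝ ∞ h) (i : Fin 3)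
    (x : E3) : partialDeriv i (c • h) x = c * partialDeriv i h x := by
  rw [partialDeriv, fderiv_const_smul (hh.differentiable (by simp) x)]
  rfl

theorem hypFlux_add {h k : E3 → ℂ} (hh : ContDiff ℝ ∞ h) (hk : ContDiff ℝ ∞ k) (i : Fin 3) :
    hypFlux (h + k) i = hypFlux h i + hypFlux k i := by
  ext x
  simp only [hypFlux, partialDeriv_add hh hk, Pi.add_apply, mul_add, Finset.sum_add_distrib]

theorem hypFlux_smul (c : ℂ) {h : E3 → ℂ} (hh : ContDiff ℝ ∞ h) (i : Fin 3) :
    hypFlux (c • h) i = c • hypFlux h i := by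
  ext x
  simp only [hypFlux, partialDeriv_smul c hh, Pi.smul_apply, smul_eq_mul, Fin.sum_univ_three]
  ring

theorem chartLaplacian_add {h k : E3 → ℂ} (hh : ContDiff ℝ ∞ h) (hk : ContDiff ℝ ∞ k) :
    chartLaplacian (h + k) = chartLaplacian h + chartLaplacian k := by
  ext x
  simp only [chartLaplacian_eq, hypFlux_add hh hk, Pi.add_apply,
    partialDeriv_add (contDiff_hypFlux hh _) (contDiff_hypFlux hk _), Finset.sum_add_distrib,
    mul_add]

theorem chartLaplacian_smul (c : ℂ) {h : E3 → ℂ} (hh : ContDiff ℝ ∞ h) :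
    chartLaplacian (c • h) = c • chartLaplacian h := by
  ext x
  simp only [chartLaplacian_eq, hypFlux_smul c hh, Pi.smul_apply, smul_eq_mul,
    partialDeriv_smul c (contDiff_hypFlux hh _), Fin.sum_univ_three]
  ring

/-- Pairs `(φ, Δφ)` with `φ` a test function, as a subspace of `L² × L²`. -/
def testGraph : Submodule ℂ (L2Hyp3 × L2Hyp3) where
  carrier := {p | ∃ φ : Hyp3 → ℂ, IsTestFunction φ ∧
    p.1 =ᵐ[hypVol] φ ∧ p.2 =ᵐ[hypVol] laplaceBeltrami φ}
  zero_mem' := by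
    refine ⟨0, ⟨contDiff_const, HasCompactSupport.zero⟩, Lp.coeFn_zero _ _ _, ?_⟩
    refine (Lp.coeFn_zero _ _ _).trans (Eventually.of_forall fun Ω => ?_)
    have := congrFun (chartLaplacian_smul 0 (h := fun _ => 0) contDiff_const) Ω.1.2
    simp only [zero_smul] at this
    exact this.symm
  add_mem' := by
    rintro p q ⟨φ, hφ, h1, h2⟩ ⟨ψ, hψ, h3, h4⟩
    refine ⟨φ + ψ, ⟨hφ.1.add hψ.1, hφ.2.add hψ.2⟩, (Lp.coeFn_add _ _).trans (h1.add h3),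
      (Lp.coeFn_add _ _).trans ((h2.add h4).trans (Eventually.of_forall fun Ω => ?_))⟩
    exact (congrFun (chartLaplacian_add hφ.1 hψ.1) Ω.1.2).symm
  smul_mem' := by
    rintro c p ⟨φ, hφ, h1, h2⟩
    refine ⟨c • φ, ⟨contDiff_const.smul hφ.1, hφ.2.smul_left (f := fun _ => c)⟩,
      (Lp.coeFn_smul _ _).trans (h1.const_smul c),
      (Lp.coeFn_smul _ _).trans ((h2.const_smul c).trans (Eventually.of_forall fun Ω => ?_))⟩
    exact (congrFun (chartLaplacian_smul c hφ.1) Ω.1.2).symm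

/-- The graph of the Laplacian as a closed subspace. -/
def laplacianSubmodule : Submodule ℂ (L2Hyp3 × L2Hyp3) := testGraph.topologicalClosure

theorem mem_laplacianSubmodule {p : L2Hyp3 × L2Hyp3} :
    p ∈ laplacianSubmodule ↔ p ∈ laplacianGraph := Iff.rfl

theorem isClosed_laplacianGraph : IsClosed laplacianGraph := isClosed_closure

theorem hasCompactSupport_comp_hypParam {φ : Hyp3 → ℂ} (hφ : HasCompactSupport φ) :
    HasCompactSupport fun x => φ (hypParam x) :=
  hφ.comp_homeomorph hypHomeo

theorem hasCompactSupport_partialDeriv {h : E3 → ℂ} (hh : HasCompactSupport h) (i : Fin 3) :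
    HasCompactSupport (partialDeriv i h) :=
  hh.fderiv_apply ℝ _

theorem integral_mul_partialDeriv {f g : E3 → ℂ} (hf : ContDiff ℝ ∞ f) (hf' : HasCompactSupport f)
    (hg : ContDiff ℝ ∞ g) (i : Fin 3) :
    ∫ x, f x * partialDeriv i g x = -∫ x, partialDeriv i f x * g x := by
  refine integral_mul_fderiv_eq_neg_fderiv_mul_of_integrable ?_ ?_ ?_
    (fun x _ => hf.differentiable (by simp) x) (fun x _ => hg.differentiable (by simp) x)
  · exact ((contDiff_partialDeriv hf i).continuous.mul hg.continuous).integrable_of_hasCompactSupport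
      (hasCompactSupport_partialDeriv hf' i).mul_right
  · exact (hf.continuous.mul (contDiff_partialDeriv hg i).continuous).integrable_of_hasCompactSupport
      hf'.mul_right
  · exact (hf.continuous.mul hg.continuous).integrable_of_hasCompactSupport hf'.mul_right

theorem partialDeriv_conj {h : E3 → ℂ} (hh : ContDiff ℝ ∞ h) (i : Fin 3) (x : E3) :
    partialDeriv i (fun y => (starRingEnd ℂ) (h y)) x = (starRingEnd ℂ) (partialDeriv i h x) := by
  have := (Complex.conjCLE.toContinuousLinearMap.hasFDerivAt.comp x
    (hh.differentiable (by simp) x).hasFDerivAt).fderiv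
  rw [partialDeriv]
  erw [this]
  rfl

/-- Green's identity: the volume density cancels the prefactor of the Laplacian, and one integrates
by parts. Compact support of `h` alone removes the boundary terms. -/
theorem integral_conj_mul_chartLaplacian {h k : E3 → ℂ} (hh : ContDiff ℝ ∞ h)
    (hh' : HasCompactSupport h) (hk : ContDiff ℝ ∞ k) :
    ∫ x, (hypDensity x : ℂ) * (chartLaplacian k x * (starRingEnd ℂ) (h x)) =
      -∫ x, ∑ i, (starRingEnd ℂ) (partialDeriv i h x) * hypFlux k i x := by
  have hc : ContDiff ℝ ∞ fun y => (starRingEnd ℂ) (h y) := Complex.conjCLE.contDiff.comp hh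
  have hc' : HasCompactSupport fun y => (starRingEnd ℂ) (h y) :=
    hh'.comp_left (g := starRingEnd ℂ) (map_zero _)
  have hi1 (i : Fin 3) : Integrable
      fun x => (starRingEnd ℂ) (h x) * partialDeriv i (hypFlux k i) x :=
    (hc.continuous.mul (contDiff_partialDeriv
      (contDiff_hypFlux hk i) i).continuous).integrable_of_hasCompactSupport hc'.mul_right
  have hi2 (i : Fin 3) : Integrable
      fun x => (starRingEnd ℂ) (partialDeriv i h x) * hypFlux k i x := by
    refine ((Complex.continuous_conj.comp (contDiff_partialDeriv hh i).continuous).mul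
      (contDiff_hypFlux hk i).continuous).integrable_of_hasCompactSupport ?_
    exact HasCompactSupport.mul_right
      ((hasCompactSupport_partialDeriv hh' i).comp_left (g := starRingEnd ℂ) (map_zero _))
  have : ∀ x, (hypDensity x : ℂ) * (chartLaplacian k x * (starRingEnd ℂ) (h x)) =
      ∑ i, (starRingEnd ℂ) (h x) * partialDeriv i (hypFlux k i) x := by
    intro x
    rw [chartLaplacian_eq, ← Finset.mul_sum]
    have h1 : (hypDensity x : ℂ) ≠ 0 := by exact_mod_cast (hypDensity_pos x).ne'
    push_cast
    field_simp
  simp only [this]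
  rw [integral_finsetSum _ fun i _ => hi1 i, integral_finsetSum _ fun i _ => hi2 i,
    ← Finset.sum_neg_distrib]
  refine Finset.sum_congr rfl fun i _ => ?_
  rw [integral_mul_partialDeriv hc hc' (contDiff_hypFlux hk i)]
  simp only [partialDeriv_conj hh]

/-- The Dirichlet form is Hermitian because the inverse metric is real and symmetric. -/
theorem sum_conj_mul_hypFlux (h k : E3 → ℂ) (x : E3) :
    ∑ i, (starRingEnd ℂ) (partialDeriv i h x) * hypFlux k i x =
      (starRingEnd ℂ) (∑ i, (starRingEnd ℂ) (partialDeriv i k x) * hypFlux h i x) := by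
  simp only [hypFlux, inv_hypMetric, Matrix.of_apply, Fin.sum_univ_three]
  simp
  ring

theorem inner_eq_of_test {p q : L2Hyp3 × L2Hyp3} (hp : p ∈ testGraph) (hq : q ∈ testGraph) :
    inner ℂ p.1 q.2 = inner ℂ p.2 q.1 := by
  obtain ⟨φ, hφ, h1, h2⟩ := hp
  obtain ⟨ψ, hψ, h3, h4⟩ := hq
  have key {p q : L2Hyp3} {φ ψ : Hyp3 → ℂ} (hφ : IsTestFunction φ) (hψ : IsTestFunction ψ)
      (h1 : p =ᵐ[hypVol] φ) (h4 : q =ᵐ[hypVol] laplaceBeltrami ψ) :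
      inner ℂ p q = -∫ x, ∑ i, (starRingEnd ℂ) (partialDeriv i (fun x => φ (hypParam x)) x) *
        hypFlux (fun x => ψ (hypParam x)) i x := by
    rw [← integral_conj_mul_chartLaplacian hφ.1 (hasCompactSupport_comp_hypParam hφ.2) hψ.1,
      L2.inner_def]
    have : (fun a => inner ℂ (p a) (q a)) =ᵐ[hypVol]
        fun a => laplaceBeltrami ψ a * (starRingEnd ℂ) (φ a) := by
      filter_upwards [h1, h4] with a ha hb
      rw [ha, hb, RCLike.inner_apply]
    rw [integral_congr_ae this, integral_hypVol]
    rfl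
  rw [← inner_conj_symm p.2, key hφ hψ h1 h4, key hψ hφ h3 h2, map_neg, ← integral_conj]
  simp only [← sum_conj_mul_hypFlux]

/-- Symmetry on test functions extends to the closure of the graph one argument at a time, the
identity being a closed condition in each. -/
theorem inner_laplacian_symm {p q : L2Hyp3 × L2Hyp3} (hp : p ∈ laplacianGraph)
    (hq : q ∈ laplacianGraph) : inner ℂ p.1 q.2 = inner ℂ p.2 q.1 := by
  have h1 : laplacianGraph ⊆ {p | ∀ q ∈ testGraph, inner ℂ p.1 q.2 = inner ℂ p.2 q.1} := by
    refine closure_minimal (fun p hp q hq => inner_eq_of_test hp hq) ?_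
    simp only [Set.ofPred_forall]
    exact isClosed_iInter fun q => isClosed_iInter fun _ => isClosed_eq (by fun_prop) (by fun_prop)
  have h2 : laplacianGraph ⊆ {q | inner ℂ p.1 q.2 = inner ℂ p.2 q.1} :=
    closure_minimal (fun q hq => h1 hp q hq) (isClosed_eq (by fun_prop) (by fun_prop))
  exact h2 hq

/-! ### Linearity and uniqueness of the free evolution. -/

theorem IsFreeEvolution.add {u₀ v₀ : L2Hyp3} {u v : ℝ → L2Hyp3} (hu : IsFreeEvolution u₀ u)
    (hv : IsFreeEvolution v₀ v) : IsFreeEvolution (u₀ + v₀) (u + v) := by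
  refine ⟨hu.continuous.add hv.continuous, by simp [hu.initial, hv.initial], fun t => ?_⟩
  have := laplacianSubmodule.add_mem (hu.mild t) (hv.mild t)
  rw [← mem_laplacianSubmodule]
  convert! this using 1
  simp only [Pi.add_apply, Prod.mk_add_mk]
  rw [intervalIntegral.integral_add (hu.continuous.intervalIntegrable _ _)
    (hv.continuous.intervalIntegrable _ _), ← smul_add]
  congr 2
  abel

theorem IsFreeEvolution.smul (c : ℂ) {u₀ : L2Hyp3} {u : ℝ → L2Hyp3} (hu : IsFreeEvolution u₀ u) :
    IsFreeEvolution (c • u₀) (c • u) := by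
  refine ⟨hu.continuous.const_smul c, by simp [hu.initial], fun t => ?_⟩
  have := laplacianSubmodule.smul_mem c (hu.mild t)
  rw [← mem_laplacianSubmodule]
  convert! this using 1
  simp only [Pi.smul_apply, Prod.smul_mk]
  rw [intervalIntegral.integral_smul, ← smul_sub, smul_comm]

theorem IsFreeEvolution.sub {u₀ v₀ : L2Hyp3} {u v : ℝ → L2Hyp3} (hu : IsFreeEvolution u₀ u)
    (hv : IsFreeEvolution v₀ v) : IsFreeEvolution (u₀ - v₀) (u - v) := by
  simpa [sub_eq_add_neg] using hu.add (hv.smul (-1))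

/-- With `W(t) = ∫₀ᵗ w` the mild equation reads `W' = iΔW`. Symmetry makes `⟨W, ΔW⟩` real, so `‖W‖²`
is constant, hence zero, and `w = W'` vanishes. -/
theorem IsFreeEvolution.eq_zero {w : ℝ → L2Hyp3} (hw : IsFreeEvolution 0 w) : w = 0 := by
  set W : ℝ → L2Hyp3 := fun t => ∫ s in (0 : ℝ)..t, w s
  have hW (t : ℝ) : HasDerivAt W (w t) t :=
    intervalIntegral.integral_hasDerivAt_right (hw.continuous.intervalIntegrable _ _)
      (hw.continuous.stronglyMeasurableAtFilter _ _) hw.continuous.continuousAt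
  have hd (t : ℝ) : HasDerivAt (fun t => inner ℂ (W t) (W t)) (0 : ℂ) t := by
    have h1 := (hW t).inner ℂ (hW t)
    have h2 := hw.mild t
    rw [sub_zero] at h2
    have h3 := inner_laplacian_symm h2 h2
    simp only [inner_smul_left, inner_smul_right] at h3
    have h4 : inner ℂ (W t) (w t) + inner ℂ (w t) (W t) = 0 := by
      simp at h3
      linear_combination Complex.I * h3 + (inner ℂ (W t) (w t) + inner ℂ (w t) (W t)) * Complex.I_sq
    rwa [h4] at h1
  have hz (t : ℝ) : W t = 0 := by
    have := is_const_of_deriv_eq_zero (fun t => (hd t).differentiableAt) (fun t => (hd t).deriv) t 0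
    rw [show W 0 = 0 from intervalIntegral.integral_same, inner_zero_left] at this
    exact inner_self_eq_zero.1 this
  ext1 t
  have h1 := hW t
  rw [show W = fun _ => 0 from funext hz] at h1
  exact h1.unique (hasDerivAt_const t 0)

theorem IsFreeEvolution.unique {u₀ : L2Hyp3} {u v : ℝ → L2Hyp3} (hu : IsFreeEvolution u₀ u)
    (hv : IsFreeEvolution u₀ v) : u = v := by
  have h := hu.sub hv
  rw [sub_self] at h
  exact sub_eq_zero.1 h.eq_zero

/-! ### Convergence in `L²`. -/

theorem eLpNorm_two_sq {α E : Type*} [MeasurableSpace α] [NormedAddCommGroup E] (μ : Measure α)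
    (f : α → E) : eLpNorm f 2 μ ^ 2 = ∫⁻ x, ‖f x‖ₑ ^ 2 ∂μ := by
  have := eLpNorm_nnreal_pow_eq_lintegral (μ := μ) (f := f) (p := 2) (by simp)
  simpa using this

theorem ennreal_tendsto_zero_of_sq {ι : Type*} {l : Filter ι} {a : ι → ENNReal}
    (h : Tendsto (fun i => a i ^ 2) l (𝓝 0)) : Tendsto a l (𝓝 0) := by
  have := (ENNReal.continuous_rpow_const (y := 1 / 2)).tendsto 0 |>.comp h
  simp only [Function.comp_def] at this
  rw [ENNReal.zero_rpow_of_pos (by norm_num)] at this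
  refine this.congr fun i => ?_
  rw [← ENNReal.rpow_natCast, ← ENNReal.rpow_mul]
  norm_num

/-- Dominated convergence in `L²`. -/
theorem tendsto_eLpNorm_two_of_dominated {α E ι : Type*} [MeasurableSpace α] [NormedAddCommGroup E]
    {μ : Measure α} {l : Filter ι} [l.IsCountablyGenerated] {F : ι → α → E} {D : α → ℝ}
    (hm : ∀ᶠ i in l, AEStronglyMeasurable (F i) μ) (hD : MemLp D 2 μ)
    (hb : ∀ᶠ i in l, ∀ᵐ x ∂μ, ‖F i x‖ ≤ D x) (hl : ∀ᵐ x ∂μ, Tendsto (fun i => F i x) l (𝓝 0)) :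
    Tendsto (fun i => eLpNorm (F i) 2 μ) l (𝓝 0) := by
  apply ennreal_tendsto_zero_of_sq
  simp only [eLpNorm_two_sq]
  rw [show (0 : ENNReal) = ∫⁻ _, 0 ∂μ by simp]
  refine tendsto_lintegral_filter_of_dominated_convergence' (fun x => ‖D x‖ₑ ^ 2) ?_ ?_ ?_ ?_
  · filter_upwards [hm] with i hi
    exact hi.enorm.pow_const 2
  · filter_upwards [hb] with i hi
    filter_upwards [hi] with x hx
    gcongr
    rw [← ofReal_norm, Real.enorm_eq_ofReal_abs]
    exact ENNReal.ofReal_le_ofReal (hx.trans (le_abs_self _))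
  · rw [← eLpNorm_two_sq]
    exact ENNReal.pow_ne_top hD.eLpNorm_ne_top
  · filter_upwards [hl] with x hx
    have := (ENNReal.continuous_pow 2).tendsto 0 |>.comp
      ((continuous_enorm.tendsto (0 : E)).comp hx |>.trans (by simp))
    simpa [Function.comp_def] using this

/-! ### The function `r / sinh r` in the variable `s = sinh² r`. -/

/-- Moments `∫₀¹ y^{2k} (1 + s y²)^{-1/2-k} dy`; they are, up to constants, the successive
derivatives of `arsinh √s / √s`. -/
def arsinhMoment (k : ℕ) (s : ℝ) : ℝ :=
  ∫ y in (0 : ℝ)..1, y ^ (2 * k) * (1 + s * y ^ 2) ^ (-(1 / 2 : ℝ) - k)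

/-- The half-line `s > -1/2` is an open neighbourhood of `[0, ∞)` on which the base of the powers
stays away from zero, so that smoothness at `s = 0` is two-sided. -/
theorem half_lt_one_add_mul_sq {s y : ℝ} (hs : -(1 / 2) < s) (hy : y ∈ Set.Icc (0 : ℝ) 1) :
    1 / 2 ≤ 1 + s * y ^ 2 := by
  have h1 : y ^ 2 ≤ 1 := pow_le_one₀ hy.1 hy.2
  nlinarith [sq_nonneg y]

theorem hasDerivAt_arsinhMoment (k : ℕ) {s : ℝ} (hs : -(1 / 2) < s) :
    HasDerivAt (arsinhMoment k) ((-(1 / 2 : ℝ) - k) * arsinhMoment (k + 1) s) s := by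
  have hcont (j : ℕ) (t : ℝ) (ht : -(1 / 2) < t) :
      ContinuousOn (fun y : ℝ => y ^ (2 * j) * (1 + t * y ^ 2) ^ (-(1 / 2 : ℝ) - j))
        (Set.Icc 0 1) := by
    refine ContinuousOn.mul (by fun_prop) (ContinuousOn.rpow_const (by fun_prop) fun y hy => ?_)
    left
    have := half_lt_one_add_mul_sq ht hy
    positivity
  have hnhds : Set.Ioi (-(1 / 2) : ℝ) ∈ 𝓝 s := Ioi_mem_nhds hs
  have hmeas (j : ℕ) (t : ℝ) (ht : -(1 / 2) < t) : AEStronglyMeasurable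
      (fun y : ℝ => y ^ (2 * j) * (1 + t * y ^ 2) ^ (-(1 / 2 : ℝ) - j))
      (volume.restrict (Set.uIoc 0 1)) := by
    rw [Set.uIoc_of_le zero_le_one]
    exact ((hcont j t ht).mono Set.Ioc_subset_Icc_self).aestronglyMeasurable measurableSet_Ioc
  have := intervalIntegral.hasDerivAt_integral_of_dominated_loc_of_deriv_le
    (μ := volume) (a := 0) (b := 1) (x₀ := s) (s := Set.Ioi (-(1 / 2) : ℝ))
    (F := fun t y => y ^ (2 * k) * (1 + t * y ^ 2) ^ (-(1 / 2 : ℝ) - k))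
    (F' := fun t y => (-(1 / 2 : ℝ) - k) *
      (y ^ (2 * (k + 1)) * (1 + t * y ^ 2) ^ (-(1 / 2 : ℝ) - (k + 1 : ℕ))))
    -- The exponent is negative, the base is at least `1/2` and `y ≤ 1`, so a constant dominates the
    -- derivative.
    (bound := fun _ => (1 / 2 + k) * (1 / 2 : ℝ) ^ (-(1 / 2 : ℝ) - (k + 1 : ℕ))) hnhds
    ?_ ?_ ?_ ?_ ?_ ?_
  · convert! this.2 using 1
    rw [intervalIntegral.integral_const_mul]
    rfl
  · filter_upwards [hnhds] with t ht using hmeas k t ht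
  · exact ((hcont k s hs).mono (by rw [Set.uIcc_of_le zero_le_one])).intervalIntegrable
  · exact (hmeas (k + 1) s hs).const_mul _
  · refine Eventually.of_forall fun y hy t ht => ?_
    rw [Set.uIoc_of_le zero_le_one] at hy
    have hy' : y ∈ Set.Icc (0 : ℝ) 1 := ⟨hy.1.le, hy.2⟩
    have h1 := half_lt_one_add_mul_sq ht hy'
    have h2 : (0 : ℝ) < 1 + t * y ^ 2 := by linarith
    have h3 : |(-(1 / 2 : ℝ) - k)| = 1 / 2 + k := by
      rw [abs_of_nonpos (by linarith [(k.cast_nonneg : (0 : ℝ) ≤ k)])]; ring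
    rw [Real.norm_eq_abs, abs_mul, h3, abs_of_nonneg (by have := hy'.1; positivity)]
    gcongr
    have h4 : y ^ (2 * (k + 1)) ≤ 1 := pow_le_one₀ hy'.1 hy'.2
    have h5 : (1 + t * y ^ 2) ^ (-(1 / 2 : ℝ) - (k + 1 : ℕ)) ≤
        (1 / 2 : ℝ) ^ (-(1 / 2 : ℝ) - (k + 1 : ℕ)) :=
      Real.rpow_le_rpow_of_nonpos (by norm_num) h1 (by push_cast; linarith [(k.cast_nonneg : (0 : ℝ) ≤ k)])
    calc _ ≤ 1 * (1 + t * y ^ 2) ^ (-(1 / 2 : ℝ) - (k + 1 : ℕ)) := by gcongr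
      _ ≤ _ := by rwa [one_mul]
  · exact intervalIntegrable_const
  · refine Eventually.of_forall fun y hy t ht => ?_
    rw [Set.uIoc_of_le zero_le_one] at hy
    have h1 := half_lt_one_add_mul_sq ht ⟨hy.1.le, hy.2⟩
    have h2 : (1 + t * y ^ 2) ≠ 0 := by linarith
    have h3 : HasDerivAt (fun t : ℝ => 1 + t * y ^ 2) (y ^ 2) t := by
      simpa using ((hasDerivAt_id t).mul_const (y ^ 2)).const_add 1
    convert! (h3.rpow_const (p := -(1 / 2 : ℝ) - k) (Or.inl h2)).const_mul (y ^ (2 * k)) using 1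
    push_cast
    rw [show (-(1 / 2 : ℝ) - (k + 1)) = -(1 / 2 : ℝ) - k - 1 by ring]
    ring

/-- The derivative of each moment is a multiple of the next one, so the order of smoothness is
raised by induction for all moments at once. -/
theorem contDiffOn_arsinhMoment (n k : ℕ) :
    ContDiffOn ℝ n (arsinhMoment k) (Set.Ioi (-(1 / 2))) := by
  induction n generalizing k with
  | zero =>
    refine contDiffOn_zero.2 fun s hs => ?_
    exact (hasDerivAt_arsinhMoment k hs).continuousAt.continuousWithinAt
  | succ n ih =>
    push_cast
    rw [contDiffOn_succ_iff_deriv_of_isOpen isOpen_Ioi]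
    refine ⟨fun s hs => (hasDerivAt_arsinhMoment k hs).differentiableAt.differentiableWithinAt,
      by simp, ?_⟩
    refine (contDiffOn_const.mul (ih (k + 1))).congr fun s hs =>
      (hasDerivAt_arsinhMoment k hs).deriv

/-- The smooth function `arsinh √s / √s`. -/
def arsinhRatio (s : ℝ) : ℝ := arsinhMoment 0 s

/-- Derivative of `arsinhRatio`. -/
def arsinhRatio' (s : ℝ) : ℝ := -(1 / 2) * arsinhMoment 1 s

/-- Second derivative of `arsinhRatio`. -/
def arsinhRatio'' (s : ℝ) : ℝ := 3 / 4 * arsinhMoment 2 s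

theorem contDiffOn_arsinhRatio : ContDiffOn ℝ ∞ arsinhRatio (Set.Ioi (-(1 / 2))) :=
  contDiffOn_infty.2 fun n => contDiffOn_arsinhMoment n 0

theorem hasDerivAt_arsinhRatio {s : ℝ} (hs : -(1 / 2) < s) :
    HasDerivAt arsinhRatio (arsinhRatio' s) s := by
  convert! hasDerivAt_arsinhMoment 0 hs using 1
  simp [arsinhRatio']

theorem hasDerivAt_arsinhRatio' {s : ℝ} (hs : -(1 / 2) < s) :
    HasDerivAt arsinhRatio' (arsinhRatio'' s) s := by
  convert! (hasDerivAt_arsinhMoment 1 hs).const_mul (-(1 / 2 : ℝ)) using 1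
  simp [arsinhRatio'']
  ring

/-- `(1 + s)^{-1/2}`. -/
def invSqrt (s : ℝ) : ℝ := (1 + s) ^ (-(1 / 2) : ℝ)

theorem invSqrt_sq {s : ℝ} (hs : -(1 / 2) < s) : (1 + s) * invSqrt s ^ 2 = 1 := by
  have h : (0 : ℝ) < 1 + s := by linarith
  rw [invSqrt, ← Real.rpow_natCast, ← Real.rpow_mul h.le]
  norm_num
  rw [Real.rpow_neg_one, mul_inv_cancel₀ h.ne']

theorem hasDerivAt_invSqrt {s : ℝ} (hs : -(1 / 2) < s) :
    HasDerivAt invSqrt (-(1 / 2) * invSqrt s ^ 3) s := by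
  have h : (0 : ℝ) < 1 + s := by linarith
  have := ((hasDerivAt_id s).const_add 1).rpow_const (p := -(1 / 2 : ℝ)) (Or.inl h.ne')
  convert! this using 1
  rw [invSqrt, ← Real.rpow_natCast, ← Real.rpow_mul h.le]
  norm_num

/-- Integrate the derivative of `y (1 + s y²)^{-1/2}` over `[0, 1]`. In the variable `r` this is the
derivative of `sinh r · (r / sinh r) = r`. -/
theorem arsinhRatio_ode {s : ℝ} (hs : -(1 / 2) < s) :
    2 * s * arsinhRatio' s + arsinhRatio s = invSqrt s := by
  have hd (y : ℝ) (hy : y ∈ Set.Icc (0 : ℝ) 1) :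
      HasDerivAt (fun y : ℝ => y * (1 + s * y ^ 2) ^ (-(1 / 2) : ℝ))
        ((1 + s * y ^ 2) ^ (-(1 / 2) : ℝ) - s * (y ^ 2 * (1 + s * y ^ 2) ^ (-(1 / 2) - 1 : ℝ))) y := by
    have h1 := half_lt_one_add_mul_sq hs hy
    have h2 : (1 + s * y ^ 2) ≠ 0 := by linarith
    have h3 : HasDerivAt (fun y : ℝ => 1 + s * y ^ 2) (s * (2 * y)) y := by
      simpa using ((hasDerivAt_pow 2 y).const_mul s).const_add 1
    convert! (hasDerivAt_id y).mul (h3.rpow_const (p := -(1 / 2 : ℝ)) (Or.inl h2)) using 1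
    simp only [id]
    ring
  have hc (p : ℝ) : ContinuousOn (fun y : ℝ => (1 + s * y ^ 2) ^ p) (Set.uIcc 0 1) := by
    rw [Set.uIcc_of_le zero_le_one]
    refine ContinuousOn.rpow_const (by fun_prop) fun y hy => ?_
    have := half_lt_one_add_mul_sq hs hy
    left
    positivity
  have hi1 : IntervalIntegrable (fun y : ℝ => (1 + s * y ^ 2) ^ (-(1 / 2) : ℝ)) volume 0 1 :=
    (hc _).intervalIntegrable
  have hi2 : IntervalIntegrable
      (fun y : ℝ => y ^ 2 * (1 + s * y ^ 2) ^ (-(1 / 2) - 1 : ℝ)) volume 0 1 :=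
    (ContinuousOn.mul (by fun_prop) (hc _)).intervalIntegrable
  have hftc := intervalIntegral.integral_eq_sub_of_hasDerivAt (a := (0 : ℝ)) (b := 1)
    (fun y hy => hd y (by rwa [Set.uIcc_of_le zero_le_one] at hy)) (hi1.sub (hi2.const_mul s))
  rw [intervalIntegral.integral_sub hi1 (hi2.const_mul s), intervalIntegral.integral_const_mul]
    at hftc
  simp only [arsinhRatio, arsinhRatio', arsinhMoment, invSqrt]
  norm_num at hftc ⊢
  linarith

/-- The derivative of the preceding identity. -/
theorem arsinhRatio_ode' {s : ℝ} (hs : -(1 / 2) < s) :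
    2 * s * arsinhRatio'' s + 3 * arsinhRatio' s = -(1 / 2) * invSqrt s ^ 3 := by
  have h1 := (((hasDerivAt_id s).const_mul 2).mul (hasDerivAt_arsinhRatio' hs)).add
    (hasDerivAt_arsinhRatio hs)
  have h2 := (hasDerivAt_invSqrt hs).congr_of_eventuallyEq
    (f₁ := fun s => 2 * s * arsinhRatio' s + arsinhRatio s) (by
      filter_upwards [Ioi_mem_nhds hs] with t ht using arsinhRatio_ode ht)
  have := h1.unique h2
  simp only [id] at this
  linarith

theorem invSqrt_le_arsinhRatio {s : ℝ} (hs : 0 ≤ s) : invSqrt s ≤ arsinhRatio s := by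
  have h : ∫ y in (0 : ℝ)..1, invSqrt s ≤ arsinhRatio s := by
    refine intervalIntegral.integral_mono_on zero_le_one intervalIntegrable_const ?_ ?_
    · refine ContinuousOn.intervalIntegrable
        (ContinuousOn.mul (by fun_prop) (ContinuousOn.rpow_const (by fun_prop) fun y _ => ?_))
      left
      positivity
    · intro y hy
      simp only [mul_zero, pow_zero, one_mul, Nat.cast_zero, sub_zero, invSqrt]
      refine Real.rpow_le_rpow_of_nonpos (by positivity) ?_ (by norm_num)
      have : y ^ 2 ≤ 1 := pow_le_one₀ hy.1 hy.2
      nlinarith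
  simpa using h

theorem invSqrt_pos {s : ℝ} (hs : -(1 / 2) < s) : 0 < invSqrt s :=
  Real.rpow_pos_of_pos (by linarith) _

theorem arsinhRatio_pos {s : ℝ} (hs : 0 ≤ s) : 0 < arsinhRatio s :=
  (invSqrt_pos (by linarith)).trans_le (invSqrt_le_arsinhRatio hs)

/-- This identifies `arsinhRatio` at `sinh² r` with `r / sinh r`. By `arsinhRatio_ode` the
difference of the two sides has derivative `cosh r · invSqrt (sinh² r) - 1 = 0`, and it vanishes at
`r = 0`. -/
theorem sinh_mul_arsinhRatio (r : ℝ) : Real.sinh r * arsinhRatio (Real.sinh r ^ 2) = r := by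
  have hpos (r : ℝ) : -(1 / 2) < Real.sinh r ^ 2 := by nlinarith [sq_nonneg (Real.sinh r)]
  have hd (r : ℝ) :
      HasDerivAt (fun r => Real.sinh r * arsinhRatio (Real.sinh r ^ 2) - r) 0 r := by
    have h1 := (Real.hasDerivAt_sinh r).pow 2
    have h2 := (hasDerivAt_arsinhRatio (hpos r)).comp r h1
    convert! ((Real.hasDerivAt_sinh r).mul h2).sub (hasDerivAt_id r) using 1
    have h3 := arsinhRatio_ode (hpos r)
    have h4 : Real.cosh r * invSqrt (Real.sinh r ^ 2) = 1 := by
      have h5 := invSqrt_sq (hpos r)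
      rw [show 1 + Real.sinh r ^ 2 = Real.cosh r ^ 2 by rw [Real.cosh_sq]; ring, ← mul_pow] at h5
      refine (pow_eq_one_iff_of_nonneg ?_ two_ne_zero).1 h5
      exact mul_nonneg (Real.cosh_pos r).le (invSqrt_pos (hpos r)).le
    simp
    linear_combination (-Real.cosh r) * h3 - h4
  have := is_const_of_deriv_eq_zero (fun t => (hd t).differentiableAt) (fun t => (hd t).deriv) r 0
  simp at this
  linarith

/-! ### Cutoffs, and radial functions in the domain of the Laplacian. -/

/-- The radial function on `Hyp3` with value `g (|x|²)`. -/
def radialOf {V : Type*} (g : ℝ → V) (Ω : Hyp3) : V := g (‖Ω.1.2‖ ^ 2)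

theorem continuous_radialOf {V : Type*} [TopologicalSpace V] {g : ℝ → V}
    (hg : ContinuousOn g (Set.Ici 0)) :
    Continuous (radialOf g) :=
  hg.comp_continuous (by fun_prop) fun Ω => by simp

theorem radialOf_eq {V : Type*} (g : ℝ → V) (Ω : Hyp3) :
    radialOf g Ω = g (Real.sinh (hypRadius Ω) ^ 2) := by
  rw [radialOf, hypRadius, Real.sinh_arsinh]

theorem contDiff_comp_norm_sq {φ : ℝ → ℂ} (hφ : ContDiffOn ℝ ∞ φ (Set.Ioi (-(1 / 2)))) :
    ContDiff ℝ ∞ fun x : E3 => φ (‖x‖ ^ 2) := by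
  refine contDiff_iff_contDiffAt.2 fun x => ?_
  have h : (-(1 / 2) : ℝ) < ‖x‖ ^ 2 := by nlinarith [sq_nonneg ‖x‖]
  exact ((hφ.contDiffAt (Ioi_mem_nhds h)).comp x (contDiff_norm_sq ℝ).contDiffAt)

/-- A smooth cutoff function: `1` for `s ≤ 1` and `0` for `s ≥ 2`. -/
def cutoff (s : ℝ) : ℝ := Real.smoothTransition (2 - s)

theorem contDiff_cutoff : ContDiff ℝ ∞ cutoff :=
  Real.smoothTransition.contDiff.comp (contDiff_const.sub contDiff_id)

theorem cutoff_of_le {s : ℝ} (hs : s ≤ 1) : cutoff s = 1 :=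
  Real.smoothTransition.one_of_one_le (by linarith)

theorem cutoff_of_ge {s : ℝ} (hs : 2 ≤ s) : cutoff s = 0 :=
  Real.smoothTransition.zero_of_nonpos (by linarith)

theorem hasDerivAt_cutoff (s : ℝ) : HasDerivAt cutoff (deriv cutoff s) s :=
  (contDiff_cutoff.differentiable (by simp) s).hasDerivAt

theorem contDiff_deriv_cutoff : ContDiff ℝ ∞ (deriv cutoff) :=
  (contDiff_infty_iff_deriv.1 contDiff_cutoff).2

theorem hasDerivAt_deriv_cutoff (s : ℝ) :
    HasDerivAt (deriv cutoff) (deriv (deriv cutoff) s) s :=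
  (contDiff_deriv_cutoff.differentiable (by simp) s).hasDerivAt

theorem deriv_cutoff_of_lt {s : ℝ} (hs : s < 1) : deriv cutoff s = 0 := by
  have : cutoff =ᶠ[𝓝 s] fun _ => 1 := by
    filter_upwards [Iio_mem_nhds hs] with t ht using cutoff_of_le (le_of_lt ht)
  rw [this.deriv_eq, deriv_const]

theorem deriv_cutoff_of_gt {s : ℝ} (hs : 2 < s) : deriv cutoff s = 0 := by
  have : cutoff =ᶠ[𝓝 s] fun _ => 0 := by
    filter_upwards [Ioi_mem_nhds hs] with t ht using cutoff_of_ge (le_of_lt ht)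
  rw [this.deriv_eq, deriv_const]

theorem deriv_deriv_cutoff_of_lt {s : ℝ} (hs : s < 1) : deriv (deriv cutoff) s = 0 := by
  have : deriv cutoff =ᶠ[𝓝 s] fun _ => 0 := by
    filter_upwards [Iio_mem_nhds hs] with t ht using deriv_cutoff_of_lt ht
  rw [this.deriv_eq, deriv_const]

theorem deriv_deriv_cutoff_of_gt {s : ℝ} (hs : 2 < s) : deriv (deriv cutoff) s = 0 := by
  have : deriv cutoff =ᶠ[𝓝 s] fun _ => 0 := by
    filter_upwards [Ioi_mem_nhds hs] with t ht using deriv_cutoff_of_gt ht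
  rw [this.deriv_eq, deriv_const]

theorem exists_bound_deriv_cutoff :
    ∃ K : ℝ, 0 ≤ K ∧ ∀ s, |deriv cutoff s| ≤ K ∧ |deriv (deriv cutoff) s| ≤ K := by
  obtain ⟨K₁, h1⟩ := (isCompact_Icc (a := (1 : ℝ)) (b := 2)).exists_bound_of_continuousOn
    contDiff_deriv_cutoff.continuous.continuousOn
  obtain ⟨K₂, h2⟩ := (isCompact_Icc (a := (1 : ℝ)) (b := 2)).exists_bound_of_continuousOn
    (contDiff_infty_iff_deriv.1 contDiff_deriv_cutoff).2.continuous.continuousOn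
  refine ⟨max (max K₁ K₂) 0, le_max_right _ _, fun s => ?_⟩
  by_cases hs : s < 1
  · simp [deriv_cutoff_of_lt hs, deriv_deriv_cutoff_of_lt hs]
  by_cases hs' : 2 < s
  · simp [deriv_cutoff_of_gt hs', deriv_deriv_cutoff_of_gt hs']
  have hm : s ∈ Set.Icc (1 : ℝ) 2 := ⟨not_lt.1 hs, not_lt.1 hs'⟩
  exact ⟨(h1 s hm).trans ((le_max_left _ _).trans (le_max_left _ _)),
    (h2 s hm).trans ((le_max_right _ _).trans (le_max_left _ _))⟩

/-- Coefficients of the commutator of the Laplacian with the cutoff at scale `N`. -/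
theorem exists_bound_cutoff_commutator :
    ∃ K : ℝ, 0 ≤ K ∧ ∀ N s : ℝ, 1 ≤ N → 0 ≤ s →
      |(6 + 8 * s) * (deriv cutoff (s / N) / N) +
        4 * s * (1 + s) * (deriv (deriv cutoff) (s / N) / N ^ 2)| ≤ K ∧
      |8 * (1 + s) * (deriv cutoff (s / N) / N)| ≤ K := by
  obtain ⟨K, hK, h⟩ := exists_bound_deriv_cutoff
  -- Derivatives of the cutoff live on `N ≤ s ≤ 2N`. As `N ≥ 1`, there `6 + 8s ≤ 22N`, `4s(1 + s) ≤
  -- 24N²` and `8(1 + s) ≤ 24N`; the constant 48 exceeds `22 + 24`.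
  refine ⟨48 * K, by positivity, fun N s hN hs => ?_⟩
  have hN0 : 0 < N := by linarith
  by_cases h1 : s / N < 1
  · simp [deriv_cutoff_of_lt h1, deriv_deriv_cutoff_of_lt h1, hK]
  by_cases h2 : 2 < s / N
  · simp [deriv_cutoff_of_gt h2, deriv_deriv_cutoff_of_gt h2, hK]
  have h3 : s ≤ 2 * N := by rw [← div_le_iff₀ hN0]; exact not_lt.1 h2
  have e1 : |(6 + 8 * s) * (deriv cutoff (s / N) / N)| ≤ 22 * K := by
    rw [abs_mul, abs_div, abs_of_pos hN0, abs_of_nonneg (by linarith), mul_div_assoc',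
      div_le_iff₀ hN0]
    calc _ ≤ (22 * N) * K := by
          gcongr
          · linarith
          · exact (h _).1
      _ = _ := by ring
  have e2 : |4 * s * (1 + s) * (deriv (deriv cutoff) (s / N) / N ^ 2)| ≤ 24 * K := by
    rw [abs_mul, abs_div, abs_of_pos (by positivity : 0 < N ^ 2), abs_of_nonneg (by positivity),
      mul_div_assoc', div_le_iff₀ (by positivity)]
    calc _ ≤ (4 * (2 * N) * (3 * N)) * K := by
          gcongr
          · linarith
          · exact (h _).2
      _ = _ := by ring
  have e3 : |8 * (1 + s) * (deriv cutoff (s / N) / N)| ≤ 24 * K := by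
    rw [abs_mul, abs_div, abs_of_pos hN0, abs_of_nonneg (by linarith), mul_div_assoc',
      div_le_iff₀ hN0]
    have : 8 * (1 + s) ≤ 24 * N := by linarith
    calc _ ≤ (24 * N) * K := by
          gcongr
          exact (h _).1
      _ = _ := by ring
  exact ⟨(abs_add_le _ _).trans (by linarith), by linarith⟩

/-- The radial Laplacian in the variable `s = |x|²`. -/
def radialLaplacian (φ' φ'' : ℝ → ℂ) (s : ℝ) : ℂ :=
  (6 + 8 * s) * φ' s + 4 * s * (1 + s) * φ'' s

/-- The function is multiplied by the cutoff at scale `s ~ n + 1`. The commutator with the Laplacian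
multiplies `φ` and `s φ'` by coefficients that are bounded uniformly in `n` and vanish for `s < n +
1`, so dominated convergence applies to the functions and to their Laplacians. The hypothesis `m1`
serves the cross term in `s φ'`. -/
theorem mem_laplacianGraph_of_radial {φ φ' φ'' : ℝ → ℂ}
    (hφ : ContDiffOn ℝ ∞ φ (Set.Ioi (-(1 / 2))))
    (h1 : ∀ s, 0 ≤ s → HasDerivAt φ (φ' s) s) (h2 : ∀ s, 0 ≤ s → HasDerivAt φ' (φ'' s) s)
    (m0 : MemLp (radialOf φ) 2 hypVol)
    (m1 : MemLp (radialOf fun s => (s : ℂ) * φ' s) 2 hypVol)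
    (m2 : MemLp (radialOf (radialLaplacian φ' φ'')) 2 hypVol) :
    (m0.toLp, m2.toLp) ∈ laplacianGraph := by
  obtain ⟨K, hK0, hK⟩ := exists_bound_cutoff_commutator
  set η : ℕ → ℝ → ℂ := fun n s => (cutoff (s / (n + 1)) : ℂ)
  set η' : ℕ → ℝ → ℂ := fun n s => ((deriv cutoff (s / (n + 1)) / (n + 1) : ℝ) : ℂ)
  set η'' : ℕ → ℝ → ℂ := fun n s => ((deriv (deriv cutoff) (s / (n + 1)) / (n + 1) ^ 2 : ℝ) : ℂ)
  have hη (n : ℕ) : ContDiff ℝ ∞ (η n) :=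
    Complex.ofRealCLM.contDiff.comp (contDiff_cutoff.comp (contDiff_id.div_const _))
  have hη1 (n : ℕ) (s : ℝ) : HasDerivAt (η n) (η' n s) s := by
    have := (hasDerivAt_cutoff (s / (n + 1))).comp s ((hasDerivAt_id s).div_const ((n : ℝ) + 1))
    convert! this.ofReal_comp using 1
    simp [η', div_eq_mul_inv]
  have hη2 (n : ℕ) (s : ℝ) : HasDerivAt (η' n) (η'' n s) s := by
    have := ((hasDerivAt_deriv_cutoff (s / (n + 1))).comp s
      ((hasDerivAt_id s).div_const ((n : ℝ) + 1))).div_const ((n : ℝ) + 1)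
    convert! this.ofReal_comp using 1
    simp [η'', div_eq_mul_inv, sq, mul_assoc]
  set ψ : ℕ → ℝ → ℂ := fun n s => η n s * φ s
  set ψ' : ℕ → ℝ → ℂ := fun n s => η' n s * φ s + η n s * φ' s
  set ψ'' : ℕ → ℝ → ℂ := fun n s => η'' n s * φ s + η' n s * φ' s + (η' n s * φ' s + η n s * φ'' s)
  have hψ1 (n : ℕ) (s : ℝ) (hs : 0 ≤ s) : HasDerivAt (ψ n) (ψ' n s) s :=
    (hη1 n s).mul (h1 s hs)
  have hψ2 (n : ℕ) (s : ℝ) (hs : 0 ≤ s) : HasDerivAt (ψ' n) (ψ'' n s) s :=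
    ((hη2 n s).mul (h1 s hs)).add ((hη1 n s).mul (h2 s hs))
  have hψ (n : ℕ) : ContDiff ℝ ∞ fun x : E3 => ψ n (‖x‖ ^ 2) :=
    contDiff_comp_norm_sq ((hη n).contDiffOn.mul hφ)
  have htest (n : ℕ) : IsTestFunction (radialOf (ψ n)) := by
    refine ⟨hψ n, ?_⟩
    have hcs : HasCompactSupport fun x : E3 => ψ n (‖x‖ ^ 2) := by
      refine HasCompactSupport.intro (isCompact_closedBall (0 : E3) (2 * (n + 1))) fun x hx => ?_
      rw [Metric.mem_closedBall, dist_zero_right, not_le] at hx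
      have hn : (1 : ℝ) ≤ n + 1 := by linarith [(n.cast_nonneg : (0 : ℝ) ≤ n)]
      have : 2 ≤ ‖x‖ ^ 2 / (n + 1) := by
        rw [le_div_iff₀ (by linarith)]
        nlinarith
      simp [ψ, η, cutoff_of_ge this]
    exact hcs.comp_homeomorph hypHomeo.symm
  have hlap (n : ℕ) : laplaceBeltrami (radialOf (ψ n)) =
      radialOf (radialLaplacian (ψ' n) (ψ'' n)) := by
    ext Ω
    have := chartLaplacian_radial (hψ1 n) (hψ2 n) Ω.1.2
    rw [laplaceBeltrami]
    refine this.trans ?_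
    simp [radialOf, radialLaplacian]
  have hcl (n : ℕ) : Continuous (radialOf (radialLaplacian (ψ' n) (ψ'' n))) := by
    rw [← hlap]
    exact (contDiff_chartLaplacian (hψ n)).continuous.comp (by fun_prop)
  have hcψ (n : ℕ) : Continuous (radialOf (ψ n)) :=
    (hψ n).continuous.comp (g := fun x : E3 => ψ n (‖x‖ ^ 2)) (by fun_prop : Continuous fun Ω : Hyp3 => Ω.1.2)
  set D : Hyp3 → ℝ := fun Ω => ‖radialOf φ Ω‖ + K * ‖radialOf φ Ω‖ +
    K * ‖radialOf (fun s => (s : ℂ) * φ' s) Ω‖ + ‖radialOf (radialLaplacian φ' φ'') Ω‖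
  have hD : MemLp D 2 hypVol :=
    ((m0.norm.add (m0.norm.const_mul K)).add (m1.norm.const_mul K)).add m2.norm
  have hη01 (n : ℕ) (s : ℝ) : ‖η n s - 1‖ ≤ 1 := by
    have : η n s - 1 = ((cutoff (s / (n + 1)) - 1 : ℝ) : ℂ) := by simp [η]
    rw [this, Complex.norm_real, Real.norm_eq_abs, abs_le]
    have a1 := Real.smoothTransition.nonneg (2 - s / (n + 1))
    have a2 := Real.smoothTransition.le_one (2 - s / (n + 1))
    constructor <;> simp only [cutoff] <;> linarith
  have hdiff (n : ℕ) (s : ℝ) : radialLaplacian (ψ' n) (ψ'' n) s - radialLaplacian φ' φ'' s =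
      (η n s - 1) * radialLaplacian φ' φ'' s +
      (((6 + 8 * s) * (deriv cutoff (s / (n + 1)) / (n + 1)) +
        4 * s * (1 + s) * (deriv (deriv cutoff) (s / (n + 1)) / (n + 1) ^ 2) : ℝ) : ℂ) * φ s +
      ((8 * (1 + s) * (deriv cutoff (s / (n + 1)) / (n + 1)) : ℝ) : ℂ) * (s * φ' s) := by
    simp only [radialLaplacian, ψ', ψ'', η', η'']
    push_cast
    ring
  have hb1 (n : ℕ) (Ω : Hyp3) : ‖radialOf (ψ n) Ω - radialOf φ Ω‖ ≤ D Ω := by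
    have : radialOf (ψ n) Ω - radialOf φ Ω = (η n (‖Ω.1.2‖ ^ 2) - 1) * radialOf φ Ω := by
      simp only [radialOf, ψ]; ring
    rw [this, norm_mul]
    calc _ ≤ 1 * ‖radialOf φ Ω‖ := by gcongr; exact hη01 _ _
      _ ≤ D Ω := by
        have e1 : 0 ≤ K * ‖radialOf φ Ω‖ := by positivity
        have e2 : 0 ≤ K * ‖radialOf (fun s => (s : ℂ) * φ' s) Ω‖ := by positivity
        have e3 := norm_nonneg (radialOf (radialLaplacian φ' φ'') Ω)
        simp only [D]
        linarith
  have hb2 (n : ℕ) (Ω : Hyp3) : ‖radialOf (radialLaplacian (ψ' n) (ψ'' n)) Ω -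
      radialOf (radialLaplacian φ' φ'') Ω‖ ≤ D Ω := by
    simp only [radialOf]
    rw [hdiff]
    have hk := hK (n + 1) (‖Ω.1.2‖ ^ 2) (by linarith [(n.cast_nonneg : (0 : ℝ) ≤ n)]) (by positivity)
    refine (norm_add₃_le).trans ?_
    simp only [norm_mul _ (radialLaplacian _ _ _), norm_mul _ (φ _), norm_mul _ ((_ : ℂ) * φ' _),
      Complex.norm_real, Real.norm_eq_abs]
    have e0 := norm_nonneg (radialOf φ Ω)
    have e1 : ‖η n (‖Ω.1.2‖ ^ 2) - 1‖ * ‖radialLaplacian φ' φ'' (‖Ω.1.2‖ ^ 2)‖ ≤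
      1 * ‖radialLaplacian φ' φ'' (‖Ω.1.2‖ ^ 2)‖ := by gcongr; exact hη01 _ _
    have e2 := mul_le_mul_of_nonneg_right hk.1 (norm_nonneg (φ (‖Ω.1.2‖ ^ 2)))
    have e3 := mul_le_mul_of_nonneg_right hk.2
      (norm_nonneg (((‖Ω.1.2‖ ^ 2 : ℝ) : ℂ) * φ' (‖Ω.1.2‖ ^ 2)))
    simp only [D, radialOf] at e0 ⊢
    linarith
  have mψ (n : ℕ) : MemLp (radialOf (ψ n)) 2 hypVol := by
    have : MemLp (fun Ω => radialOf (ψ n) Ω - radialOf φ Ω) 2 hypVol :=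
      hD.mono' ((hcψ n).aestronglyMeasurable.sub m0.1) (Eventually.of_forall (hb1 n))
    convert! this.add m0 using 1
    ext Ω
    simp
  have mψ2 (n : ℕ) : MemLp (radialOf (radialLaplacian (ψ' n) (ψ'' n))) 2 hypVol := by
    have : MemLp (fun Ω => radialOf (radialLaplacian (ψ' n) (ψ'' n)) Ω -
        radialOf (radialLaplacian φ' φ'') Ω) 2 hypVol :=
      hD.mono' ((hcl n).aestronglyMeasurable.sub m2.1) (Eventually.of_forall (hb2 n))
    convert! this.add m2 using 1
    ext Ω
    simp
  have hev (Ω : Hyp3) : ∀ᶠ n : ℕ in atTop, ‖Ω.1.2‖ ^ 2 / ((n : ℝ) + 1) < 1 := by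
    filter_upwards [eventually_gt_atTop ⌈‖Ω.1.2‖ ^ 2⌉₊] with n hn
    have : ‖Ω.1.2‖ ^ 2 < n := (Nat.le_ceil _).trans_lt (by exact_mod_cast hn)
    rw [div_lt_one (by positivity)]
    linarith
  have t1 : Tendsto (fun n => (mψ n).toLp) atTop (𝓝 m0.toLp) := by
    rw [Lp.tendsto_Lp_iff_tendsto_eLpNorm'']
    refine tendsto_eLpNorm_two_of_dominated
      (Eventually.of_forall fun n => (hcψ n).aestronglyMeasurable.sub m0.1) hD
      (Eventually.of_forall fun n => Eventually.of_forall (hb1 n)) (Eventually.of_forall fun Ω => ?_)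
    refine tendsto_const_nhds.congr' ?_
    filter_upwards [hev Ω] with n hn
    simp [radialOf, ψ, η, cutoff_of_le hn.le]
  have t2 : Tendsto (fun n => (mψ2 n).toLp) atTop (𝓝 m2.toLp) := by
    rw [Lp.tendsto_Lp_iff_tendsto_eLpNorm'']
    refine tendsto_eLpNorm_two_of_dominated
      (Eventually.of_forall fun n => (hcl n).aestronglyMeasurable.sub m2.1) hD
      (Eventually.of_forall fun n => Eventually.of_forall (hb2 n)) (Eventually.of_forall fun Ω => ?_)
    refine tendsto_const_nhds.congr' ?_
    filter_upwards [hev Ω] with n hn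
    simp only [Pi.sub_apply, radialOf]
    rw [hdiff]
    simp [η, cutoff_of_le hn.le, deriv_cutoff_of_lt hn, deriv_deriv_cutoff_of_lt hn]
  refine mem_closure_of_tendsto (t1.prodMk_nhds t2) (Eventually.of_forall fun n => ?_)
  refine ⟨radialOf (ψ n), htest n, (mψ n).coeFn_toLp, ?_⟩
  rw [hlap]
  exact (mψ2 n).coeFn_toLp

/-! ### Strong solutions and their limits. -/

/-- A strong solution of the Schrödinger equation. -/
def IsStrongSolution (u₀ : L2Hyp3) (u : ℝ → L2Hyp3) : Prop :=
  u 0 = u₀ ∧ ∃ v : ℝ → L2Hyp3, Continuous v ∧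
    ∀ t, HasDerivAt u (Complex.I • v t) t ∧ (u t, v t) ∈ laplacianGraph

theorem IsStrongSolution.add {u₀ v₀ : L2Hyp3} {u v : ℝ → L2Hyp3} (hu : IsStrongSolution u₀ u)
    (hv : IsStrongSolution v₀ v) : IsStrongSolution (u₀ + v₀) (u + v) := by
  obtain ⟨h0, w, hw, h⟩ := hu
  obtain ⟨h0', w', hw', h'⟩ := hv
  refine ⟨by simp [h0, h0'], w + w', hw.add hw', fun t => ⟨?_, ?_⟩⟩
  · simpa [smul_add] using (h t).1.add (h' t).1
  · exact laplacianSubmodule.add_mem (h t).2 (h' t).2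

theorem IsStrongSolution.smul (c : ℂ) {u₀ : L2Hyp3} {u : ℝ → L2Hyp3}
    (hu : IsStrongSolution u₀ u) : IsStrongSolution (c • u₀) (c • u) := by
  obtain ⟨h0, w, hw, h⟩ := hu
  refine ⟨by simp [h0], c • w, hw.const_smul c, fun t => ⟨?_, ?_⟩⟩
  · have := (h t).1.const_smul c
    rwa [smul_comm] at this
  · exact laplacianSubmodule.smul_mem c (h t).2

/-- A closed subspace of a complete space is complete, so the integral can be formed inside it. It
is used for the graph of the Laplacian. -/
theorem intervalIntegral_mem_of_isClosed {E : Type*} [NormedAddCommGroup E] [NormedSpace ℂ E]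
    [CompleteSpace E] {S : Submodule ℂ E} (hS : IsClosed (S : Set E)) {f : ℝ → E}
    (hf : Continuous f) (h : ∀ t, f t ∈ S) (a b : ℝ) : ∫ s in a..b, f s ∈ S := by
  have : CompleteSpace S := hS.completeSpace_coe
  set g : ℝ → S := fun t => ⟨f t, h t⟩
  have hg : Continuous g := hf.subtype_mk h
  have := S.subtypeL.intervalIntegral_comp_comm (hg.intervalIntegrable (μ := volume) a b)
  change ∫ s in a..b, S.subtypeL (g s) ∈ S
  rw [this]
  exact Subtype.mem _

/-- The curve `(u, Δu)` stays in the closed graph, hence so does its time integral, whose second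
component is `-i (u(t) - u₀)` by the fundamental theorem of calculus. -/
theorem IsStrongSolution.isFreeEvolution {u₀ : L2Hyp3} {u : ℝ → L2Hyp3}
    (hu : IsStrongSolution u₀ u) : IsFreeEvolution u₀ u := by
  obtain ⟨h0, v, hv, h⟩ := hu
  have hc : Continuous u := continuous_iff_continuousAt.2 fun t => (h t).1.continuousAt
  refine ⟨hc, h0, fun t => ?_⟩
  have hp := intervalIntegral_mem_of_isClosed (S := laplacianSubmodule)
    (Submodule.isClosed_topologicalClosure _) (hc.prodMk hv) (fun t => (h t).2) 0 t
  have hi := (hc.prodMk hv).intervalIntegrable (μ := volume) 0 t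
  have h1 := (ContinuousLinearMap.fst ℂ L2Hyp3 L2Hyp3).intervalIntegral_comp_comm hi
  have h2 := (ContinuousLinearMap.snd ℂ L2Hyp3 L2Hyp3).intervalIntegral_comp_comm hi
  have h3 := intervalIntegral.integral_eq_sub_of_hasDerivAt (a := 0) (b := t)
    (fun s _ => (h s).1) ((hv.const_smul Complex.I).intervalIntegrable _ _)
  rw [intervalIntegral.integral_smul, h0] at h3
  rw [← mem_laplacianSubmodule]
  convert! hp using 1
  refine Prod.ext h1 ?_
  rw [← h3, smul_smul, neg_mul, Complex.I_mul_I, neg_neg, one_smul]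
  exact h2

/-- Conservation of mass: `⟨u, Δu⟩` is real by symmetry, so the derivative of `‖u‖²` vanishes. -/
theorem IsStrongSolution.norm_eq {u₀ : L2Hyp3} {u : ℝ → L2Hyp3}
    (hu : IsStrongSolution u₀ u) (t : ℝ) : ‖u t‖ = ‖u₀‖ := by
  obtain ⟨h0, v, hv, h⟩ := hu
  have hd (t : ℝ) : HasDerivAt (fun t => inner ℂ (u t) (u t)) (0 : ℂ) t := by
    have h1 := (h t).1.inner ℂ (h t).1
    have h3 := inner_laplacian_symm (h t).2 (h t).2
    have h4 : inner ℂ (u t) (Complex.I • v t) + inner ℂ (Complex.I • v t) (u t) = 0 := by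
      simp only [inner_smul_left, inner_smul_right, Complex.conj_I]
      simp only at h3
      rw [h3]
      ring
    rwa [h4] at h1
  have := is_const_of_deriv_eq_zero (fun t => (hd t).differentiableAt) (fun t => (hd t).deriv) t 0
  simp only [h0, inner_self_eq_norm_sq_to_K] at this
  have h5 : ‖u t‖ ^ 2 = ‖u₀‖ ^ 2 := by exact_mod_cast this
  exact (pow_left_inj₀ (norm_nonneg _) (norm_nonneg _) two_ne_zero).1 h5

/-- The initial data of strong solutions form a subspace. -/
def strongData : Submodule ℂ L2Hyp3 where
  carrier := {u₀ | ∃ u, IsStrongSolution u₀ u}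
  zero_mem' := ⟨0, rfl, 0, continuous_const, fun t =>
    ⟨by simp only [Pi.zero_apply, smul_zero]; exact hasDerivAt_const t (0 : L2Hyp3), laplacianSubmodule.zero_mem⟩⟩
  add_mem' := fun ⟨_, hu⟩ ⟨_, hv⟩ => ⟨_, hu.add hv⟩
  smul_mem' := fun c _ ⟨_, hu⟩ => ⟨_, hu.smul c⟩

open BoundedContinuousFunction in
/-- Data that are limits of data of strong solutions have an isometric free evolution. -/
theorem exists_isFreeEvolution {u₀ : L2Hyp3} (hu₀ : u₀ ∈ strongData.topologicalClosure) :
    ∃ u, IsFreeEvolution u₀ u ∧ ∀ t, ‖u t‖ = ‖u₀‖ := by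
  obtain ⟨d, hd, hlim⟩ := mem_closure_iff_seq_limit.1 hu₀
  choose U hU using hd
  set B : ℕ → (ℝ →ᵇ L2Hyp3) := fun n =>
    BoundedContinuousFunction.ofNormedAddCommGroup (U n) (hU n).isFreeEvolution.continuous ‖d n‖
      fun t => ((hU n).norm_eq t).le
  -- A difference of strong solutions is a strong solution of constant norm, so convergence of the
  -- data becomes uniform convergence in time.
  have hdist (m n : ℕ) : dist (B m) (B n) ≤ dist (d m) (d n) := by
    refine (dist_le dist_nonneg).2 fun t => ?_
    have := ((hU m).add ((hU n).smul (-1))).norm_eq t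
    simp only [neg_smul, one_smul, ← sub_eq_add_neg] at this
    rw [dist_eq_norm, dist_eq_norm]
    exact this.le
  have hcauchy : CauchySeq B := by
    have h1 := hlim.cauchySeq
    rw [Metric.cauchySeq_iff] at h1 ⊢
    intro ε hε
    obtain ⟨N, hN⟩ := h1 ε hε
    exact ⟨N, fun m hm n hn => (hdist m n).trans_lt (hN m hm n hn)⟩
  obtain ⟨u, hu⟩ := cauchySeq_tendsto_of_complete hcauchy
  have hpt (t : ℝ) : Tendsto (fun n => U n t) atTop (𝓝 (u t)) :=
    ((continuous_eval_const t).tendsto u).comp hu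
  have hn (t : ℝ) : ‖u t‖ = ‖u₀‖ :=
    tendsto_nhds_unique (hpt t).norm (by simpa only [(hU _).norm_eq t] using hlim.norm)
  refine ⟨u, ⟨u.continuous, ?_, fun t => ?_⟩, hn⟩
  · exact tendsto_nhds_unique (hpt 0) (by simpa only [(hU _).1] using hlim)
  -- The mild equation survives the limit because it involves only `u(t)` and its time integral, and
  -- the graph is closed.
  · refine isClosed_laplacianGraph.mem_of_tendsto (b := atTop) (Tendsto.prodMk_nhds ?_
      (((hpt t).sub hlim).const_smul (-Complex.I)))
      (Eventually.of_forall fun n => (hU n).isFreeEvolution.mild t)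
    refine intervalIntegral.tendsto_integral_filter_of_dominated_convergence (fun _ => ‖u₀‖ + 1)
      (Eventually.of_forall fun n => (hU n).isFreeEvolution.continuous.aestronglyMeasurable)
      ?_ intervalIntegrable_const (Eventually.of_forall fun s _ => hpt s)
    filter_upwards [hlim.norm.eventually_lt_const (lt_add_one ‖u₀‖)] with n hn
    exact Eventually.of_forall fun s _ => by rw [(hU n).norm_eq s]; exact hn.le

/-- Differentiability in `L²` from pointwise differentiability and a dominated second derivative. -/
theorem hasDerivAt_toLp_of_dominated {α : Type*} [MeasurableSpace α] {μ : Measure α}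
    {k k' k'' : ℝ → α → ℂ} (m : ∀ t, MemLp (k t) 2 μ) (m' : ∀ t, MemLp (k' t) 2 μ)
    (h1 : ∀ x t, HasDerivAt (fun t => k t x) (k' t x) t)
    (h2 : ∀ x t, HasDerivAt (fun t => k' t x) (k'' t x) t)
    (hD : ∀ T : ℝ, ∃ D : α → ℝ, MemLp D 2 μ ∧ ∀ t x, |t| ≤ T → ‖k'' t x‖ ≤ D x) :
    (∀ t, HasDerivAt (fun t => (m t).toLp) (m' t).toLp t) ∧
      Continuous fun t => (m' t).toLp := by
  -- Pointwise Taylor estimates, with `D` bounding the second derivative, become `L²` estimates with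
  -- `M = ‖D‖`.
  have key (T : ℝ) : ∃ M : ℝ, 0 ≤ M ∧ ∀ a b, |a| ≤ T → |b| ≤ T →
      ‖(m' b).toLp - (m' a).toLp‖ ≤ M * |b - a| ∧
      ‖(m b).toLp - (m a).toLp - (b - a) • (m' a).toLp‖ ≤ M * |b - a| ^ 2 := by
    obtain ⟨D, mD, hD⟩ := hD T
    refine ⟨‖mD.toLp‖, norm_nonneg _, fun a b ha hb => ?_⟩
    have hseg {τ : ℝ} (hτ : τ ∈ Set.uIcc a b) : |τ| ≤ T := by
      rw [abs_le] at ha hb ⊢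
      rw [Set.mem_uIcc] at hτ
      rcases hτ with h | h <;> constructor <;> linarith [h.1, h.2, ha.1, ha.2, hb.1, hb.2]
    have hl (x : α) {τ : ℝ} (hτ : τ ∈ Set.uIcc a b) : ‖k' τ x - k' a x‖ ≤ D x * |τ - a| :=
      (convex_uIcc a b).norm_image_sub_le_of_norm_hasDerivWithin_le (f := fun t => k' t x)
        (fun s _ => (h2 x s).hasDerivWithinAt) (fun s hs => hD s x (hseg hs)) Set.left_mem_uIcc hτ
    -- The mean value inequality is applied to `k t - (t - a) k' a`, whose derivative `k' t - k' a`
    -- has just been bounded.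
    have hq (x : α) : ‖k b x - k a x - (b - a : ℝ) • k' a x‖ ≤ D x * |b - a| ^ 2 := by
      have := (convex_uIcc a b).norm_image_sub_le_of_norm_hasDerivWithin_le
        (f := fun t => k t x - (t - a : ℝ) • k' a x) (f' := fun t => k' t x - k' a x)
        (C := D x * |b - a|) (x := a) (y := b)
        (fun s _ => HasDerivAt.hasDerivWithinAt (by
          simpa using! (h1 x s).sub (((hasDerivAt_id s).sub_const a).smul_const (k' a x)))) ?_
        Set.left_mem_uIcc Set.right_mem_uIcc
      · simp only [sub_self, zero_smul, sub_zero] at this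
        rw [sub_right_comm, pow_two, ← mul_assoc]
        exact this
      · intro s hs
        refine (hl x hs).trans ?_
        have h0 : 0 ≤ D x := (norm_nonneg _).trans (hD a x ha)
        exact mul_le_mul_of_nonneg_left (Set.abs_sub_left_of_mem_uIcc hs) h0
    constructor
    · rw [mul_comm]
      refine Lp.norm_le_mul_norm_of_ae_le_mul ?_
      filter_upwards [Lp.coeFn_sub (m' b).toLp (m' a).toLp, (m' b).coeFn_toLp, (m' a).coeFn_toLp,
        mD.coeFn_toLp] with x e1 e2 e3 e4
      rw [e1, Pi.sub_apply, e2, e3, e4, mul_comm]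
      exact (hl x Set.right_mem_uIcc).trans (by gcongr; exact le_abs_self _)
    · rw [mul_comm]
      refine Lp.norm_le_mul_norm_of_ae_le_mul ?_
      filter_upwards [Lp.coeFn_sub ((m b).toLp - (m a).toLp) ((b - a) • (m' a).toLp),
        Lp.coeFn_sub (m b).toLp (m a).toLp, Lp.coeFn_smul (b - a) (m' a).toLp,
        (m b).coeFn_toLp, (m a).coeFn_toLp, (m' a).coeFn_toLp, mD.coeFn_toLp]
        with x e1 e2 e3 e4 e5 e6 e7
      rw [e1, Pi.sub_apply, e2, e3, Pi.sub_apply, Pi.smul_apply, e4, e5, e6, e7, mul_comm]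
      exact (hq x).trans (by gcongr; exact le_abs_self _)
  have habs (t : ℝ) : ∀ᶠ s in 𝓝 t, |s| ≤ |t| + 1 := by
    filter_upwards [Metric.ball_mem_nhds t one_pos] with s hs
    rw [Metric.mem_ball, Real.dist_eq] at hs
    have := abs_sub_abs_le_abs_sub s t
    linarith
  constructor
  · intro t
    obtain ⟨M, hM0, hM⟩ := key (|t| + 1)
    rw [hasDerivAt_iff_isLittleO]
    refine Asymptotics.IsBigO.trans_isLittleO (g := fun s => |s - t| ^ 2)
      (Asymptotics.IsBigO.of_bound M ?_) ?_
    · filter_upwards [habs t] with s hs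
      rw [Real.norm_eq_abs, abs_of_nonneg (by positivity : 0 ≤ |s - t| ^ 2)]
      exact (hM t s (by linarith) hs).2
    · simp only [sq_abs]
      have := Asymptotics.isLittleO_pow_sub_sub (t : ℝ) (m := 2) (by norm_num)
      simpa using this
  · refine continuous_iff_continuousAt.2 fun t => ?_
    obtain ⟨M, hM0, hM⟩ := key (|t| + 1)
    rw [ContinuousAt, tendsto_iff_norm_sub_tendsto_zero]
    refine squeeze_zero' (Eventually.of_forall fun _ => norm_nonneg _)
      (by filter_upwards [habs t] with s hs using (hM t s (by linarith) hs).1) ?_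
    have : Continuous fun s => M * |s - t| := by fun_prop
    simpa using this.tendsto t

/-! ### Complex Gaussians in the domain of the Laplacian. -/

/-- The square of the geodesic distance as a function of `s = |x|² = sinh² r`. -/
def geodesicSq (s : ℝ) : ℝ := s * arsinhRatio s ^ 2

theorem contDiffOn_geodesicSq : ContDiffOn ℝ ∞ geodesicSq (Set.Ioi (-(1 / 2))) :=
  contDiffOn_id.mul (contDiffOn_arsinhRatio.pow 2)

theorem hasDerivAt_geodesicSq {s : ℝ} (hs : -(1 / 2) < s) :
    HasDerivAt geodesicSq (arsinhRatio s * invSqrt s) s := by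
  convert! (hasDerivAt_id s).mul ((hasDerivAt_arsinhRatio hs).pow 2) using 1
  rw [← arsinhRatio_ode hs]
  simp
  ring

theorem geodesicSq_nonneg {s : ℝ} (hs : 0 ≤ s) : 0 ≤ geodesicSq s := by
  unfold geodesicSq; positivity

theorem geodesicSq_sinh_sq (r : ℝ) : geodesicSq (Real.sinh r ^ 2) = r ^ 2 := by
  rw [geodesicSq, ← mul_pow, sinh_mul_arsinhRatio]

/-- The family `c e^{-w r²} r / sinh r`, in the variable `s = sinh² r`. -/
def gaussian (c w : ℂ) (s : ℝ) : ℂ := c * Complex.exp (-w * geodesicSq s) * arsinhRatio s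

/-- The factor by which the Laplacian acts on `gaussian c w`. -/
def gaussianSymbol (w : ℂ) (s : ℝ) : ℂ := -1 - 6 * w + 4 * w ^ 2 * geodesicSq s

/-- A real Gaussian dominating all functions considered below. -/
def realGaussian (δ s : ℝ) : ℝ := Real.exp (-δ * geodesicSq s) * arsinhRatio s

theorem continuousOn_arsinhRatio : ContinuousOn arsinhRatio (Set.Ici 0) :=
  contDiffOn_arsinhRatio.continuousOn.mono fun s (hs : 0 ≤ s) => by
    simp only [Set.mem_Ioi]; linarith

theorem continuousOn_geodesicSq : ContinuousOn geodesicSq (Set.Ici 0) :=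
  contDiffOn_geodesicSq.continuousOn.mono fun s (hs : 0 ≤ s) => by
    simp only [Set.mem_Ioi]; linarith

theorem continuousOn_realGaussian (δ : ℝ) : ContinuousOn (realGaussian δ) (Set.Ici 0) :=
  (Real.continuous_exp.comp_continuousOn
    (continuousOn_const.mul continuousOn_geodesicSq)).mul continuousOn_arsinhRatio

theorem continuousOn_gaussian (c w : ℂ) : ContinuousOn (gaussian c w) (Set.Ici 0) :=
  (continuousOn_const.mul (Complex.continuous_exp.comp_continuousOn (continuousOn_const.mul
    (Complex.continuous_ofReal.comp_continuousOn continuousOn_geodesicSq)))).mul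
    (Complex.continuous_ofReal.comp_continuousOn continuousOn_arsinhRatio)

theorem continuousOn_gaussianSymbol (w : ℂ) : ContinuousOn (gaussianSymbol w) (Set.Ici 0) :=
  continuousOn_const.add (continuousOn_const.mul
    (Complex.continuous_ofReal.comp_continuousOn continuousOn_geodesicSq))

/-- The volume factor `sinh² r` cancels the square of `1 / sinh r`, leaving the integrable function
`r² e^{-2δr²}`. -/
theorem memLp_realGaussian {δ : ℝ} (hδ : 0 < δ) : MemLp (radialOf (realGaussian δ)) 2 hypVol := by
  refine ⟨(continuous_radialOf (continuousOn_realGaussian δ)).aestronglyMeasurable, ?_⟩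
  have h2 : eLpNorm (radialOf (realGaussian δ)) 2 hypVol ^ 2 < ⊤ := by
    rw [eLpNorm_two_sq]
    have hm : Measurable fun r : ℝ => ‖realGaussian δ (Real.sinh r ^ 2)‖ₑ ^ 2 := by
      have : Continuous fun r : ℝ => realGaussian δ (Real.sinh r ^ 2) :=
        (continuousOn_realGaussian δ).comp_continuous (by fun_prop) fun r => by
          simp only [Set.mem_Ici]; positivity
      exact (this.enorm.measurable).pow_const 2
    simp only [radialOf_eq]
    rw [lintegral_comp_hypRadius hm]
    refine ENNReal.mul_lt_top sphereArea_ne_top.lt_top ?_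
    have hi := integrable_rpow_mul_exp_neg_mul_sq (b := 2 * δ) (by positivity) (s := 2)
      (by norm_num)
    refine lt_of_le_of_lt (lintegral_mono fun r => ?_) hi.restrict.2
    refine le_of_eq ?_
    rw [← ofReal_norm, ← ENNReal.ofReal_pow (norm_nonneg _),
      ← ENNReal.ofReal_mul (by positivity), ← ofReal_norm, Real.norm_eq_abs, Real.norm_eq_abs,
      sq_abs, realGaussian, geodesicSq_sinh_sq]
    congr 1
    rw [mul_pow, abs_of_nonneg (by norm_cast; positivity), ← Real.exp_nat_mul]
    have h3 := sinh_mul_arsinhRatio r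
    rw [mul_left_comm, ← mul_pow, h3, mul_comm]
    norm_num
    left
    ring
  by_contra hcon
  rw [not_lt, top_le_iff] at hcon
  rw [hcon] at h2
  exact absurd h2 (by simp)

/-- Each factor `1 + ρ` is absorbed by `e^{δρ/4}`, which uses half of the decay in total. -/
theorem one_add_sq_mul_exp_le {δ ρ : ℝ} (hδ : 0 < δ) (hρ : 0 ≤ ρ) :
    (1 + ρ) ^ 2 * Real.exp (-δ * ρ) ≤ (1 + 4 / δ) ^ 2 * Real.exp (-(δ / 2) * ρ) := by
  have h1 : 1 + ρ ≤ (1 + 4 / δ) * Real.exp (δ / 4 * ρ) := by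
    have h2 := Real.add_one_le_exp (δ / 4 * ρ)
    have h3 : 0 < 4 / δ := by positivity
    calc 1 + ρ ≤ (1 + 4 / δ) * (δ / 4 * ρ + 1) := by
          have : (4 / δ) * (δ / 4 * ρ) = ρ := by field_simp
          have : 0 ≤ δ / 4 * ρ := by positivity
          nlinarith
      _ ≤ _ := by gcongr
  calc (1 + ρ) ^ 2 * Real.exp (-δ * ρ)
      ≤ ((1 + 4 / δ) * Real.exp (δ / 4 * ρ)) ^ 2 * Real.exp (-δ * ρ) := by gcongr
    _ = _ := by
      rw [mul_pow, ← Real.exp_nat_mul, mul_assoc, ← Real.exp_add]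
      congr 2
      push_cast
      ring

theorem norm_gaussian_le {c w : ℂ} {δ c₀ s : ℝ} (hs : 0 ≤ s) (hc : ‖c‖ ≤ c₀) (hw : δ ≤ w.re) :
    ‖gaussian c w s‖ ≤ c₀ * realGaussian δ s := by
  have hA := arsinhRatio_pos hs
  rw [gaussian, norm_mul, norm_mul, Complex.norm_exp, Complex.norm_real, Real.norm_eq_abs,
    abs_of_pos hA, realGaussian, mul_assoc]
  have : (-w * (geodesicSq s : ℂ)).re = -w.re * geodesicSq s := by simp
  rw [this]
  have hg := geodesicSq_nonneg hs
  have hc0 : 0 ≤ c₀ := (norm_nonneg _).trans hc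
  gcongr

/-- Functions bounded by a quadratic polynomial in `r²` times a Gaussian. -/
theorem norm_le_of_gaussian {c w : ℂ} {δ c₀ s M : ℝ} (hδ : 0 < δ) (hs : 0 ≤ s) (hc : ‖c‖ ≤ c₀)
    (hM : 0 ≤ M) (hw : δ ≤ w.re) {q : ℂ} (hq : ‖q‖ ≤ M * (1 + geodesicSq s) ^ 2) :
    ‖q * gaussian c w s‖ ≤ M * c₀ * (1 + 4 / δ) ^ 2 * realGaussian (δ / 2) s := by
  have hA := arsinhRatio_pos hs
  have hg := geodesicSq_nonneg hs
  have hc0 : 0 ≤ c₀ := (norm_nonneg _).trans hc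
  have h1 := one_add_sq_mul_exp_le hδ hg
  rw [norm_mul]
  calc _ ≤ (M * (1 + geodesicSq s) ^ 2) * (c₀ * realGaussian δ s) := by
        gcongr
        exact norm_gaussian_le hs hc hw
    _ = M * c₀ * ((1 + geodesicSq s) ^ 2 * Real.exp (-δ * geodesicSq s)) * arsinhRatio s := by
        rw [realGaussian]; ring
    _ ≤ M * c₀ * ((1 + 4 / δ) ^ 2 * Real.exp (-(δ / 2) * geodesicSq s)) * arsinhRatio s := by
        gcongr
    _ = _ := by rw [realGaussian]; ring

theorem memLp_of_gaussian_bound {g : ℝ → ℂ} (hg : ContinuousOn g (Set.Ici 0)) {δ K : ℝ}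
    (hδ : 0 < δ) (h : ∀ s, 0 ≤ s → ‖g s‖ ≤ K * realGaussian δ s) :
    MemLp (radialOf g) 2 hypVol :=
  ((memLp_realGaussian hδ).const_mul K).mono'
    (continuous_radialOf hg).aestronglyMeasurable
    (Eventually.of_forall fun Ω => h (‖Ω.1.2‖ ^ 2) (by positivity))

theorem norm_gaussianSymbol_le (w : ℂ) {s : ℝ} (hs : 0 ≤ s) :
    ‖gaussianSymbol w s‖ ≤ (1 + 6 * ‖w‖ + 4 * ‖w‖ ^ 2) * (1 + geodesicSq s) := by
  have hg := geodesicSq_nonneg hs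
  have : gaussianSymbol w s = -1 + -(6 * w) + 4 * w ^ 2 * geodesicSq s := by
    rw [gaussianSymbol]; ring
  rw [this]
  refine norm_add₃_le.trans ?_
  simp only [norm_neg, norm_mul, norm_pow, Complex.norm_real, Real.norm_eq_abs, abs_of_nonneg hg,
    norm_one, Complex.norm_ofNat]
  have := norm_nonneg w
  nlinarith [mul_nonneg this hg, mul_nonneg (sq_nonneg ‖w‖) hg, sq_nonneg ‖w‖]

theorem le_one_add_sq {ρ : ℝ} (hρ : 0 ≤ ρ) : 1 + ρ ≤ (1 + ρ) ^ 2 := by nlinarith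

theorem memLp_gaussian (c : ℂ) {w : ℂ} (hw : 0 < w.re) :
    MemLp (radialOf (gaussian c w)) 2 hypVol :=
  memLp_of_gaussian_bound (continuousOn_gaussian c w) hw
    fun _ hs => norm_gaussian_le hs le_rfl le_rfl

theorem memLp_gaussianSymbol (c : ℂ) {w : ℂ} (hw : 0 < w.re) :
    MemLp (radialOf fun s => gaussianSymbol w s * gaussian c w s) 2 hypVol := by
  refine memLp_of_gaussian_bound ((continuousOn_gaussianSymbol w).mul (continuousOn_gaussian c w))
    (half_pos hw) fun s hs => norm_le_of_gaussian (M := 1 + 6 * ‖w‖ + 4 * ‖w‖ ^ 2) hw hs le_rfl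
      (by positivity) le_rfl ((norm_gaussianSymbol_le w hs).trans ?_)
  gcongr
  exact le_one_add_sq (geodesicSq_nonneg hs)

/-- After multiplication by `sinh r` the Gaussian is `c r e^{-wr²}`, on which `∂ᵣ² - 1` acts as
multiplication by `-1 - 6w + 4w²r²`. The computation is carried out in the variable `s`. -/
theorem gaussian_mem_laplacianGraph (c : ℂ) {w : ℂ} (hw : 0 < w.re) :
    ((memLp_gaussian c hw).toLp, (memLp_gaussianSymbol c hw).toLp) ∈ laplacianGraph := by
  have hhalf {s : ℝ} (hs : 0 ≤ s) : -(1 / 2) < s := by linarith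
  set E : ℝ → ℂ := fun s => c * Complex.exp (-w * geodesicSq s)
  set φ' : ℝ → ℂ := fun s => E s * (arsinhRatio' s - w * arsinhRatio s ^ 2 * invSqrt s)
  set φ'' : ℝ → ℂ := fun s =>
    E s * (-w * (arsinhRatio s * invSqrt s)) * (arsinhRatio' s - w * arsinhRatio s ^ 2 * invSqrt s) +
    E s * (arsinhRatio'' s - w * (2 * arsinhRatio s * arsinhRatio' s * invSqrt s +
      arsinhRatio s ^ 2 * (-(1 / 2) * invSqrt s ^ 3)))
  have hE (s : ℝ) (hs : 0 ≤ s) :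
      HasDerivAt E (E s * (-w * (arsinhRatio s * invSqrt s))) s := by
    have h1 := ((hasDerivAt_geodesicSq (hhalf hs)).ofReal_comp.const_mul (-w)).cexp.const_mul c
    convert! h1 using 1
    simp only [E]
    push_cast
    ring
  have h1 (s : ℝ) (hs : 0 ≤ s) : HasDerivAt (gaussian c w) (φ' s) s := by
    convert! (hE s hs).mul (hasDerivAt_arsinhRatio (hhalf hs)).ofReal_comp using 1
    simp only [φ']
    ring
  have h2 (s : ℝ) (hs : 0 ≤ s) : HasDerivAt φ' (φ'' s) s := by
    have hA := (hasDerivAt_arsinhRatio (hhalf hs)).ofReal_comp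
    have hA' := (hasDerivAt_arsinhRatio' (hhalf hs)).ofReal_comp
    have hB := (hasDerivAt_invSqrt (hhalf hs)).ofReal_comp
    convert! (hE s hs).mul (hA'.sub (((hA.pow 2).const_mul w).mul hB)) using 1
    simp only [φ'']
    push_cast
    simp only [Pi.mul_apply, Pi.pow_apply, Pi.sub_apply]
    ring
  have hL (s : ℝ) (hs : 0 ≤ s) :
      radialLaplacian φ' φ'' s = gaussianSymbol w s * gaussian c w s := by
    have o1 : 2 * (s : ℂ) * arsinhRatio' s + arsinhRatio s = invSqrt s := by
      exact_mod_cast arsinhRatio_ode (hhalf hs)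
    have o2 : 2 * (s : ℂ) * arsinhRatio'' s + 3 * arsinhRatio' s = -(1 / 2) * invSqrt s ^ 3 := by
      have := congrArg ((↑) : ℝ → ℂ) (arsinhRatio_ode' (hhalf hs))
      push_cast at this
      exact this
    have o3 : (1 + (s : ℂ)) * invSqrt s ^ 2 = 1 := by
      exact_mod_cast invSqrt_sq (hhalf hs)
    simp only [radialLaplacian, φ', φ'', gaussianSymbol, gaussian, geodesicSq]
    have hE' : c * Complex.exp (-w * ((s * arsinhRatio s ^ 2 : ℝ) : ℂ)) = E s := rfl
    rw [hE']
    push_cast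
    -- The three identities eliminate the first and second derivatives of `arsinhRatio` and the
    -- product `(1 + s) invSqrt²`.
    linear_combination E s * (2 * (1 + s) * o2 - invSqrt s * o3 + o1 +
      w * (-6 * (1 + s) * arsinhRatio s * invSqrt s * o1 - 6 * arsinhRatio s * o3 +
        2 * s * arsinhRatio s ^ 2 * invSqrt s * o3) + 4 * w ^ 2 * s * arsinhRatio s ^ 3 * o3)
  have m1 : MemLp (radialOf fun s => (s : ℂ) * φ' s) 2 hypVol := by
    have hcont : ContinuousOn (fun s : ℝ => (s : ℂ) * φ' s) (Set.Ici 0) :=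
      Complex.continuous_ofReal.continuousOn.mul
        fun s hs => (h2 s hs).continuousAt.continuousWithinAt
    refine memLp_of_gaussian_bound hcont (half_pos hw) fun s hs => le_trans ?_
      (norm_le_of_gaussian (c := c) (M := 1 + ‖w‖)
        (q := (((1 + ‖w‖) * (1 + geodesicSq s) : ℝ) : ℂ)) hw hs le_rfl (by positivity) le_rfl ?_)
    · have hA := arsinhRatio_pos hs
      have hB := invSqrt_pos (hhalf hs)
      have hBA := invSqrt_le_arsinhRatio hs
      have hg := geodesicSq_nonneg hs
      have o1 : 2 * (s : ℂ) * arsinhRatio' s + arsinhRatio s = invSqrt s := by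
        exact_mod_cast arsinhRatio_ode (hhalf hs)
      -- The relation `o1` trades `s · arsinhRatio'` for half of `invSqrt - arsinhRatio`. Since
      -- `invSqrt ≤ arsinhRatio`, the growth of `s φ'` relative to the Gaussian is at most linear in
      -- `r²`.
      have e1 : (s : ℂ) * φ' s = E s * ((((invSqrt s - arsinhRatio s) / 2 : ℝ) : ℂ) -
          w * ((geodesicSq s * invSqrt s : ℝ) : ℂ)) := by
        simp only [φ', geodesicSq]
        push_cast
        linear_combination E s / 2 * o1
      have e2 : (((1 + ‖w‖) * (1 + geodesicSq s) : ℝ) : ℂ) * gaussian c w s =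
          E s * (((1 + ‖w‖) * (1 + geodesicSq s) * arsinhRatio s : ℝ) : ℂ) := by
        simp only [gaussian, E]
        push_cast
        ring
      rw [e1, e2, norm_mul (E s), norm_mul (E s)]
      refine mul_le_mul_of_nonneg_left ((norm_sub_le _ _).trans ?_) (norm_nonneg (E s))
      rw [norm_mul, Complex.norm_real, Complex.norm_real, Complex.norm_real, Real.norm_eq_abs,
        Real.norm_eq_abs, Real.norm_eq_abs, abs_of_nonpos (by linarith), abs_of_nonneg (by positivity),
        abs_of_nonneg (by positivity)]
      have hw0 := norm_nonneg w
      have e3 : ‖w‖ * (geodesicSq s * invSqrt s) ≤ ‖w‖ * (geodesicSq s * arsinhRatio s) := by gcongr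
      have e4 : 0 ≤ geodesicSq s * arsinhRatio s := by positivity
      have e5 : 0 ≤ ‖w‖ * arsinhRatio s := by positivity
      linarith
    · have hg := geodesicSq_nonneg hs
      rw [Complex.norm_real, Real.norm_eq_abs, abs_of_nonneg (by positivity)]
      gcongr
      exact le_one_add_sq hg
  have hsm : ContDiffOn ℝ ∞ (gaussian c w) (Set.Ioi (-(1 / 2))) := by
    have hA : ContDiffOn ℝ ∞ (fun s => (arsinhRatio s : ℂ)) (Set.Ioi (-(1 / 2))) :=
      Complex.ofRealCLM.contDiff.comp_contDiffOn contDiffOn_arsinhRatio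
    have hG : ContDiffOn ℝ ∞ (fun s => (geodesicSq s : ℂ)) (Set.Ioi (-(1 / 2))) :=
      Complex.ofRealCLM.contDiff.comp_contDiffOn contDiffOn_geodesicSq
    exact (contDiffOn_const.mul (contDiffOn_const.mul hG).cexp).mul hA
  have he : radialOf (radialLaplacian φ' φ'') =
      radialOf fun s => gaussianSymbol w s * gaussian c w s :=
    funext fun Ω => hL _ (by positivity)
  have m2 : MemLp (radialOf (radialLaplacian φ' φ'')) 2 hypVol := he ▸ memLp_gaussianSymbol c hw
  have := mem_laplacianGraph_of_radial hsm h1 h2 (memLp_gaussian c hw) m1 m2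
  rwa [show m2.toLp = (memLp_gaussianSymbol c hw).toLp by simp only [he]] at this

/-! ### The explicit evolution of the Gaussians. -/

/-- Complex time `a + i t`. -/
def cTime (a t : ℝ) : ℂ := a + Complex.I * t

/-- Width of the Gaussian at time `t`. -/
def waveWidth (a t : ℝ) : ℂ := (4 * cTime a t)⁻¹

/-- Amplitude of the Gaussian at time `t`. -/
def waveAmp (a t : ℝ) : ℂ := Complex.exp (-Complex.I * t) * cTime a t ^ (-(3 / 2) : ℂ)

theorem cTime_re (a t : ℝ) : (cTime a t).re = a := by simp [cTime]

theorem cTime_ne_zero {a : ℝ} (ha : 0 < a) (t : ℝ) : cTime a t ≠ 0 := fun h => by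
  have := cTime_re a t
  rw [h] at this
  simp at this
  linarith

theorem cTime_normSq (a t : ℝ) : Complex.normSq (cTime a t) = a ^ 2 + t ^ 2 := by
  simp [cTime, Complex.normSq_apply, sq]

theorem le_norm_cTime {a : ℝ} (ha : 0 < a) (t : ℝ) : a ≤ ‖cTime a t‖ := by
  have := Complex.abs_re_le_norm (cTime a t)
  rwa [cTime_re, abs_of_pos ha] at this

theorem waveWidth_re (a t : ℝ) : (waveWidth a t).re = a / (4 * (a ^ 2 + t ^ 2)) := by
  rw [waveWidth, mul_inv, show (4 : ℂ)⁻¹ = ((4⁻¹ : ℝ) : ℂ) by push_cast; rfl, Complex.re_ofReal_mul,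
    Complex.inv_re, cTime_re, cTime_normSq]
  field_simp

theorem waveWidth_re_pos {a : ℝ} (ha : 0 < a) (t : ℝ) : 0 < (waveWidth a t).re := by
  rw [waveWidth_re]; positivity

theorem norm_waveWidth_le {a : ℝ} (ha : 0 < a) (t : ℝ) : ‖waveWidth a t‖ ≤ (4 * a)⁻¹ := by
  rw [waveWidth, norm_inv, norm_mul, Complex.norm_ofNat]
  have := le_norm_cTime ha t
  gcongr

theorem hasDerivAt_cTime (a t : ℝ) : HasDerivAt (cTime a) Complex.I t := by
  convert! (((hasDerivAt_id t).ofReal_comp).const_mul Complex.I).const_add (a : ℂ) using 1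
  simp

/-- The Schrödinger equation for a Gaussian amounts to two ordinary differential equations. This one
matches the coefficient of `r²` in the symbol, and `hasDerivAt_waveAmp` matches the constant term.
-/
theorem hasDerivAt_waveWidth {a : ℝ} (ha : 0 < a) (t : ℝ) :
    HasDerivAt (waveWidth a) (-4 * Complex.I * waveWidth a t ^ 2) t := by
  have h := cTime_ne_zero ha t
  have := ((hasDerivAt_cTime a t).const_mul (4 : ℂ)).inv (by simpa using h)
  convert! this using 1
  rw [waveWidth]
  field_simp

theorem hasDerivAt_waveAmp {a : ℝ} (ha : 0 < a) (t : ℝ) :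
    HasDerivAt (waveAmp a) (Complex.I * (-1 - 6 * waveWidth a t) * waveAmp a t) t := by
  have h := cTime_ne_zero ha t
  have h1 : HasDerivAt (fun t : ℝ => Complex.exp (-Complex.I * t))
      (Complex.exp (-Complex.I * t) * (-Complex.I)) t := by
    simpa using (((hasDerivAt_id t).ofReal_comp).const_mul (-Complex.I)).cexp
  -- Positivity of `a` keeps the complex time off the branch cut of the principal power.
  have hs : cTime a t ∈ Complex.slitPlane := Or.inl (by rwa [cTime_re])
  have h2 := ((hasDerivAt_id (cTime a t)).cpow_const (c := (-(3 / 2) : ℂ)) hs).scomp t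
    (hasDerivAt_cTime a t)
  have h3 := h1.mul h2
  convert! h3 using 1
  simp only [id, smul_eq_mul, Function.comp_def]
  rw [Complex.cpow_sub _ _ h, Complex.cpow_one, waveAmp, waveWidth]
  field_simp
  ring

theorem norm_waveAmp {a : ℝ} (ha : 0 < a) (t : ℝ) :
    ‖waveAmp a t‖ = ‖cTime a t‖ ^ (-(3 / 2) : ℝ) := by
  have h : ‖Complex.exp (-Complex.I * t)‖ = 1 := by simp [Complex.norm_exp]
  rw [waveAmp, norm_mul, h, one_mul, Complex.norm_cpow_of_ne_zero (cTime_ne_zero ha t)]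
  have h1 : (-(3 / 2) : ℂ) = ((-(3 / 2) : ℝ) : ℂ) := by push_cast; rfl
  rw [h1]
  simp

theorem norm_waveAmp_le {a : ℝ} (ha : 0 < a) (t : ℝ) : ‖waveAmp a t‖ ≤ a ^ (-(3 / 2) : ℝ) := by
  rw [norm_waveAmp ha]
  exact Real.rpow_le_rpow_of_nonpos ha (le_norm_cTime ha t) (by norm_num)

/-- The explicit solution with Gaussian data. -/
def gaussianWave (a t : ℝ) : ℝ → ℂ := gaussian (waveAmp a t) (waveWidth a t)

/-- The Gaussian wave as an element of `L²`. -/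
def gaussianWaveLp {a : ℝ} (ha : 0 < a) (t : ℝ) : L2Hyp3 :=
  (memLp_gaussian (waveAmp a t) (waveWidth_re_pos ha t)).toLp

theorem coeFn_gaussianWaveLp {a : ℝ} (ha : 0 < a) (t : ℝ) :
    gaussianWaveLp ha t =ᵐ[hypVol] radialOf (gaussianWave a t) :=
  MemLp.coeFn_toLp _

theorem hasDerivAt_gaussianWave {a : ℝ} (ha : 0 < a) (s t : ℝ) :
    HasDerivAt (fun t => gaussianWave a t s)
      (Complex.I * (gaussianSymbol (waveWidth a t) s * gaussianWave a t s)) t := by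
  have h1 := ((hasDerivAt_waveAmp ha t).mul
    ((hasDerivAt_waveWidth ha t).neg.mul_const (geodesicSq s : ℂ)).cexp).mul_const
      (arsinhRatio s : ℂ)
  convert! h1 using 1
  simp only [gaussianSymbol, gaussianWave, gaussian, Pi.neg_apply]
  ring

/-- The second time derivative is needed only to dominate the Taylor remainder in
`hasDerivAt_toLp_of_dominated`. -/
theorem hasDerivAt_deriv_gaussianWave {a : ℝ} (ha : 0 < a) (s t : ℝ) :
    HasDerivAt (fun t => Complex.I * (gaussianSymbol (waveWidth a t) s * gaussianWave a t s))
      ((32 * waveWidth a t ^ 3 * geodesicSq s - 24 * waveWidth a t ^ 2 -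
        gaussianSymbol (waveWidth a t) s ^ 2) * gaussianWave a t s) t := by
  have hw := hasDerivAt_waveWidth ha t
  have h1 := ((hw.const_mul (6 : ℂ)).const_sub (-1)).add
    (((hw.pow 2).const_mul 4).mul_const (geodesicSq s : ℂ))
  have h2 := (h1.mul (hasDerivAt_gaussianWave ha s t)).const_mul Complex.I
  convert! h2 using 1
  simp only [gaussianSymbol, Pi.pow_apply, Pi.add_apply]
  ring_nf
  simp only [Complex.I_sq]
  ring

theorem isStrongSolution_gaussianWave {a : ℝ} (ha : 0 < a) :
    IsStrongSolution (gaussianWaveLp ha 0) (gaussianWaveLp ha) := by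
  have m' (t : ℝ) : MemLp
      (radialOf fun s => gaussianSymbol (waveWidth a t) s * gaussianWave a t s) 2 hypVol :=
    memLp_gaussianSymbol (waveAmp a t) (waveWidth_re_pos ha t)
  obtain ⟨h1, h2⟩ := hasDerivAt_toLp_of_dominated
    (k := fun t => radialOf (gaussianWave a t))
    (k' := fun t Ω => Complex.I * radialOf
      (fun s => gaussianSymbol (waveWidth a t) s * gaussianWave a t s) Ω)
    (fun t => memLp_gaussian (waveAmp a t) (waveWidth_re_pos ha t))
    (fun t => (m' t).const_mul Complex.I)
    (fun Ω t => hasDerivAt_gaussianWave ha _ t)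
    (fun Ω t => hasDerivAt_deriv_gaussianWave ha _ t) (fun T => by
      -- For `|t| ≤ T` this bounds the real part of the width from below. The constant `M` below
      -- collects the coefficients of the second derivative, estimated with `‖waveWidth a t‖ ≤
      -- (4a)⁻¹`.
      have hδ : 0 < a / (4 * (a ^ 2 + T ^ 2)) := by positivity
      set δ := a / (4 * (a ^ 2 + T ^ 2)) with hδ'
      set M : ℝ := 24 * (4 * a)⁻¹ ^ 2 + 32 * (4 * a)⁻¹ ^ 3 + (1 + 6 * (4 * a)⁻¹ + 4 * (4 * a)⁻¹ ^ 2) ^ 2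
      refine ⟨fun Ω => (M * a ^ (-(3 / 2) : ℝ) * (1 + 4 / δ) ^ 2) *
        radialOf (realGaussian (δ / 2)) Ω, (memLp_realGaussian (half_pos hδ)).const_mul _,
        fun t Ω ht => ?_⟩
      have hre : δ ≤ (waveWidth a t).re := by
        have : t ^ 2 ≤ T ^ 2 := sq_le_sq.2 (ht.trans (le_abs_self T))
        rw [waveWidth_re, hδ']
        gcongr
      have hs : (0 : ℝ) ≤ ‖Ω.1.2‖ ^ 2 := by positivity
      refine norm_le_of_gaussian hδ hs (norm_waveAmp_le ha t) (by positivity) hre ?_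
      have hg := geodesicSq_nonneg hs
      have hw := norm_waveWidth_le ha t
      have hq := norm_gaussianSymbol_le (waveWidth a t) hs
      set ρ := geodesicSq (‖Ω.1.2‖ ^ 2)
      set w := waveWidth a t
      have hq' : ‖gaussianSymbol w (‖Ω.1.2‖ ^ 2)‖ ≤
          (1 + 6 * (4 * a)⁻¹ + 4 * (4 * a)⁻¹ ^ 2) * (1 + ρ) := hq.trans (by gcongr)
      have e1 : ‖32 * w ^ 3 * (ρ : ℂ)‖ ≤ 32 * (4 * a)⁻¹ ^ 3 * (1 + ρ) ^ 2 := by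
        rw [norm_mul, norm_mul, norm_pow, Complex.norm_ofNat, Complex.norm_real, Real.norm_eq_abs,
          abs_of_nonneg hg]
        gcongr
        nlinarith
      have e2 : ‖24 * w ^ 2‖ ≤ 24 * (4 * a)⁻¹ ^ 2 * (1 + ρ) ^ 2 := by
        rw [norm_mul, norm_pow, Complex.norm_ofNat]
        calc _ ≤ 24 * (4 * a)⁻¹ ^ 2 * 1 := by rw [mul_one]; gcongr
          _ ≤ _ := by gcongr; nlinarith
      have e3 : ‖gaussianSymbol w (‖Ω.1.2‖ ^ 2) ^ 2‖ ≤
          ((1 + 6 * (4 * a)⁻¹ + 4 * (4 * a)⁻¹ ^ 2) * (1 + ρ)) ^ 2 := by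
        rw [norm_pow]
        gcongr
      refine (norm_sub_le _ _).trans ((add_le_add_left (norm_sub_le _ _) _).trans ?_)
      simp only [M]
      linarith)
  refine ⟨rfl, fun t => (m' t).toLp, ?_, fun t => ⟨?_, gaussian_mem_laplacianGraph _ (waveWidth_re_pos ha t)⟩⟩
  · have h3 (t : ℝ) : (m' t).toLp = -Complex.I • ((m' t).const_mul Complex.I).toLp := by
      rw [show ((m' t).const_mul Complex.I).toLp = Complex.I • (m' t).toLp from
        MemLp.toLp_const_smul Complex.I (m' t), smul_smul]
      simp
    simp only [h3]
    exact h2.const_smul (-Complex.I)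
  · exact h1 t

/-! ### Density of the Gaussian profiles among radial functions. -/

/-- By linearity polynomials in `y` integrate to zero against `q`; Weierstrass approximation on `[0,
1]` and integrability of `q` extend this to continuous `F`. -/
theorem integral_comp_mul_eq_zero_of_moments {q : ℝ → ℂ} {μ : Measure ℝ} (hq : Integrable q μ)
    {y : ℝ → ℝ} (hy : Continuous y) (hy01 : ∀ r, y r ∈ Set.Icc (0 : ℝ) 1)
    (h : ∀ n : ℕ, ∫ r, ((y r ^ n : ℝ) : ℂ) * q r ∂μ = 0) {F : ℝ → ℝ}
    (hF : ContinuousOn F (Set.Icc 0 1)) : ∫ r, (F (y r) : ℂ) * q r ∂μ = 0 := by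
  have hint {H : ℝ → ℝ} (hH : ContinuousOn H (Set.Icc 0 1)) :
      Integrable (fun r => (H (y r) : ℂ) * q r) μ := by
    obtain ⟨B, hB⟩ := isCompact_Icc.exists_bound_of_continuousOn hH
    have hc : Continuous fun r => H (y r) := hH.comp_continuous hy hy01
    refine hq.bdd_mul (c := B) (Complex.continuous_ofReal.comp hc).aestronglyMeasurable
      (Eventually.of_forall fun r => ?_)
    rw [Complex.norm_real]
    exact hB _ (hy01 r)
  have hp (p : Polynomial ℝ) : ∫ r, ((p.eval (y r) : ℝ) : ℂ) * q r ∂μ = 0 := by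
    induction p using Polynomial.induction_on' with
    | add p₁ p₂ h1 h2 =>
      have e : ∀ r, (((p₁ + p₂).eval (y r) : ℝ) : ℂ) * q r =
          ((p₁.eval (y r) : ℝ) : ℂ) * q r + ((p₂.eval (y r) : ℝ) : ℂ) * q r := fun r => by
        rw [Polynomial.eval_add]; push_cast; ring
      simp only [e]
      rw [integral_add (hint p₁.continuousOn) (hint p₂.continuousOn), h1, h2, add_zero]
    | monomial n a =>
      have e : ∀ r, (((Polynomial.monomial n a).eval (y r) : ℝ) : ℂ) * q r =
          (a : ℂ) * (((y r ^ n : ℝ) : ℂ) * q r) := fun r => by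
        rw [Polynomial.eval_monomial]; push_cast; ring
      simp only [e]
      rw [integral_const_mul, h, mul_zero]
  have hle (ε : ℝ) (hε : 0 < ε) : ‖∫ r, (F (y r) : ℂ) * q r ∂μ‖ ≤ ε * ∫ r, ‖q r‖ ∂μ := by
    obtain ⟨p, hpε⟩ := exists_polynomial_near_of_continuousOn 0 1 F hF ε hε
    have e : ∫ r, (F (y r) : ℂ) * q r ∂μ =
        ∫ r, ((F (y r) : ℂ) * q r - ((p.eval (y r) : ℝ) : ℂ) * q r) ∂μ := by
      rw [integral_sub (hint hF) (hint p.continuousOn), hp, sub_zero]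
    rw [e, ← integral_const_mul]
    refine norm_integral_le_of_norm_le (hq.norm.const_mul ε) (Eventually.of_forall fun r => ?_)
    rw [← sub_mul, norm_mul, ← Complex.ofReal_sub, Complex.norm_real, Real.norm_eq_abs, abs_sub_comm]
    gcongr
    exact (hpε _ (hy01 r)).le
  have hlim : Tendsto (fun ε : ℝ => ε * ∫ r, ‖q r‖ ∂μ) (𝓝[>] 0) (𝓝 0) := by
    have : Continuous fun ε : ℝ => ε * ∫ r, ‖q r‖ ∂μ := by fun_prop
    have h0 := this.tendsto 0
    simp only [zero_mul] at h0
    exact h0.mono_left nhdsWithin_le_nhds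
  have := ge_of_tendsto hlim (by filter_upwards [self_mem_nhdsWithin] with ε hε using hle ε hε)
  exact norm_le_zero_iff.1 this

/-- A function on the half-line all of whose Gaussian moments vanish is zero. -/
theorem ae_eq_zero_of_gaussian_moments {q : ℝ → ℂ}
    (hq : IntegrableOn q (Set.Ioi 0))
    (h : ∀ n : ℕ, ∫ r in Set.Ioi (0 : ℝ), ((Real.exp (-r ^ 2) ^ n : ℝ) : ℂ) * q r = 0) :
    ∀ᵐ r ∂(volume.restrict (Set.Ioi (0 : ℝ))), q r = 0 := by
  rw [ae_restrict_iff' measurableSet_Ioi]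
  refine IsOpen.ae_eq_zero_of_integral_contDiff_smul_eq_zero isOpen_Ioi
    hq.locallyIntegrableOn fun g hg hgc hgs => ?_
  -- Chosen so that `F (e^{-r²}) = g r` for `r > 0`. It is continuous at `y = 0`, which corresponds
  -- to `r = ∞`, because `g` has compact support.
  set F : ℝ → ℝ := fun y => g (Real.sqrt (-Real.log y))
  have hg0 : ∀ r, r ≤ 0 → g r = 0 := fun r hr => by
    by_contra hne
    exact absurd (hgs (subset_tsupport g hne)) (not_lt.2 hr)
  obtain ⟨R, hR⟩ := hgc.isCompact.isBounded.subset_closedBall 0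
  have hgR : ∀ r, R < r → g r = 0 := fun r hr => by
    by_contra hne
    have := hR (subset_tsupport g hne)
    rw [Metric.mem_closedBall, dist_zero_right, Real.norm_eq_abs] at this
    exact absurd (le_abs_self r) (by linarith)
  have hF : ContinuousOn F (Set.Icc 0 1) := by
    intro y hy
    rcases hy.1.eq_or_lt with h0 | h0
    · have hlt : Real.exp (-(|R| + 1) ^ 2) ∈ Set.Ioi (0 : ℝ) := Real.exp_pos _
      have hev : F =ᶠ[𝓝[Set.Icc 0 1] y] fun _ => 0 := by
        rw [← h0]
        filter_upwards [self_mem_nhdsWithin, mem_nhdsWithin_of_mem_nhds (Iio_mem_nhds hlt)]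
          with x hx hx2
        rcases hx.1.eq_or_lt with h1 | h1
        · simp only [F, ← h1]
          exact hg0 _ (by simp)
        · refine hgR _ ?_
          have h2 : Real.log x < -(|R| + 1) ^ 2 := by
            rw [Real.log_lt_iff_lt_exp h1]; exact hx2
          have h3 : |R| + 1 ≤ Real.sqrt (-Real.log x) := by
            refine Real.le_sqrt_of_sq_le ?_
            linarith
          linarith [le_abs_self R]
      refine ContinuousWithinAt.congr_of_eventuallyEq continuousWithinAt_const hev ?_
      simp only [F, ← h0]
      exact hg0 _ (by simp)
    · have : ContinuousAt F y :=
        hg.continuous.continuousAt.comp (Real.continuous_sqrt.continuousAt.comp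
          (Real.continuousAt_log h0.ne').neg)
      exact this.continuousWithinAt
  have hkey := integral_comp_mul_eq_zero_of_moments hq (y := fun r => Real.exp (-r ^ 2))
    (by fun_prop) (fun r => ⟨(Real.exp_pos _).le, by
      rw [Real.exp_le_one_iff]; nlinarith [sq_nonneg r]⟩) h hF
  rw [← hkey, ← setIntegral_eq_integral_of_forall_compl_eq_zero (s := Set.Ioi (0 : ℝ))]
  · refine setIntegral_congr_fun measurableSet_Ioi fun r hr => ?_
    simp only [F, Real.log_exp, neg_neg, Real.sqrt_sq (le_of_lt hr), Complex.real_smul]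
  · intro r hr
    rw [hg0 r (not_lt.1 hr), zero_smul]

/-- Radial functions as a subspace of `L²`. -/
def radialLift : Lp ℂ 2 radialMeasure →ₗᵢ[ℂ] L2Hyp3 :=
  Lp.compMeasurePreservingₗᵢ ℂ hypRadius measurePreserving_hypRadius

theorem coeFn_radialLift (h : Lp ℂ 2 radialMeasure) :
    radialLift h =ᵐ[hypVol] fun Ω => h (hypRadius Ω) :=
  Lp.coeFn_compMeasurePreserving h measurePreserving_hypRadius

/-- The profile of the Gaussian wave as a function of the distance. -/
def gaussianProfile (a r : ℝ) : ℂ := gaussianWave a 0 (Real.sinh r ^ 2)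

theorem continuous_gaussianProfile (a : ℝ) : Continuous (gaussianProfile a) :=
  (continuousOn_gaussian _ _).comp_continuous (by fun_prop) fun r => by
    simp only [Set.mem_Ici]; positivity

theorem memLp_radialMeasure_iff {f : ℝ → ℂ} (hf : AEStronglyMeasurable f radialMeasure) :
    MemLp f 2 radialMeasure ↔ MemLp (fun Ω => f (hypRadius Ω)) 2 hypVol := by
  have h := measurePreserving_hypRadius.map_eq
  rw [← h] at hf ⊢
  exact memLp_map_measure_iff hf continuous_hypRadius.measurable.aemeasurable

theorem memLp_gaussianProfile {a : ℝ} (ha : 0 < a) : MemLp (gaussianProfile a) 2 radialMeasure := by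
  rw [memLp_radialMeasure_iff (continuous_gaussianProfile a).aestronglyMeasurable]
  have := memLp_gaussian (waveAmp a 0) (waveWidth_re_pos ha 0)
  exact (memLp_congr_ae (Eventually.of_forall fun Ω => radialOf_eq _ Ω)).1 this

theorem radialLift_gaussianProfile {a : ℝ} (ha : 0 < a) :
    radialLift (memLp_gaussianProfile ha).toLp = gaussianWaveLp ha 0 := by
  refine Lp.ext ((coeFn_radialLift _).trans ?_)
  refine EventuallyEq.trans ?_ (coeFn_gaussianWaveLp ha 0).symm
  have := measurePreserving_hypRadius.quasiMeasurePreserving.ae (memLp_gaussianProfile ha).coeFn_toLp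
  filter_upwards [this] with Ω hΩ
  rw [hΩ, radialOf_eq]
  rfl

theorem integral_radialMeasure (f : ℝ → ℂ) :
    ∫ r, f r ∂radialMeasure =
      sphereArea.toReal • ∫ r in Set.Ioi (0 : ℝ), ((Real.sinh r ^ 2 : ℝ) : ℂ) * f r := by
  rw [radialMeasure, integral_smul_measure,
    integral_withDensity_eq_integral_toReal_smul measurable_ofReal_sinh_sq (by simp)]
  simp only [ENNReal.toReal_ofReal (sq_nonneg _), Complex.real_smul]

theorem integrable_radialMeasure_iff {f : ℝ → ℂ} : Integrable f radialMeasure ↔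
    IntegrableOn (fun r => ((Real.sinh r ^ 2 : ℝ) : ℂ) * f r) (Set.Ioi 0) := by
  rw [radialMeasure, integrable_smul_measure sphereArea_ne_zero sphereArea_ne_top,
    integrable_withDensity_iff_integrable_smul' measurable_ofReal_sinh_sq (by simp)]
  simp only [ENNReal.toReal_ofReal (sq_nonneg _), Complex.real_smul]
  rfl

theorem waveAmp_ne_zero {a : ℝ} (ha : 0 < a) (t : ℝ) : waveAmp a t ≠ 0 := by
  rw [← norm_pos_iff, norm_waveAmp ha]
  exact Real.rpow_pos_of_pos (norm_pos_iff.2 (cTime_ne_zero ha t)) _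

theorem waveWidth_zero (a : ℝ) : waveWidth a 0 = (((4 * a)⁻¹ : ℝ) : ℂ) := by
  simp [waveWidth, cTime]

theorem sinh_mul_gaussianWave (a t r : ℝ) : (Real.sinh r : ℂ) * gaussianWave a t (Real.sinh r ^ 2) =
    waveAmp a t * Complex.exp (-waveWidth a t * (r ^ 2 : ℝ)) * r := by
  have h1 : (Real.sinh r : ℂ) * arsinhRatio (Real.sinh r ^ 2) = r := by
    exact_mod_cast sinh_mul_arsinhRatio r
  rw [gaussianWave, gaussian, geodesicSq_sinh_sq]
  linear_combination waveAmp a t * Complex.exp (-waveWidth a t * (r ^ 2 : ℝ)) * h1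

/-- The span of the Gaussian profiles. -/
def gaussianSpan : Submodule ℂ (Lp ℂ 2 radialMeasure) :=
  Submodule.span ℂ {h | ∃ (a : ℝ) (ha : 0 < a), h = (memLp_gaussianProfile ha).toLp}

/-- Orthogonality of `h` to the Gaussian of width `n + 1` says that the `n`-th moment of `q =
e^{-r²} r sinh r · h` in the variable `e^{-r²}` vanishes; hence `q = 0`, and so `h = 0`. -/
theorem gaussianSpan_dense : gaussianSpan.topologicalClosure = ⊤ := by
  rw [Submodule.topologicalClosure_eq_top_iff, Submodule.eq_bot_iff]
  intro h hh
  set q : ℝ → ℂ := fun r => (Real.exp (-r ^ 2) : ℂ) * (r * (Real.sinh r * h r))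
  have hkey (n : ℕ) : IntegrableOn (fun r => ((Real.exp (-r ^ 2) ^ n : ℝ) : ℂ) * q r) (Set.Ioi 0) ∧
      ∫ r in Set.Ioi (0 : ℝ), ((Real.exp (-r ^ 2) ^ n : ℝ) : ℂ) * q r = 0 := by
    -- The width at time zero is `(4a)⁻¹ = n + 1`. One factor `e^{-r²}` goes into `q`, so that the
    -- case `n = 0` gives the integrability of `q`.
    set a : ℝ := (4 * (n + 1))⁻¹ with ha'
    have ha : 0 < a := by positivity
    have hw : waveWidth a 0 = ((n + 1 : ℝ) : ℂ) := by
      rw [waveWidth_zero, ha']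
      congr 1
      field_simp
    set G := (memLp_gaussianProfile ha).toLp
    have hG : G =ᵐ[volume.restrict (Set.Ioi 0)] gaussianProfile a :=
      ae_radialMeasure_iff.1 (memLp_gaussianProfile ha).coeFn_toLp
    have h1 : inner ℂ G h = 0 := hh G (Submodule.subset_span ⟨a, ha, rfl⟩)
    have h2 := L2.integrable_inner (𝕜 := ℂ) G h
    rw [L2.inner_def, integral_radialMeasure] at h1
    rw [integrable_radialMeasure_iff] at h2
    have hc : (starRingEnd ℂ) (waveAmp a 0) ≠ 0 := by
      simpa using waveAmp_ne_zero ha 0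
    have he : (fun r => ((Real.sinh r ^ 2 : ℝ) : ℂ) * inner ℂ (G r) (h r))
        =ᵐ[volume.restrict (Set.Ioi 0)]
        fun r => (starRingEnd ℂ) (waveAmp a 0) * (((Real.exp (-r ^ 2) ^ n : ℝ) : ℂ) * q r) := by
      filter_upwards [hG] with r hr
      rw [RCLike.inner_apply, hr, gaussianProfile]
      have h3 := congrArg (starRingEnd ℂ) (sinh_mul_gaussianWave a 0 r)
      rw [hw] at h3
      have h4 : Complex.exp (-((n + 1 : ℝ) : ℂ) * (r ^ 2 : ℝ)) =
          ((Real.exp (-r ^ 2) ^ n * Real.exp (-r ^ 2) : ℝ) : ℂ) := by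
        rw [← pow_succ, ← Real.exp_nat_mul, Complex.ofReal_exp]
        congr 1
        push_cast
        ring
      rw [h4] at h3
      simp only [map_mul, Complex.conj_ofReal] at h3
      simp only [q]
      push_cast at h3 ⊢
      linear_combination (Complex.sinh r * h r) * h3
    refine ⟨?_, ?_⟩
    · have h5 : IntegrableOn (fun r => (starRingEnd ℂ) (waveAmp a 0) *
          (((Real.exp (-r ^ 2) ^ n : ℝ) : ℂ) * q r)) (Set.Ioi 0) := h2.congr he
      exact (integrable_const_mul_iff (Ne.isUnit hc) _).1 h5
    · rw [integral_congr_ae he, integral_const_mul] at h1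
      have h6 : sphereArea.toReal ≠ 0 :=
        (ENNReal.toReal_pos sphereArea_ne_zero sphereArea_ne_top).ne'
      simpa [h6, waveAmp_ne_zero ha 0] using h1
  have hz := ae_eq_zero_of_gaussian_moments (q := q) (by simpa using (hkey 0).1)
    fun n => (hkey n).2
  refine Lp.ext (EventuallyEq.trans ?_ (Lp.coeFn_zero _ _ _).symm)
  refine ae_radialMeasure_iff.2 ?_
  filter_upwards [hz, ae_restrict_mem measurableSet_Ioi] with r hr (h0 : 0 < r)
  have h1 : Real.sinh r ≠ 0 := (Real.sinh_pos_iff.2 h0).ne'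
  have h2 : (Real.sinh r : ℂ) ≠ 0 := by exact_mod_cast h1
  have h3 : (r : ℂ) ≠ 0 := by exact_mod_cast h0.ne'
  have h4 : (Real.exp (-r ^ 2) : ℂ) ≠ 0 := by exact_mod_cast (Real.exp_pos _).ne'
  have := (mul_eq_zero.1 ((mul_eq_zero.1 ((mul_eq_zero.1 hr).resolve_left h4)).resolve_left
    h3)).resolve_left h2
  simpa using this

theorem radialLift_mem_closure_strongData (h : Lp ℂ 2 radialMeasure) :
    radialLift h ∈ strongData.topologicalClosure := by
  have hS : gaussianSpan ≤ strongData.comap radialLift.toLinearMap := by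
    refine Submodule.span_le.2 ?_
    rintro _ ⟨a, ha, rfl⟩
    refine ⟨gaussianWaveLp ha, ?_⟩
    have := isStrongSolution_gaussianWave ha
    rwa [← radialLift_gaussianProfile ha] at this
  have hh : h ∈ gaussianSpan.topologicalClosure := gaussianSpan_dense ▸ Submodule.mem_top
  exact map_mem_closure radialLift.continuous hh fun x hx => hS hx

/-! ### Plancherel for the radial Fourier transform. -/

open FourierTransform in
theorem continuous_fourier_of_integrable {g : ℝ → ℂ} (hg : Integrable g) : Continuous (𝓕 g) :=
  VectorFourier.fourierIntegral_continuous Real.continuous_fourierChar continuous_inner hg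

open FourierTransform in
/-- On `L¹ ∩ L²` the Fourier integral agrees with the Plancherel transform. -/
theorem coeFn_fourier_toLp {g : ℝ → ℂ} (hg : Integrable g) (m : MemLp g 2) :
    (𝓕 m.toLp : Lp ℂ 2 (volume : Measure ℝ)) =ᵐ[volume] 𝓕 g := by
  -- Both sides are compared against test functions: the transform is moved onto the test function
  -- by the distributional definition on one side and by Fubini on the other.
  refine ae_eq_of_integral_contDiff_smul_eq
    ((Lp.memLp _).locallyIntegrable (by norm_num))
    (continuous_fourier_of_integrable hg).locallyIntegrable fun φ hφ hφc => ?_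
  have h1 : HasCompactSupport fun x => (φ x : ℂ) := hφc.comp_left (g := ((↑) : ℝ → ℂ)) rfl
  have h2 : ContDiff ℝ ∞ fun x => (φ x : ℂ) := Complex.ofRealCLM.contDiff.comp hφ
  set ψ := h1.toSchwartzMap h2
  have hψ (x : ℝ) : ψ x = φ x := rfl
  have h3 := congrArg (fun T => T ψ) (Lp.fourier_toTemperedDistribution_eq m.toLp)
  simp only [TemperedDistribution.fourier_apply, Lp.toTemperedDistribution_apply] at h3
  have h4 : ∫ x, φ x • (𝓕 m.toLp : Lp ℂ 2 (volume : Measure ℝ)) x =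
      ∫ x, ψ x • (𝓕 m.toLp : Lp ℂ 2 (volume : Measure ℝ)) x := by
    simp only [hψ, Complex.real_smul, smul_eq_mul]
  have h5 : ∫ x, φ x • 𝓕 g x = ∫ x, ψ x • 𝓕 g x := by
    simp only [hψ, Complex.real_smul, smul_eq_mul]
  rw [h4, h5, ← h3]
  have h6 : ∫ x, (𝓕 ψ : SchwartzMap ℝ ℂ) x • (MemLp.toLp g m : Lp ℂ 2 (volume : Measure ℝ)) x = ∫ x, (𝓕 ψ : SchwartzMap ℝ ℂ) x • g x := by
    refine integral_congr_ae ?_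
    filter_upwards [m.coeFn_toLp] with x hx
    rw [hx]
  rw [h6, SchwartzMap.fourier_coe]
  simpa using! (VectorFourier.integral_fourierIntegral_smul_eq_flip (L := innerₗ ℝ) (μ := volume)
    (ν := volume) Real.continuous_fourierChar continuous_inner ψ.integrable hg)

/-- The one-dimensional function `sinh r f(r)` on the half-line, extended by zero. -/
def sinhWeight (f : ℝ → ℂ) : ℝ → ℂ := (Set.Ioi 0).indicator fun r => (Real.sinh r : ℂ) * f r

theorem aestronglyMeasurable_sinhWeight {f : ℝ → ℂ} (hf : AEStronglyMeasurable f radialMeasure) :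
    AEStronglyMeasurable (sinhWeight f) := by
  refine (aestronglyMeasurable_indicator_iff measurableSet_Ioi).2 ?_
  have h : AEStronglyMeasurable f (volume.restrict (Set.Ioi 0)) := by
    obtain ⟨k, hk, hk'⟩ := hf
    exact ⟨k, hk, ae_radialMeasure_iff.1 hk'⟩
  exact AEStronglyMeasurable.mul (by fun_prop) h

theorem lintegral_radialMeasure (f : ℝ → ENNReal) :
    ∫⁻ r, f r ∂radialMeasure =
      sphereArea * ∫⁻ r in Set.Ioi (0 : ℝ), ENNReal.ofReal (Real.sinh r ^ 2) * f r := by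
  rw [radialMeasure, lintegral_smul_measure,
    lintegral_withDensity_eq_lintegral_mul_non_measurable _ measurable_ofReal_sinh_sq (by simp)]
  rfl

theorem eLpNorm_sinhWeight_sq (f : ℝ → ℂ) :
    sphereArea * eLpNorm (sinhWeight f) 2 volume ^ 2 = eLpNorm f 2 radialMeasure ^ 2 := by
  rw [eLpNorm_two_sq, eLpNorm_two_sq, lintegral_radialMeasure, ← lintegral_indicator measurableSet_Ioi]
  congr 2
  ext r
  by_cases hr : r ∈ Set.Ioi (0 : ℝ)
  · rw [sinhWeight, Set.indicator_of_mem hr, Set.indicator_of_mem hr, enorm_mul, mul_pow,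
      ← ofReal_norm, Complex.norm_real, Real.norm_eq_abs, ← ENNReal.ofReal_pow (abs_nonneg _),
      sq_abs]
  · rw [sinhWeight, Set.indicator_of_notMem hr, Set.indicator_of_notMem hr]
    simp

theorem memLp_sinhWeight {f : ℝ → ℂ} (hf : MemLp f 2 radialMeasure) : MemLp (sinhWeight f) 2 := by
  refine ⟨aestronglyMeasurable_sinhWeight hf.1, ?_⟩
  by_contra hcon
  rw [not_lt, top_le_iff] at hcon
  have h := eLpNorm_sinhWeight_sq f
  rw [hcon] at h
  have h2 : eLpNorm f 2 radialMeasure ^ 2 ≠ ⊤ := ENNReal.pow_ne_top hf.2.ne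
  rw [← h] at h2
  simp [ENNReal.mul_top, sphereArea_ne_zero] at h2

/-- The restriction of `sinhWeight f` to `(0, R]`. -/
def truncWeight (f : ℝ → ℂ) (R : ℝ) : ℝ → ℂ := (Set.Ioc 0 R).indicator (sinhWeight f)

theorem memLp_truncWeight {f : ℝ → ℂ} (hf : MemLp f 2 radialMeasure) (R : ℝ) :
    MemLp (truncWeight f R) 2 :=
  (memLp_sinhWeight hf).indicator measurableSet_Ioc

theorem integrable_truncWeight {f : ℝ → ℂ} (hf : MemLp f 2 radialMeasure) (R : ℝ) :
    Integrable (truncWeight f R) := by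
  rw [truncWeight, integrable_indicator_iff measurableSet_Ioc]
  exact ((memLp_sinhWeight hf).restrict (Set.Ioc 0 R)).integrable (by norm_num)

/-- The measure `ξ² dξ` on the half-line. -/
def spectralMeasure : Measure ℝ :=
  (volume.restrict (Set.Ioi 0)).withDensity fun ξ => ENNReal.ofReal (ξ ^ 2)

theorem eLpNorm_spectralMeasure_sq (F : ℝ → ℂ) : eLpNorm F 2 spectralMeasure ^ 2 =
    ∫⁻ ξ in Set.Ioi (0 : ℝ), ‖F ξ‖ₑ ^ 2 * ENNReal.ofReal (ξ ^ 2) := by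
  rw [eLpNorm_two_sq, spectralMeasure,
    lintegral_withDensity_eq_lintegral_mul_non_measurable _ (by fun_prop) (by simp)]
  simp only [Pi.mul_apply, mul_comm]

theorem aestronglyMeasurable_spectralMeasure {F : ℝ → ℂ}
    (hF : AEStronglyMeasurable F (volume.restrict (Set.Ioi 0))) :
    AEStronglyMeasurable F spectralMeasure :=
  hF.mono_ac (withDensity_absolutelyContinuous _ _)

theorem isRadialFourier_iff {C : ℂ} {f F : ℝ → ℂ} : IsRadialFourier C f F ↔
    AEStronglyMeasurable F (volume.restrict (Set.Ioi (0 : ℝ))) ∧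
    Tendsto (fun R => eLpNorm (fun ξ => truncRadialFourier C f R ξ - F ξ) 2 spectralMeasure)
      atTop (𝓝 0) := by
  refine and_congr_right fun _ => ?_
  simp only [← eLpNorm_spectralMeasure_sq]
  refine ⟨ennreal_tendsto_zero_of_sq, fun h => ?_⟩
  have := ((ENNReal.continuous_pow 2).tendsto 0).comp h
  simpa [Function.comp_def] using this

/-- The radial transform in terms of a one-dimensional Fourier transform `G`. -/
def sineTransform (C : ℂ) (G : ℝ → ℂ) (ξ : ℝ) : ℂ :=
  C / ξ * ((2 * Complex.I)⁻¹ * (G (-(2 * Real.pi)⁻¹ * ξ) - G ((2 * Real.pi)⁻¹ * ξ)))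

open FourierTransform in
-- The sine is split into exponentials; the kernel `e^{-2πivr}` accounts for the frequencies
-- `±ξ/(2π)`. The truncation makes the function integrable, so the Fourier integral exists
-- pointwise.
theorem truncRadialFourier_eq {C : ℂ} {f : ℝ → ℂ} (hf : MemLp f 2 radialMeasure) {R : ℝ}
    (hR : 0 ≤ R) (ξ : ℝ) :
    truncRadialFourier C f R ξ = sineTransform C (𝓕 (truncWeight f R)) ξ := by
  rw [truncRadialFourier, sineTransform]
  congr 1
  have hi := integrable_truncWeight hf R
  have hF (v : ℝ) : 𝓕 (truncWeight f R) v =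
      ∫ r : ℝ, Complex.exp (-2 * Real.pi * v * r * Complex.I) * truncWeight f R r := by
    rw [Real.fourier_real_eq_integral_exp_smul]
    refine integral_congr_ae (Eventually.of_forall fun r => ?_)
    simp only [smul_eq_mul]
    congr 2
    push_cast
    ring
  have hint (v : ℝ) :
      Integrable fun r : ℝ => Complex.exp (-2 * Real.pi * v * r * Complex.I) * truncWeight f R r := by
    refine hi.bdd_mul (c := 1) (by fun_prop) (Eventually.of_forall fun r => ?_)
    rw [show (-2 * Real.pi * v * r * Complex.I : ℂ) = ((-2 * Real.pi * v * r : ℝ) : ℂ) * Complex.I by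
      push_cast; ring, Complex.norm_exp_ofReal_mul_I]
  rw [hF, hF, ← integral_sub (hint _) (hint _), ← integral_const_mul,
    intervalIntegral.integral_of_le hR, ← integral_indicator measurableSet_Ioc]
  refine integral_congr_ae (Eventually.of_forall fun r => ?_)
  have hpi : (Real.pi : ℂ) ≠ 0 := by exact_mod_cast Real.pi_ne_zero
  simp only [truncWeight]
  by_cases hr : r ∈ Set.Ioc 0 R
  · rw [Set.indicator_of_mem hr, Set.indicator_of_mem hr, sinhWeight,
      Set.indicator_of_mem (show r ∈ Set.Ioi 0 from hr.1), Complex.ofReal_sin, Complex.sin]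
    have e1 : (-2 * Real.pi * ((-(2 * Real.pi)⁻¹ * ξ : ℝ) : ℂ) * r * Complex.I) =
        ((ξ * r : ℝ) : ℂ) * Complex.I := by
      push_cast
      field_simp
    have e2 : (-2 * Real.pi * (((2 * Real.pi)⁻¹ * ξ : ℝ) : ℂ) * r * Complex.I) =
        -((ξ * r : ℝ) : ℂ) * Complex.I := by
      push_cast
      field_simp
    rw [e1, e2, mul_inv, Complex.inv_I]
    ring
  · rw [Set.indicator_of_notMem hr, Set.indicator_of_notMem hr]
    simp

theorem eLpNorm_comp_mul_left_le {G : ℝ → ℂ} {c : ℝ} (hc : c ≠ 0) (hG : AEStronglyMeasurable G) :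
    AEStronglyMeasurable (fun ξ => G (c * ξ)) ∧
    eLpNorm (fun ξ => G (c * ξ)) 2 volume =
      ENNReal.ofReal |c⁻¹| ^ (1 / 2 : ℝ) * eLpNorm G 2 volume := by
  have h1 := Real.map_volume_mul_left hc
  have h2 : AEStronglyMeasurable G (Measure.map (c * ·) volume) := by
    rw [h1]
    exact hG.smul_measure _
  refine ⟨h2.comp_measurable (measurable_const_mul c), ?_⟩
  have h3 := eLpNorm_map_measure (p := 2) h2 (measurable_const_mul c).aemeasurable
  rw [h1, eLpNorm_smul_measure_of_ne_top (by simp)] at h3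
  rw [show (fun ξ => G (c * ξ)) = G ∘ (c * ·) from rfl, ← h3]
  simp

/-- Bound of `sineTransform C` as an operator into `L²(ξ² dξ)`. -/
def sineConst (C : ℂ) : ENNReal :=
  ‖C * (2 * Complex.I)⁻¹‖ₑ * (2 * ENNReal.ofReal |((2 * Real.pi)⁻¹)⁻¹| ^ (1 / 2 : ℝ))

theorem sineConst_ne_top (C : ℂ) : sineConst C ≠ ⊤ := by
  refine ENNReal.mul_ne_top enorm_ne_top (ENNReal.mul_ne_top (by simp) ?_)
  exact ENNReal.rpow_ne_top_of_nonneg (by norm_num) ENNReal.ofReal_ne_top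

/-- The weight `ξ²` cancels the factor `1/ξ`, and what remains is a difference of two dilates of
`G`. -/
theorem eLpNorm_sineTransform_le (C : ℂ) {G : ℝ → ℂ} (hG : AEStronglyMeasurable G) :
    eLpNorm (sineTransform C G) 2 spectralMeasure ≤ sineConst C * eLpNorm G 2 volume := by
  have hc : (2 * Real.pi)⁻¹ ≠ 0 := by positivity
  obtain ⟨m1, e1⟩ := eLpNorm_comp_mul_left_le (neg_ne_zero.2 hc) hG
  obtain ⟨m2, e2⟩ := eLpNorm_comp_mul_left_le hc hG
  set H : ℝ → ℂ := (fun ξ => G (-(2 * Real.pi)⁻¹ * ξ)) - fun ξ => G ((2 * Real.pi)⁻¹ * ξ)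
  have h1 : eLpNorm (sineTransform C G) 2 spectralMeasure ≤
      eLpNorm ((C * (2 * Complex.I)⁻¹) • H) 2 volume := by
    have h2 : eLpNorm (sineTransform C G) 2 spectralMeasure ^ 2 ≤
        eLpNorm ((C * (2 * Complex.I)⁻¹) • H) 2 volume ^ 2 := by
      rw [eLpNorm_spectralMeasure_sq, eLpNorm_two_sq]
      refine le_trans (setLIntegral_mono' measurableSet_Ioi fun ξ (hξ : 0 < ξ) => ?_)
        (setLIntegral_le_lintegral (Set.Ioi 0) _)
      have hξ' : (ξ : ℂ) ≠ 0 := by exact_mod_cast hξ.ne'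
      have e3 : ENNReal.ofReal (ξ ^ 2) = ‖(ξ : ℂ)‖ₑ ^ 2 := by
        rw [← ofReal_norm, Complex.norm_real, Real.norm_eq_abs, ← ENNReal.ofReal_pow (abs_nonneg _),
          sq_abs]
      rw [e3, ← mul_pow, ← enorm_mul]
      refine le_of_eq ?_
      congr 2
      simp only [sineTransform, H, Pi.smul_apply, Pi.sub_apply, smul_eq_mul]
      field_simp
    exact (ENNReal.pow_le_pow_left_iff two_ne_zero).1 h2
  refine h1.trans ?_
  rw [eLpNorm_const_smul, sineConst, mul_assoc]
  gcongr
  refine (eLpNorm_sub_le m1 m2 (by norm_num)).trans ?_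
  rw [e1, e2, inv_neg, abs_neg, mul_assoc]
  exact (two_mul _).ge

theorem sineTransform_sub (C : ℂ) (G H : ℝ → ℂ) (ξ : ℝ) :
    sineTransform C G ξ - sineTransform C H ξ = sineTransform C (G - H) ξ := by
  simp only [sineTransform, Pi.sub_apply]; ring

theorem stronglyMeasurable_sineTransform (C : ℂ) {G : ℝ → ℂ} (hG : StronglyMeasurable G) :
    StronglyMeasurable (sineTransform C G) := by
  have h := hG.measurable
  refine Measurable.stronglyMeasurable ?_
  unfold sineTransform
  fun_prop

theorem tendsto_truncWeight {f : ℝ → ℂ} (hf : MemLp f 2 radialMeasure) :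
    Tendsto (fun R => (memLp_truncWeight hf R).toLp) atTop (𝓝 (memLp_sinhWeight hf).toLp) := by
  rw [Lp.tendsto_Lp_iff_tendsto_eLpNorm'']
  refine tendsto_eLpNorm_two_of_dominated
    (Eventually.of_forall fun R => (memLp_truncWeight hf R).1.sub (memLp_sinhWeight hf).1)
    (memLp_sinhWeight hf).norm (Eventually.of_forall fun R => Eventually.of_forall fun r => ?_)
    (Eventually.of_forall fun r => ?_)
  · simp only [Pi.sub_apply, truncWeight]
    by_cases hr : r ∈ Set.Ioc 0 R
    · simp [Set.indicator_of_mem hr]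
    · simp [Set.indicator_of_notMem hr]
  · refine tendsto_const_nhds.congr' ?_
    filter_upwards [eventually_ge_atTop r] with R hR
    simp only [Pi.sub_apply, truncWeight]
    by_cases hr : 0 < r
    · simp [Set.indicator_of_mem (show r ∈ Set.Ioc 0 R from ⟨hr, hR⟩)]
    · simp [Set.indicator_of_notMem (show r ∉ Set.Ioc 0 R from fun h => hr h.1), sinhWeight,
        Set.indicator_of_notMem (show r ∉ Set.Ioi 0 from hr)]

open FourierTransform in
-- By linearity the error is the sine transform of the Fourier transform of the discarded tail, and
-- Plancherel bounds it by the `L²` norm of that tail.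
theorem isRadialFourier_sineTransform (C : ℂ) {f : ℝ → ℂ} (hf : MemLp f 2 radialMeasure)
    {G : ℝ → ℂ} (hG : StronglyMeasurable G)
    (h : (𝓕 (memLp_sinhWeight hf).toLp : Lp ℂ 2 (volume : Measure ℝ)) =ᵐ[volume] G) :
    IsRadialFourier C f (sineTransform C G) := by
  rw [isRadialFourier_iff]
  refine ⟨(stronglyMeasurable_sineTransform C hG).aestronglyMeasurable, ?_⟩
  have h1 (R : ℝ) (hR : 0 ≤ R) :
      eLpNorm (fun ξ => truncRadialFourier C f R ξ - sineTransform C G ξ) 2 spectralMeasure ≤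
      sineConst C * ‖(memLp_truncWeight hf R).toLp - (memLp_sinhWeight hf).toLp‖ₑ := by
    simp only [truncRadialFourier_eq hf hR, sineTransform_sub]
    have hm := continuous_fourier_of_integrable (integrable_truncWeight hf R)
    refine (eLpNorm_sineTransform_le C (hm.aestronglyMeasurable.sub hG.aestronglyMeasurable)).trans ?_
    gcongr
    refine le_of_eq ?_
    have h2 : (𝓕 (truncWeight f R) - G) =ᵐ[volume]
        (𝓕 ((memLp_truncWeight hf R).toLp - (memLp_sinhWeight hf).toLp) :
          Lp ℂ 2 (volume : Measure ℝ)) := by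
      rw [show 𝓕 ((memLp_truncWeight hf R).toLp - (memLp_sinhWeight hf).toLp) =
          𝓕 (memLp_truncWeight hf R).toLp - 𝓕 (memLp_sinhWeight hf).toLp from
        map_sub (Lp.fourierTransformₗᵢ ℝ ℂ) _ _]
      filter_upwards [h, coeFn_fourier_toLp (integrable_truncWeight hf R) (memLp_truncWeight hf R),
        Lp.coeFn_sub (𝓕 (memLp_truncWeight hf R).toLp) (𝓕 (memLp_sinhWeight hf).toLp)]
        with x e1 e2 e3
      rw [e3, Pi.sub_apply, Pi.sub_apply, e1, e2]
    rw [eLpNorm_congr_ae h2, ← Lp.enorm_def, ← ofReal_norm, Lp.norm_fourier_eq, ofReal_norm]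
  have h2 : Tendsto (fun R => sineConst C *
      ‖(memLp_truncWeight hf R).toLp - (memLp_sinhWeight hf).toLp‖ₑ) atTop (𝓝 0) := by
    have h3 := (tendsto_truncWeight hf).sub_const (memLp_sinhWeight hf).toLp
    rw [sub_self] at h3
    have h4 := ENNReal.Tendsto.const_mul (a := sineConst C) h3.enorm (Or.inr (sineConst_ne_top C))
    simpa using h4
  refine tendsto_of_tendsto_of_tendsto_of_le_of_le' tendsto_const_nhds h2
    (Eventually.of_forall fun _ => zero_le) ?_
  filter_upwards [eventually_ge_atTop 0] with R hR using h1 R hR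

theorem exists_isRadialFourier (C : ℂ) {f : ℝ → ℂ} (hf : MemLp f 2 radialMeasure) :
    ∃ F, IsRadialFourier C f F ∧
      eLpNorm F 2 spectralMeasure ≤ sineConst C * eLpNorm (sinhWeight f) 2 volume := by
  refine ⟨_, isRadialFourier_sineTransform C hf (Lp.stronglyMeasurable _) EventuallyEq.rfl,
    (eLpNorm_sineTransform_le C (Lp.aestronglyMeasurable _)).trans ?_⟩
  rw [← Lp.enorm_def, ← ofReal_norm, Lp.norm_fourier_eq, ofReal_norm, Lp.enorm_toLp]

theorem aestronglyMeasurable_truncRadialFourier (C : ℂ) {f : ℝ → ℂ} (hf : MemLp f 2 radialMeasure)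
    {R : ℝ} (hR : 0 ≤ R) : AEStronglyMeasurable (truncRadialFourier C f R) spectralMeasure := by
  rw [show truncRadialFourier C f R = _ from funext fun ξ => truncRadialFourier_eq (C := C) hf hR ξ]
  exact (stronglyMeasurable_sineTransform C (continuous_fourier_of_integrable
    (integrable_truncWeight hf R)).stronglyMeasurable).aestronglyMeasurable

/-- Two limits of the same truncations agree, so the bound known for the constructed transform
passes to every transform of `f`. -/
theorem IsRadialFourier.eLpNorm_sub_eq_zero {C : ℂ} {f F G : ℝ → ℂ} (hf : MemLp f 2 radialMeasure)
    (hF : IsRadialFourier C f F) (hG : IsRadialFourier C f G) :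
    eLpNorm (F - G) 2 spectralMeasure = 0 := by
  rw [isRadialFourier_iff] at hF hG
  have h := hF.2.add hG.2
  rw [add_zero] at h
  refine le_antisymm (ge_of_tendsto h ?_) (zero_le)
  filter_upwards [eventually_ge_atTop 0] with R hR
  have m := aestronglyMeasurable_truncRadialFourier C hf hR
  have e : F - G = (fun ξ => truncRadialFourier C f R ξ - G ξ) -
      fun ξ => truncRadialFourier C f R ξ - F ξ := by
    ext ξ; simp
  rw [e, add_comm]
  exact eLpNorm_sub_le (m.sub (aestronglyMeasurable_spectralMeasure hG.1))
    (m.sub (aestronglyMeasurable_spectralMeasure hF.1)) (by norm_num)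

theorem IsRadialFourier.eLpNorm_le {C : ℂ} {f F : ℝ → ℂ} (hf : MemLp f 2 radialMeasure)
    (hF : IsRadialFourier C f F) :
    eLpNorm F 2 spectralMeasure ≤ sineConst C * eLpNorm (sinhWeight f) 2 volume := by
  obtain ⟨G, hG, hb⟩ := exists_isRadialFourier C hf
  have h := hF.eLpNorm_sub_eq_zero hf hG
  have mF := aestronglyMeasurable_spectralMeasure hF.1
  have mG := aestronglyMeasurable_spectralMeasure hG.1
  calc eLpNorm F 2 spectralMeasure = eLpNorm ((F - G) + G) 2 spectralMeasure := by
        rw [sub_add_cancel]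
    _ ≤ eLpNorm (F - G) 2 spectralMeasure + eLpNorm G 2 spectralMeasure :=
        eLpNorm_add_le (mF.sub mG) mG (by norm_num)
    _ ≤ _ := by rw [h, zero_add]; exact hb

theorem intervalIntegrable_truncRadialFourier {f : ℝ → ℂ} (hf : MemLp f 2 radialMeasure)
    {R : ℝ} (hR : 0 ≤ R) (ξ : ℝ) : IntervalIntegrable
      (fun r => (Real.sin (ξ * r) : ℂ) * f r * (Real.sinh r : ℂ)) volume 0 R := by
  rw [intervalIntegrable_iff_integrableOn_Ioc_of_le hR]
  have h := integrable_truncWeight hf R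
  rw [truncWeight, integrable_indicator_iff measurableSet_Ioc] at h
  have h2 : IntegrableOn (fun r => (Real.sin (ξ * r) : ℂ) * sinhWeight f r) (Set.Ioc 0 R) := by
    refine h.bdd_mul (c := 1) (by fun_prop) (Eventually.of_forall fun r => ?_)
    rw [Complex.norm_real]
    exact Real.abs_sin_le_one _
  refine h2.congr_fun (fun r hr => ?_) measurableSet_Ioc
  simp only [sinhWeight, Set.indicator_of_mem (show r ∈ Set.Ioi 0 from hr.1)]
  ring

theorem IsRadialFourier.add {C : ℂ} {f g F G : ℝ → ℂ} (hf : MemLp f 2 radialMeasure)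
    (hg : MemLp g 2 radialMeasure) (hF : IsRadialFourier C f F) (hG : IsRadialFourier C g G) :
    IsRadialFourier C (f + g) (F + G) := by
  rw [isRadialFourier_iff] at hF hG ⊢
  refine ⟨hF.1.add hG.1, ?_⟩
  have h := hF.2.add hG.2
  rw [add_zero] at h
  refine tendsto_of_tendsto_of_tendsto_of_le_of_le' tendsto_const_nhds h
    (Eventually.of_forall fun _ => zero_le) ?_
  filter_upwards [eventually_ge_atTop 0] with R hR
  have m1 := aestronglyMeasurable_truncRadialFourier C hf hR
  have m2 := aestronglyMeasurable_truncRadialFourier C hg hR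
  have e : (fun ξ => truncRadialFourier C (f + g) R ξ - (F + G) ξ) =
      (fun ξ => truncRadialFourier C f R ξ - F ξ) + fun ξ => truncRadialFourier C g R ξ - G ξ := by
    ext ξ
    simp only [truncRadialFourier, Pi.add_apply, mul_add, add_mul]
    rw [intervalIntegral.integral_add (intervalIntegrable_truncRadialFourier hf hR ξ)
      (intervalIntegrable_truncRadialFourier hg hR ξ)]
    ring
  rw [e]
  exact eLpNorm_add_le (m1.sub (aestronglyMeasurable_spectralMeasure hF.1))
    (m2.sub (aestronglyMeasurable_spectralMeasure hG.1)) (by norm_num)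

theorem IsRadialFourier.smul {C : ℂ} {f F : ℝ → ℂ} (c : ℂ) (hF : IsRadialFourier C f F) :
    IsRadialFourier C (c • f) (c • F) := by
  rw [isRadialFourier_iff] at hF ⊢
  refine ⟨hF.1.const_smul c, ?_⟩
  have h := ENNReal.Tendsto.const_mul (a := ‖c‖ₑ) hF.2 (Or.inr enorm_ne_top)
  rw [mul_zero] at h
  refine h.congr fun R => ?_
  rw [← eLpNorm_const_smul]
  congr 1
  ext ξ
  simp only [truncRadialFourier, Pi.smul_apply, smul_eq_mul]
  have : ∀ r, (Real.sin (ξ * r) : ℂ) * (c * f r) * (Real.sinh r : ℂ) =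
      c * ((Real.sin (ξ * r) : ℂ) * f r * (Real.sinh r : ℂ)) := fun r => by ring
  simp only [this, intervalIntegral.integral_const_mul]
  ring

theorem IsRadialFourier.congr {C : ℂ} {f g F : ℝ → ℂ} (h : f =ᵐ[radialMeasure] g)
    (hF : IsRadialFourier C f F) : IsRadialFourier C g F := by
  refine ⟨hF.1, hF.2.congr' ?_⟩
  filter_upwards [eventually_ge_atTop 0] with R hR
  have e (ξ : ℝ) : truncRadialFourier C f R ξ = truncRadialFourier C g R ξ := by
    rw [truncRadialFourier, truncRadialFourier]
    congr 1
    rw [intervalIntegral.integral_of_le hR, intervalIntegral.integral_of_le hR]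
    refine integral_congr_ae ?_
    filter_upwards [ae_restrict_of_ae_restrict_of_subset Set.Ioc_subset_Ioi_self
      (ae_radialMeasure_iff.1 h)] with r hr
    rw [hr]
  simp only [e]

/-! ### The radial Fourier transform of the Gaussian profiles. -/

open FourierTransform in
-- Multiplication by `x` becomes differentiation in frequency, so this is the derivative of the
-- transform of a Gaussian.
theorem fourier_mul_gaussian {a : ℝ} (ha : 0 < a) (ξ : ℝ) :
    𝓕 (fun x : ℝ => (x : ℂ) * Complex.exp (-((4 * a)⁻¹ : ℝ) * x ^ 2)) ξ =
      -(4 * Real.pi * Complex.I * a * ξ) * ((Real.sqrt (4 * Real.pi * a) : ℝ) : ℂ) *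
        Complex.exp (-(4 * Real.pi ^ 2 * a * ξ ^ 2 : ℝ)) := by
  have hpi := Real.pi_pos
  have hpi' : (Real.pi : ℂ) ≠ 0 := by exact_mod_cast hpi.ne'
  have ha' : (a : ℂ) ≠ 0 := by exact_mod_cast ha.ne'
  set b : ℝ := (4 * Real.pi * a)⁻¹ with hb
  have hb0 : 0 < b := by positivity
  have hf : (fun x : ℝ => Complex.exp (-Real.pi * (b : ℂ) * x ^ 2)) =
      fun x : ℝ => Complex.exp (-((4 * a)⁻¹ : ℝ) * x ^ 2) := by
    ext x
    congr 2
    rw [hb]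
    push_cast
    field_simp
  have hbase := fourier_gaussian_pi (b := (b : ℂ)) (by simpa using hb0)
  rw [hf] at hbase
  have hinv : 1 / (b : ℂ) ^ (1 / 2 : ℂ) = ((Real.sqrt (4 * Real.pi * a) : ℝ) : ℂ) := by
    have h1 : (b : ℂ) ^ (1 / 2 : ℂ) = ((b ^ (1 / 2 : ℝ) : ℝ) : ℂ) := by
      rw [Complex.ofReal_cpow hb0.le]; norm_num
    rw [h1, ← Real.sqrt_eq_rpow, hb, Real.sqrt_inv]
    push_cast
    simp
  rw [hinv] at hbase
  set f : ℝ → ℂ := fun x => Complex.exp (-((4 * a)⁻¹ : ℝ) * x ^ 2)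
  have hre : (0 : ℝ) < (((4 * a)⁻¹ : ℝ) : ℂ).re := by rw [Complex.ofReal_re]; positivity
  have i1 : Integrable f := integrable_cexp_neg_mul_sq hre
  have i2 : Integrable fun x : ℝ => x • f x := by
    simp only [Complex.real_smul]
    exact integrable_mul_cexp_neg_mul_sq hre
  have hd := Real.hasDerivAt_fourier i1 i2 ξ
  rw [hbase] at hd
  have hd2 : HasDerivAt (fun t : ℝ => ((Real.sqrt (4 * Real.pi * a) : ℝ) : ℂ) *
      Complex.exp (-Real.pi / (b : ℂ) * t ^ 2))
      (((Real.sqrt (4 * Real.pi * a) : ℝ) : ℂ) * (Complex.exp (-Real.pi / (b : ℂ) * ξ ^ 2) *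
        (-Real.pi / (b : ℂ) * (2 * ξ)))) ξ := by
    have h0 : HasDerivAt (fun t : ℝ => (t : ℂ) ^ 2) (2 * ξ) ξ := by
      simpa using! ((hasDerivAt_id ξ).ofReal_comp).pow 2
    exact ((h0.const_mul _).cexp).const_mul _
  have hu := hd.unique hd2
  have hsmul : (fun x : ℝ => (-2 * Real.pi * Complex.I * x) • f x) =
      fun x : ℝ => (-2 * Real.pi * Complex.I) • ((x : ℂ) * f x) := by
    ext x; simp only [smul_eq_mul]; ring
  rw [hsmul] at hu
  have hF : 𝓕 (fun x : ℝ => (-2 * Real.pi * Complex.I) • ((x : ℂ) * f x)) ξ =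
      (-2 * Real.pi * Complex.I) * 𝓕 (fun x : ℝ => (x : ℂ) * f x) ξ := by
    rw [Real.fourier_real_eq, Real.fourier_real_eq, ← integral_const_mul]
    refine integral_congr_ae (Eventually.of_forall fun x => ?_)
    simp only [smul_eq_mul, Circle.smul_def]
    ring
  rw [hF] at hu
  have hexp : Complex.exp (-Real.pi / (b : ℂ) * ξ ^ 2) =
      Complex.exp (-(4 * Real.pi ^ 2 * a * ξ ^ 2 : ℝ)) := by
    congr 1
    rw [hb]
    push_cast
    field_simp
  rw [hexp] at hu
  have hb' : (-Real.pi / (b : ℂ)) = -(4 * Real.pi ^ 2 * a) := by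
    rw [hb]
    push_cast
    field_simp
  rw [hb'] at hu
  have h2 : (-2 * Real.pi * Complex.I : ℂ) ≠ 0 := by simp [hpi']
  refine mul_left_cancel₀ h2 (hu.trans ?_)
  ring_nf
  rw [Complex.I_sq]
  ring

theorem waveAmp_zero {a : ℝ} (ha : 0 < a) : waveAmp a 0 = ((a ^ (-(3 / 2) : ℝ) : ℝ) : ℂ) := by
  rw [waveAmp, Complex.ofReal_cpow ha.le]
  simp [cTime]

theorem sinhWeight_gaussianProfile {a : ℝ} (ha : 0 < a) : sinhWeight (gaussianProfile a) =
    (Set.Ioi 0).indicator fun r : ℝ => ((a ^ (-(3 / 2) : ℝ) : ℝ) : ℂ) *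
      ((r : ℂ) * Complex.exp (-((4 * a)⁻¹ : ℝ) * r ^ 2)) := by
  rw [sinhWeight]
  congr 1
  ext r
  rw [gaussianProfile, sinh_mul_gaussianWave, waveAmp_zero ha, waveWidth_zero]
  push_cast
  ring

open FourierTransform in
-- The weighted profile is the positive half of an odd function `A h`. The difference of its
-- transforms at `-ξ` and `ξ` recovers the transform of the whole odd function.
theorem isRadialFourier_gaussianProfile (C : ℂ) {a : ℝ} (ha : 0 < a) :
    IsRadialFourier C (gaussianProfile a)
      fun ξ => 2 * (Real.sqrt Real.pi : ℂ) * C * Complex.exp (-(a * ξ ^ 2 : ℝ)) := by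
  have hpi := Real.pi_pos
  have hpi' : (Real.pi : ℂ) ≠ 0 := by exact_mod_cast hpi.ne'
  set h : ℝ → ℂ := fun x => (x : ℂ) * Complex.exp (-((4 * a)⁻¹ : ℝ) * x ^ 2) with hh
  set A : ℂ := ((a ^ (-(3 / 2) : ℝ) : ℝ) : ℂ)
  have hre : (0 : ℝ) < (((4 * a)⁻¹ : ℝ) : ℂ).re := by rw [Complex.ofReal_re]; positivity
  have ih : Integrable h := integrable_mul_cexp_neg_mul_sq hre
  set g := sinhWeight (gaussianProfile a) with hgdef
  have hg : g = (Set.Ioi 0).indicator fun r : ℝ => A * h r := sinhWeight_gaussianProfile ha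
  have ig : Integrable g := by
    rw [hg]
    exact (ih.const_mul A).indicator measurableSet_Ioi
  have hR := isRadialFourier_sineTransform C (memLp_gaussianProfile ha)
    (continuous_fourier_of_integrable ig).stronglyMeasurable
    (coeFn_fourier_toLp ig (memLp_sinhWeight (memLp_gaussianProfile ha)))
  have hint {k : ℝ → ℂ} (hk : Integrable k) (v : ℝ) :
      Integrable fun x : ℝ => Real.fourierChar (-(x * v)) • k x := by
    have := (VectorFourier.fourierIntegral_convergent_iff (L := innerₗ ℝ) (μ := volume)
      Real.continuous_fourierChar continuous_inner v).2 hk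
    refine this.congr (Eventually.of_forall fun x => ?_)
    simp [mul_comm]
  have hodd (ξ : ℝ) : 𝓕 g (-ξ) - 𝓕 g ξ = -(A * 𝓕 h ξ) := by
    rw [Real.fourier_real_eq g (-ξ), Real.fourier_real_eq g ξ, Real.fourier_real_eq h ξ]
    rw [← integral_neg_eq_self (fun x : ℝ => Real.fourierChar (-(x * -ξ)) • g x)]
    have i1 : Integrable fun x : ℝ => Real.fourierChar (-(-x * -ξ)) • g (-x) :=
      (hint ig (-ξ)).comp_neg
    rw [← integral_sub i1 (hint ig ξ), ← integral_const_mul, ← integral_neg]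
    refine integral_congr_ae (Eventually.of_forall fun x => ?_)
    simp only [neg_mul_neg, ← smul_sub]
    have hgx : g (-x) - g x = -(A * h x) := by
      rw [hg]
      have hneg : h (-x) = -h x := by simp [h]
      rcases lt_trichotomy x 0 with hx | hx | hx
      · rw [Set.indicator_of_mem (show -x ∈ Set.Ioi 0 from neg_pos.2 hx),
          Set.indicator_of_notMem (show x ∉ Set.Ioi 0 from not_lt.2 hx.le), hneg]
        ring
      · simp [hx, h]
      · rw [Set.indicator_of_notMem (show -x ∉ Set.Ioi 0 from not_lt.2 (neg_nonpos.2 hx.le)),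
          Set.indicator_of_mem (show x ∈ Set.Ioi 0 from hx)]
        ring
    rw [hgx]
    simp only [smul_eq_mul, Circle.smul_def]
    ring
  have hev : ∀ ξ ∈ Set.Ioi (0 : ℝ), sineTransform C (𝓕 g) ξ =
      2 * (Real.sqrt Real.pi : ℂ) * C * Complex.exp (-(a * ξ ^ 2 : ℝ)) := by
    intro ξ (hξ : 0 < ξ)
    have hξ' : (ξ : ℂ) ≠ 0 := by exact_mod_cast hξ.ne'
    rw [sineTransform, neg_mul, hodd, hh, fourier_mul_gaussian ha]
    have e1 : -((4 * Real.pi ^ 2 * a * ((2 * Real.pi)⁻¹ * ξ) ^ 2 : ℝ) : ℂ) =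
        -((a * ξ ^ 2 : ℝ) : ℂ) := by
      push_cast
      field_simp
      ring
    rw [e1]
    -- The powers `a^{-3/2} · a · a^{1/2}` cancel; this is why one constant `c` serves all
    -- Gaussians.
    have e2 : A * a * ((Real.sqrt (4 * Real.pi * a) : ℝ) : ℂ) = 2 * (Real.sqrt Real.pi : ℂ) := by
      have : a ^ (-(3 / 2) : ℝ) * a * Real.sqrt (4 * Real.pi * a) = 2 * Real.sqrt Real.pi := by
        rw [Real.sqrt_mul (by positivity), Real.sqrt_mul (by norm_num),
          show Real.sqrt 4 = 2 by rw [show (4 : ℝ) = 2 ^ 2 by norm_num]; simp, Real.sqrt_eq_rpow a]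
        have e3 : a ^ (-(3 / 2) : ℝ) * a * a ^ (1 / 2 : ℝ) = 1 := by
          nth_rewrite 2 [← Real.rpow_one a]
          rw [← Real.rpow_add ha, ← Real.rpow_add ha]
          norm_num
        linear_combination (2 * Real.sqrt Real.pi) * e3
      have h2 := congrArg ((↑) : ℝ → ℂ) this
      simp only [Complex.ofReal_mul, Complex.ofReal_ofNat] at h2
      exact h2
    rw [← e2]
    push_cast
    field_simp
    ring
  refine ⟨(by fun_prop : Continuous fun ξ : ℝ => 2 * (Real.sqrt Real.pi : ℂ) * C *
    Complex.exp (-(a * ξ ^ 2 : ℝ))).aestronglyMeasurable, hR.2.congr fun R => ?_⟩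
  refine setLIntegral_congr_fun measurableSet_Ioi fun ξ hξ => ?_
  simp only [hev ξ hξ]

/-! ### Measurability and norm of the asymptotic profile. -/

theorem lintegral_comp_div_Ioi {g : ℝ → ENNReal} (hg : Measurable g) {c : ℝ} (hc : 0 < c) :
    ∫⁻ r in Set.Ioi (0 : ℝ), g (r / c) = ENNReal.ofReal c * ∫⁻ r in Set.Ioi (0 : ℝ), g r := by
  have hc' : c⁻¹ ≠ 0 := by positivity
  rw [← lintegral_indicator measurableSet_Ioi, ← lintegral_indicator measurableSet_Ioi]
  have h1 := lintegral_map (μ := volume) (hg.indicator (measurableSet_Ioi (a := (0 : ℝ))))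
    (measurable_const_mul c⁻¹)
  rw [Real.map_volume_mul_left hc', lintegral_smul_measure, inv_inv, abs_of_pos hc] at h1
  rw [← smul_eq_mul, h1]
  refine lintegral_congr fun r => ?_
  by_cases hr : r ∈ Set.Ioi (0 : ℝ)
  · rw [Set.indicator_of_mem hr, Set.indicator_of_mem (by
      have : 0 < r := hr
      simp only [Set.mem_Ioi]; positivity), div_eq_inv_mul]
  · rw [Set.indicator_of_notMem hr, Set.indicator_of_notMem]
    simp only [Set.mem_Ioi, not_lt] at hr ⊢
    exact mul_nonpos_of_nonneg_of_nonpos (by positivity) hr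

theorem ae_comp_div_Ioi {p : ℝ → Prop} (hp : ∀ᵐ r ∂(volume.restrict (Set.Ioi (0 : ℝ))), p r)
    {c : ℝ} (hc : 0 < c) : ∀ᵐ r ∂(volume.restrict (Set.Ioi (0 : ℝ))), p (r / c) := by
  have hc' : c⁻¹ ≠ 0 := by positivity
  rw [ae_restrict_iff' measurableSet_Ioi] at hp ⊢
  have hq : Measure.QuasiMeasurePreserving (fun r : ℝ => c⁻¹ * r) volume volume := by
    refine ⟨measurable_const_mul _, ?_⟩
    rw [Real.map_volume_mul_left hc']
    exact Measure.smul_absolutelyContinuous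
  filter_upwards [hq.ae hp] with r hr (h0 : 0 < r)
  rw [div_eq_inv_mul]
  exact hr (by simp only [Set.mem_Ioi]; positivity)

/-- The asymptotic profile as a function of the distance. -/
def asymptoticRadial (c : ℂ) (F : ℝ → ℂ) (t r : ℝ) : ℂ :=
  c * (Complex.exp (-Complex.I * t + Complex.I * ((r : ℂ) ^ 2 / (4 * t))) /
      ((t ^ (3 / 2 : ℝ) : ℝ) : ℂ)) *
    ((r / Real.sinh r : ℝ) : ℂ) *
    F (r / (2 * t))

theorem asymptoticRadial_ae_congr (c : ℂ) {F G : ℝ → ℂ}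
    (h : F =ᵐ[volume.restrict (Set.Ioi 0)] G) {t : ℝ} (ht : 0 < t) :
    asymptoticRadial c F t =ᵐ[radialMeasure] asymptoticRadial c G t := by
  refine ae_radialMeasure_iff.2 ?_
  filter_upwards [ae_comp_div_Ioi h (by positivity : 0 < 2 * t)] with r hr
  rw [asymptoticRadial, asymptoticRadial, hr]

theorem measurable_asymptoticRadial (c : ℂ) {F : ℝ → ℂ} (hF : Measurable F) (t : ℝ) :
    Measurable (asymptoticRadial c F t) := by
  unfold asymptoticRadial
  refine Measurable.mul (Measurable.mul (by fun_prop) ?_) (hF.comp (by fun_prop))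
  exact Complex.measurable_ofReal.comp (measurable_id.div Real.continuous_sinh.measurable)

theorem aestronglyMeasurable_asymptoticProfile (c : ℂ) {F : ℝ → ℂ}
    (hF : AEStronglyMeasurable F (volume.restrict (Set.Ioi 0))) {t : ℝ} (ht : 0 < t) :
    AEStronglyMeasurable (asymptoticProfile c F t) hypVol := by
  obtain ⟨G, hG, h⟩ := hF
  have h1 : AEStronglyMeasurable (asymptoticRadial c F t) radialMeasure :=
    ⟨_, (measurable_asymptoticRadial c hG.measurable t).stronglyMeasurable,
      asymptoticRadial_ae_congr c h ht⟩
  exact h1.comp_measurePreserving measurePreserving_hypRadius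

theorem eLpNorm_comp_hypRadius {f : ℝ → ℂ} (hf : AEStronglyMeasurable f radialMeasure) :
    eLpNorm (fun Ω => f (hypRadius Ω)) 2 hypVol = eLpNorm f 2 radialMeasure :=
  eLpNorm_comp_measurePreserving hf measurePreserving_hypRadius

theorem norm_exp_phase (t r : ℝ) :
    ‖Complex.exp (-Complex.I * t + Complex.I * ((r : ℂ) ^ 2 / (4 * t)))‖ = 1 := by
  rw [show -Complex.I * t + Complex.I * ((r : ℂ) ^ 2 / (4 * t)) =
    ((-t + r ^ 2 / (4 * t) : ℝ) : ℂ) * Complex.I by push_cast; ring,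
    Complex.norm_exp_ofReal_mul_I]

/-- The factors `sinh r` cancel, and `ξ = r/(2t)` turns `t⁻³ r² dr` into `8 ξ² dξ`. The norm is thus
independent of `t`. -/
theorem eLpNorm_asymptoticProfile_sq (c : ℂ) {F : ℝ → ℂ}
    (hF : AEStronglyMeasurable F (volume.restrict (Set.Ioi 0))) {t : ℝ} (ht : 0 < t) :
    eLpNorm (asymptoticProfile c F t) 2 hypVol ^ 2 =
      sphereArea * (8 * ‖c‖ₑ ^ 2) * eLpNorm F 2 spectralMeasure ^ 2 := by
  obtain ⟨G, hG, h⟩ := hF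
  have hm := measurable_asymptoticRadial c hG.measurable t
  have h1 : AEStronglyMeasurable (asymptoticRadial c F t) radialMeasure :=
    ⟨_, hm.stronglyMeasurable, asymptoticRadial_ae_congr c h ht⟩
  have h2 : eLpNorm F 2 spectralMeasure = eLpNorm G 2 spectralMeasure :=
    eLpNorm_congr_ae ((withDensity_absolutelyContinuous _ _).ae_eq h)
  have h3 : eLpNorm (asymptoticProfile c F t) 2 hypVol =
      eLpNorm (asymptoticRadial c G t) 2 radialMeasure := by
    rw [← eLpNorm_congr_ae (asymptoticRadial_ae_congr c h ht), ← eLpNorm_comp_hypRadius h1]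
    rfl
  rw [h3, h2, eLpNorm_spectralMeasure_sq, eLpNorm_two_sq, lintegral_radialMeasure, mul_assoc]
  congr 1
  have hGm : Measurable fun ξ : ℝ => ‖G ξ‖ₑ ^ 2 * ENNReal.ofReal (ξ ^ 2) :=
    (hG.enorm.pow_const 2).mul (by fun_prop)
  have h2t : 0 < 2 * t := by positivity
  have hpt : ∀ r ∈ Set.Ioi (0 : ℝ),
      ENNReal.ofReal (Real.sinh r ^ 2) * ‖asymptoticRadial c G t r‖ₑ ^ 2 =
      (‖c‖ₑ ^ 2 * ENNReal.ofReal (4 / t)) *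
        (‖G (r / (2 * t))‖ₑ ^ 2 * ENNReal.ofReal ((r / (2 * t)) ^ 2)) := by
    intro r (hr : 0 < r)
    have hs := Real.sinh_pos_iff.2 hr
    have ht3 : (0 : ℝ) < t ^ (3 / 2 : ℝ) := Real.rpow_pos_of_pos ht _
    have ht3' : (t ^ (3 / 2 : ℝ)) ^ 2 = t ^ 3 := by
      rw [← Real.rpow_natCast, ← Real.rpow_mul ht.le, ← Real.rpow_natCast]
      norm_num
    have e1 : ‖asymptoticRadial c G t r‖ =
        ‖c‖ * ((t ^ (3 / 2 : ℝ))⁻¹ * (r / Real.sinh r)) * ‖G (r / (2 * t))‖ := by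
      rw [asymptoticRadial, norm_mul, norm_mul, norm_mul, norm_div, norm_exp_phase,
        Complex.norm_real, Complex.norm_real, Real.norm_eq_abs, Real.norm_eq_abs,
        abs_of_pos ht3, abs_of_pos (by positivity)]
      ring
    rw [← ofReal_norm (asymptoticRadial c G t r), ← ofReal_norm c, ← ofReal_norm (G _), e1,
      ← ENNReal.ofReal_pow (by positivity), ← ENNReal.ofReal_pow (by positivity),
      ← ENNReal.ofReal_pow (by positivity), ← ENNReal.ofReal_mul (by positivity),
      ← ENNReal.ofReal_mul (by positivity), ← ENNReal.ofReal_mul (by positivity),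
      ← ENNReal.ofReal_mul (by positivity)]
    congr 1
    have e2 : ((t ^ (3 / 2 : ℝ))⁻¹) ^ 2 = (t ^ 3)⁻¹ := by rw [inv_pow, ht3']
    calc _ = Real.sinh r ^ 2 * (‖c‖ ^ 2 * (((t ^ (3 / 2 : ℝ))⁻¹) ^ 2 * (r / Real.sinh r) ^ 2) *
          ‖G (r / (2 * t))‖ ^ 2) := by ring
      _ = _ := by
        rw [e2]
        field_simp
        ring
  rw [setLIntegral_congr_fun measurableSet_Ioi hpt, lintegral_const_mul _ (by
    exact hGm.comp (measurable_id.div_const _)), lintegral_comp_div_Ioi hGm h2t, ← mul_assoc,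
    mul_assoc (‖c‖ₑ ^ 2), ← ENNReal.ofReal_mul (by positivity)]
  congr 1
  rw [show 4 / t * (2 * t) = 8 by field_simp; norm_num, mul_comm]
  simp

/-! ### Asymptotics of the Gaussian waves. -/

/-- The rescaled difference between the Gaussian wave and its asymptotic profile. -/
def rescaledError (a t ρ : ℝ) : ℂ :=
  ρ * ((a / t + Complex.I) ^ (-(3 / 2) : ℂ) *
      Complex.exp (-(Complex.I * a / (4 * (a / t + Complex.I))) * ρ ^ 2) -
    Complex.I ^ (-(3 / 2) : ℂ) * Complex.exp (-(a / 4) * ρ ^ 2))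

/-- Write `a + it = t z` with `z = a/t + i` and `ρ = r/t`. Since `1 + iz = ia/t`, the exponent
`-r²/(4tz)` equals `i r²/(4t) - ia ρ²/(4z)`, so the oscillating phase factors out of both terms. -/
theorem sinh_mul_gaussianWave_sub {C : ℂ} (hC : C ≠ 0) {a t r : ℝ} (ha : 0 < a) (ht : 0 < t)
    (hr : 0 < r) :
    (Real.sinh r : ℂ) * (gaussianWave a t (Real.sinh r ^ 2) -
      asymptoticRadial (Complex.I ^ (-(3 / 2) : ℂ) / (2 * (Real.sqrt Real.pi : ℂ) * C))
        (fun ξ => 2 * (Real.sqrt Real.pi : ℂ) * C * Complex.exp (-(a * ξ ^ 2 : ℝ))) t r) =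
    Complex.exp (-Complex.I * t + Complex.I * ((r : ℂ) ^ 2 / (4 * t))) *
      ((t ^ (-(1 / 2) : ℝ) : ℝ) : ℂ) * rescaledError a t (r / t) := by
  have hs : (Real.sinh r : ℂ) ≠ 0 := by exact_mod_cast (Real.sinh_pos_iff.2 hr).ne'
  have ht' : (t : ℂ) ≠ 0 := by exact_mod_cast ht.ne'
  have hpi : (Real.sqrt Real.pi : ℂ) ≠ 0 := by
    exact_mod_cast (Real.sqrt_pos.2 Real.pi_pos).ne'
  set z : ℂ := a / t + Complex.I with hz
  have hzre : 0 < z.re := by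
    rw [hz, ← Complex.ofReal_div]; simp; positivity
  have hz0 : z ≠ 0 := fun h => by rw [h] at hzre; simp at hzre
  have hcz : cTime a t = (t : ℝ) * z := by rw [cTime, hz]; field_simp
  -- As `t` is positive, `log (t z) = log t + log z` without a branch correction.
  have hpow : cTime a t ^ (-(3 / 2) : ℂ) = ((t ^ (-(3 / 2) : ℝ) : ℝ) : ℂ) * z ^ (-(3 / 2) : ℂ) := by
    rw [hcz, Complex.cpow_def_of_ne_zero (mul_ne_zero ht' hz0), Complex.log_ofReal_mul ht hz0,
      Complex.cpow_def_of_ne_zero hz0, add_mul, Complex.exp_add, Real.rpow_def_of_pos ht]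
    push_cast
    rfl
  have hT : ((t ^ (-(3 / 2) : ℝ) : ℝ) : ℂ) * t = ((t ^ (-(1 / 2) : ℝ) : ℝ) : ℂ) := by
    have : t ^ (-(3 / 2) : ℝ) * t = t ^ (-(1 / 2) : ℝ) := by
      nth_rewrite 2 [← Real.rpow_one t]
      rw [← Real.rpow_add ht]
      norm_num
    exact_mod_cast congrArg ((↑) : ℝ → ℂ) this
  have hTinv : (((t ^ (3 / 2 : ℝ) : ℝ) : ℂ))⁻¹ = ((t ^ (-(3 / 2) : ℝ) : ℝ) : ℂ) := by
    rw [Real.rpow_neg ht.le]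
    push_cast
    rfl
  rw [mul_sub, sinh_mul_gaussianWave, waveAmp, hpow]
  have h1 : (Real.sinh r : ℂ) *
      asymptoticRadial (Complex.I ^ (-(3 / 2) : ℂ) / (2 * (Real.sqrt Real.pi : ℂ) * C))
        (fun ξ => 2 * (Real.sqrt Real.pi : ℂ) * C * Complex.exp (-(a * ξ ^ 2 : ℝ))) t r =
      Complex.exp (-Complex.I * t + Complex.I * ((r : ℂ) ^ 2 / (4 * t))) *
        ((t ^ (-(3 / 2) : ℝ) : ℝ) : ℂ) * r * (Complex.I ^ (-(3 / 2) : ℂ) *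
          Complex.exp (-(a / 4) * ((r / t : ℝ) : ℂ) ^ 2)) := by
    have e1 : -((a * (r / (2 * t)) ^ 2 : ℝ) : ℂ) = -(a / 4) * ((r / t : ℝ) : ℂ) ^ 2 := by
      push_cast
      field_simp
      norm_num
    rw [asymptoticRadial, ← hTinv, e1]
    push_cast
    rw [Complex.ofReal_sinh] at hs
    field_simp
  have h2 : Complex.exp (-Complex.I * t) * Complex.exp (-waveWidth a t * (r ^ 2 : ℝ)) =
      Complex.exp (-Complex.I * t + Complex.I * ((r : ℂ) ^ 2 / (4 * t))) *
        Complex.exp (-(Complex.I * a / (4 * z)) * ((r / t : ℝ) : ℂ) ^ 2) := by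
    rw [← Complex.exp_add, ← Complex.exp_add]
    congr 1
    rw [waveWidth, hcz]
    push_cast
    have hza : (t : ℂ) * z = a + Complex.I * t := by rw [← hcz, cTime]
    have : Complex.I * a = Complex.I * t * z + t := by
      linear_combination (-Complex.I) * hza - t * Complex.I_sq
    rw [this]
    field_simp
    ring
  rw [h1, rescaledError, ← hz, ← hT]
  have hrt : ((r / t : ℝ) : ℂ) * t = r := by push_cast; field_simp
  rw [show Complex.exp (-Complex.I * t) * (((t ^ (-(3 / 2) : ℝ) : ℝ) : ℂ) * z ^ (-(3 / 2) : ℂ)) *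
    Complex.exp (-waveWidth a t * (r ^ 2 : ℝ)) * r =
    (Complex.exp (-Complex.I * t) * Complex.exp (-waveWidth a t * (r ^ 2 : ℝ))) *
      (((t ^ (-(3 / 2) : ℝ) : ℝ) : ℂ) * z ^ (-(3 / 2) : ℂ)) * r by ring, h2]
  linear_combination (-(Complex.exp (-Complex.I * t + Complex.I * ((r : ℂ) ^ 2 / (4 * t))) *
    ((t ^ (-(3 / 2) : ℝ) : ℝ) : ℂ) *
    (z ^ (-(3 / 2) : ℂ) * Complex.exp (-(Complex.I * a / (4 * z)) * ((r / t : ℝ) : ℂ) ^ 2) -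
      Complex.I ^ (-(3 / 2) : ℂ) * Complex.exp (-(a / 4) * ((r / t : ℝ) : ℂ) ^ 2)))) * hrt

theorem tendsto_rescaledError {a : ℝ} (ha : 0 < a) :
    Tendsto (fun t => eLpNorm (rescaledError a t) 2 (volume.restrict (Set.Ioi 0))) atTop (𝓝 0) := by
  have hzre (t : ℝ) (ht : 0 < t) : ((a : ℂ) / t + Complex.I).re = a / t := by
    rw [← Complex.ofReal_div]; simp
  have hzim (t : ℝ) : ((a : ℂ) / t + Complex.I).im = 1 := by
    rw [← Complex.ofReal_div]; simp
  have hD : MemLp (fun ρ : ℝ => 2 * (ρ * Real.exp (-(a / 8) * ρ ^ 2))) 2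
      (volume.restrict (Set.Ioi 0)) := by
    refine MemLp.const_mul ?_ 2
    rw [memLp_two_iff_integrable_sq (by fun_prop)]
    have := (integrable_rpow_mul_exp_neg_mul_sq (b := a / 4) (by positivity) (s := 2)
      (by norm_num)).restrict (s := Set.Ioi 0)
    refine this.congr (Eventually.of_forall fun ρ => ?_)
    simp only [mul_pow, ← Real.exp_nat_mul]
    norm_num
    left
    ring
  refine tendsto_eLpNorm_two_of_dominated (Eventually.of_forall fun t => ?_) hD ?_ ?_
  · refine Continuous.aestronglyMeasurable ?_
    unfold rescaledError
    fun_prop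
  -- For `t ≥ a` the decay rate `a / (4((a/t)² + 1))` is at least `a/8`. Since `|z| ≥ 1`, the powers
  -- have modulus at most one, and each of the two terms is bounded by `ρ e^{-aρ²/8}`.
  · filter_upwards [eventually_ge_atTop a] with t hta
    have ht : 0 < t := ha.trans_le hta
    filter_upwards [ae_restrict_mem measurableSet_Ioi] with ρ (hρ : 0 < ρ)
    set z : ℂ := a / t + Complex.I with hz
    have hz0 : z ≠ 0 := fun h => by have := hzim t; rw [← hz, h] at this; simp at this
    have hz1 : 1 ≤ ‖z‖ := by
      have := Complex.abs_im_le_norm z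
      rwa [hzim t, abs_one] at this
    have h32 : (-(3 / 2) : ℂ) = ((-(3 / 2) : ℝ) : ℂ) := by push_cast; rfl
    have e1 : ‖z ^ (-(3 / 2) : ℂ)‖ ≤ 1 := by
      rw [Complex.norm_cpow_of_ne_zero hz0, h32]
      simp only [Complex.ofReal_re, Complex.ofReal_im, mul_zero, Real.exp_zero, div_one]
      exact Real.rpow_le_one_of_one_le_of_nonpos hz1 (by norm_num)
    have e2 : ‖Complex.I ^ (-(3 / 2) : ℂ)‖ ≤ 1 := by
      rw [Complex.norm_cpow_of_ne_zero Complex.I_ne_zero, h32]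
      simp
    have e3 : ‖Complex.exp (-(Complex.I * a / (4 * z)) * (ρ : ℂ) ^ 2)‖ ≤
        Real.exp (-(a / 8) * ρ ^ 2) := by
      rw [Complex.norm_exp, Real.exp_le_exp]
      have : (-(Complex.I * a / (4 * z)) * (ρ : ℂ) ^ 2).re =
          -(a / (4 * ((a / t) ^ 2 + 1))) * ρ ^ 2 := by
        have hi : z⁻¹ = ((a / t : ℝ) - Complex.I) / (((a / t) ^ 2 + 1 : ℝ) : ℂ) := by
          have hn : (((a / t) ^ 2 + 1 : ℝ) : ℂ) ≠ 0 := by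
            exact_mod_cast (by positivity : (a / t) ^ 2 + 1 ≠ 0)
          rw [eq_div_iff hn, inv_mul_eq_iff_eq_mul₀ hz0, hz]
          push_cast
          linear_combination Complex.I_sq
        have hsplit (x n : ℝ) : -(Complex.I * a * ((4 : ℂ)⁻¹ * ((x - Complex.I) / (n : ℂ)))) *
            (ρ : ℂ) ^ 2 = ((-(a / (4 * n)) * ρ ^ 2 : ℝ) : ℂ) +
            ((-(a * x / (4 * n)) * ρ ^ 2 : ℝ) : ℂ) * Complex.I := by
          push_cast
          linear_combination (a * (4 * (n : ℂ))⁻¹ * (ρ : ℂ) ^ 2) * Complex.I_sq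
        rw [div_eq_mul_inv, mul_inv, hi, hsplit]
        rw [Complex.add_re, Complex.ofReal_re, Complex.re_ofReal_mul]
        simp
      rw [this]
      have h1 : a / t ≤ 1 := (div_le_one ht).2 hta
      have h2 : (a / t) ^ 2 ≤ 1 := pow_le_one₀ (by positivity) h1
      have h3 : a / 8 ≤ a / (4 * ((a / t) ^ 2 + 1)) := by
        gcongr
        linarith
      nlinarith [sq_nonneg ρ]
    have e4 : ‖Complex.exp (-(a / 4) * (ρ : ℂ) ^ 2)‖ ≤ Real.exp (-(a / 8) * ρ ^ 2) := by
      rw [show (-(a / 4) * (ρ : ℂ) ^ 2 : ℂ) = ((-(a / 4) * ρ ^ 2 : ℝ) : ℂ) by push_cast; rfl,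
        Complex.norm_exp, Complex.ofReal_re, Real.exp_le_exp]
      nlinarith [sq_nonneg ρ, mul_nonneg ha.le (sq_nonneg ρ)]
    rw [rescaledError, norm_mul, Complex.norm_real, Real.norm_eq_abs, abs_of_pos hρ, ← mul_assoc,
      mul_comm 2, mul_assoc]
    gcongr
    refine (norm_sub_le _ _).trans ?_
    rw [norm_mul, norm_mul]
    calc _ ≤ 1 * Real.exp (-(a / 8) * ρ ^ 2) + 1 * Real.exp (-(a / 8) * ρ ^ 2) := by gcongr
      _ = _ := by ring
  · refine Eventually.of_forall fun ρ => ?_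
    have hz : Tendsto (fun t : ℝ => (a : ℂ) / t + Complex.I) atTop (𝓝 Complex.I) := by
      have h1 : Tendsto (fun t : ℝ => ((a / t : ℝ) : ℂ)) atTop (𝓝 ((0 : ℝ) : ℂ)) :=
        (Complex.continuous_ofReal.tendsto 0).comp (tendsto_const_nhds.div_atTop tendsto_id)
      have := h1.add_const Complex.I
      simpa using this
    have hI : Complex.I ∈ Complex.slitPlane := Or.inr (by simp)
    have h1 := ((continuousAt_cpow_const (b := (-(3 / 2) : ℂ)) hI).tendsto).comp hz
    have h2 : Tendsto (fun t : ℝ => -(Complex.I * a / (4 * ((a : ℂ) / t + Complex.I))) * (ρ : ℂ) ^ 2)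
        atTop (𝓝 (-(a / 4) * (ρ : ℂ) ^ 2)) := by
      have h3 := (((hz.const_mul 4).inv₀ (by simp)).const_mul (Complex.I * a)).neg.mul_const
        ((ρ : ℂ) ^ 2)
      convert! h3 using 2
      field_simp
    have h4 := (h1.mul ((Complex.continuous_exp.tendsto _).comp h2)).sub_const
      (Complex.I ^ (-(3 / 2) : ℂ) * Complex.exp (-(a / 4) * (ρ : ℂ) ^ 2))
    rw [sub_self] at h4
    have h5 := h4.const_mul (ρ : ℂ)
    rw [mul_zero] at h5
    exact h5

/-- The factor `t⁻¹` in the squared error is the Jacobian of `r = tρ`, so the norm equals that of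
`rescaledError` up to the area of the sphere. -/
theorem tendsto_gaussianWave {C : ℂ} (hC : C ≠ 0) {a : ℝ} (ha : 0 < a) :
    Tendsto (fun t => eLpNorm (fun Ω => gaussianWaveLp ha t Ω -
      asymptoticProfile (Complex.I ^ (-(3 / 2) : ℂ) / (2 * (Real.sqrt Real.pi : ℂ) * C))
        (fun ξ => 2 * (Real.sqrt Real.pi : ℂ) * C * Complex.exp (-(a * ξ ^ 2 : ℝ))) t Ω) 2 hypVol)
      atTop (𝓝 0) := by
  set F : ℝ → ℂ := fun ξ => 2 * (Real.sqrt Real.pi : ℂ) * C * Complex.exp (-(a * ξ ^ 2 : ℝ))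
  set c : ℂ := Complex.I ^ (-(3 / 2) : ℂ) / (2 * (Real.sqrt Real.pi : ℂ) * C)
  have hF : Measurable F := by fun_prop
  apply ennreal_tendsto_zero_of_sq
  have h1 := (ENNReal.continuous_pow 2).tendsto 0 |>.comp (tendsto_rescaledError ha)
  have h2 := ENNReal.Tendsto.const_mul (a := sphereArea) h1 (Or.inr sphereArea_ne_top)
  simp only [Function.comp_def, ne_eq, OfNat.ofNat_ne_zero, not_false_eq_true, zero_pow,
    mul_zero] at h2
  refine h2.congr' ?_
  filter_upwards [eventually_gt_atTop 0] with t ht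
  set k : ℝ → ℂ := fun r => gaussianWave a t (Real.sinh r ^ 2) - asymptoticRadial c F t r
  have hk : Measurable k := by
    refine Measurable.sub ?_ (measurable_asymptoticRadial c hF t)
    exact ((continuousOn_gaussian _ _).comp_continuous (by fun_prop) fun r => by
      simp only [Set.mem_Ici]; positivity : Continuous fun r : ℝ =>
        gaussianWave a t (Real.sinh r ^ 2)).measurable
  have h3 : (fun Ω => gaussianWaveLp ha t Ω - asymptoticProfile c F t Ω) =ᵐ[hypVol]
      fun Ω => k (hypRadius Ω) := by
    filter_upwards [coeFn_gaussianWaveLp ha t] with Ω hΩ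
    rw [hΩ, radialOf_eq]
    rfl
  rw [eLpNorm_congr_ae h3, eLpNorm_comp_hypRadius hk.aestronglyMeasurable, eLpNorm_two_sq,
    eLpNorm_two_sq, lintegral_radialMeasure]
  congr 1
  have hm : Measurable fun ρ : ℝ => ‖rescaledError a t ρ‖ₑ ^ 2 := by
    have : Continuous (rescaledError a t) := by
      unfold rescaledError
      fun_prop
    exact this.enorm.measurable.pow_const 2
  have hpt : ∀ r ∈ Set.Ioi (0 : ℝ), ENNReal.ofReal (Real.sinh r ^ 2) * ‖k r‖ₑ ^ 2 =
      ENNReal.ofReal t⁻¹ * ‖rescaledError a t (r / t)‖ₑ ^ 2 := by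
    intro r (hr : 0 < r)
    have e1 := congrArg norm (sinh_mul_gaussianWave_sub hC ha ht hr)
    have ht2 : (0 : ℝ) < t ^ (-(1 / 2) : ℝ) := Real.rpow_pos_of_pos ht _
    rw [norm_mul, norm_mul, norm_mul, norm_exp_phase, one_mul, Complex.norm_real,
      Complex.norm_real, Real.norm_eq_abs, Real.norm_eq_abs, abs_of_pos ht2] at e1
    have e2 : (t ^ (-(1 / 2) : ℝ)) ^ 2 = t⁻¹ := by
      rw [← Real.rpow_natCast, ← Real.rpow_mul ht.le]
      norm_num
      rw [Real.rpow_neg_one]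
    rw [← ofReal_norm, ← ofReal_norm, ← ENNReal.ofReal_pow (norm_nonneg _),
      ← ENNReal.ofReal_pow (norm_nonneg _), ← ENNReal.ofReal_mul (by positivity),
      ← ENNReal.ofReal_mul (by positivity), ← sq_abs (Real.sinh r), ← mul_pow, e1, mul_pow, e2]
  rw [setLIntegral_congr_fun measurableSet_Ioi hpt, lintegral_const_mul _ (by
    exact hm.comp (measurable_id.div_const _)), lintegral_comp_div_Ioi hm ht, ← mul_assoc,
    ← ENNReal.ofReal_mul (by positivity), inv_mul_cancel₀ ht.ne', ENNReal.ofReal_one, one_mul]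

/-! ### Extension to all radial data by density. -/

/-- The constant of the asymptotic profile for the normalization `C` of the Fourier transform. -/
def profileConst (C : ℂ) : ℂ := Complex.I ^ (-(3 / 2) : ℂ) / (2 * (Real.sqrt Real.pi : ℂ) * C)

theorem profileConst_ne_zero {C : ℂ} (hC : C ≠ 0) : profileConst C ≠ 0 := by
  have hpi : (Real.sqrt Real.pi : ℂ) ≠ 0 := by
    exact_mod_cast (Real.sqrt_pos.2 Real.pi_pos).ne'
  refine div_ne_zero ?_ (mul_ne_zero (mul_ne_zero two_ne_zero hpi) hC)
  rw [Complex.cpow_def_of_ne_zero Complex.I_ne_zero]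
  exact Complex.exp_ne_zero _

theorem asymptoticProfile_add (c : ℂ) (F G : ℝ → ℂ) (t : ℝ) :
    asymptoticProfile c (F + G) t = asymptoticProfile c F t + asymptoticProfile c G t := by
  ext Ω
  simp only [asymptoticProfile, Pi.add_apply]
  ring

theorem asymptoticProfile_smul (c b : ℂ) (F : ℝ → ℂ) (t : ℝ) :
    asymptoticProfile c (b • F) t = b • asymptoticProfile c F t := by
  ext Ω
  simp only [asymptoticProfile, Pi.smul_apply, smul_eq_mul]
  ring

theorem aestronglyMeasurable_sub_asymptoticProfile (w : L2Hyp3) (c : ℂ) {F : ℝ → ℂ}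
    (hF : AEStronglyMeasurable F (volume.restrict (Set.Ioi 0))) {t : ℝ} (ht : 0 < t) :
    AEStronglyMeasurable (fun Ω => w Ω - asymptoticProfile c F t Ω) hypVol :=
  (Lp.aestronglyMeasurable w).sub (aestronglyMeasurable_asymptoticProfile c hF ht)

/-- The asymptotics on the span of the Gaussian profiles. -/
theorem exists_isStrongSolution_tendsto {C : ℂ} (hC : C ≠ 0) {v : Lp ℂ 2 radialMeasure}
    (hv : v ∈ gaussianSpan) :
    ∃ (u : ℝ → L2Hyp3) (F : ℝ → ℂ), IsStrongSolution (radialLift v) u ∧ IsRadialFourier C v F ∧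
      Tendsto (fun t => eLpNorm (fun Ω => u t Ω - asymptoticProfile (profileConst C) F t Ω) 2 hypVol)
        atTop (𝓝 0) := by
  have hsmul (b : ℂ) (v : Lp ℂ 2 radialMeasure) (h : ∃ (u : ℝ → L2Hyp3) (F : ℝ → ℂ),
      IsStrongSolution (radialLift v) u ∧ IsRadialFourier C v F ∧
      Tendsto (fun t => eLpNorm (fun Ω => u t Ω - asymptoticProfile (profileConst C) F t Ω) 2 hypVol)
        atTop (𝓝 0)) : ∃ (u : ℝ → L2Hyp3) (F : ℝ → ℂ),
      IsStrongSolution (radialLift (b • v)) u ∧ IsRadialFourier C (b • v : Lp ℂ 2 radialMeasure) F ∧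
      Tendsto (fun t => eLpNorm (fun Ω => u t Ω - asymptoticProfile (profileConst C) F t Ω) 2 hypVol)
        atTop (𝓝 0) := by
    obtain ⟨u, F, hu, hF, h⟩ := h
    refine ⟨b • u, b • F, ?_, (hF.smul b).congr (Lp.coeFn_smul b v).symm, ?_⟩
    · rw [map_smul]
      exact hu.smul b
    · have h' := ENNReal.Tendsto.const_mul (a := ‖b‖ₑ) h (Or.inr enorm_ne_top)
      rw [mul_zero] at h'
      refine h'.congr fun t => ?_
      rw [← eLpNorm_const_smul]
      refine eLpNorm_congr_ae ?_
      filter_upwards [Lp.coeFn_smul b (u t)] with Ω hΩ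
      rw [show (b • u) t = b • u t from rfl, hΩ, asymptoticProfile_smul]
      simp only [Pi.smul_apply, smul_sub]
  have hgauss {a : ℝ} (ha : 0 < a) : ∃ (u : ℝ → L2Hyp3) (F : ℝ → ℂ),
      IsStrongSolution (radialLift (memLp_gaussianProfile ha).toLp) u ∧
      IsRadialFourier C ((memLp_gaussianProfile ha).toLp : Lp ℂ 2 radialMeasure) F ∧
      Tendsto (fun t => eLpNorm (fun Ω => u t Ω - asymptoticProfile (profileConst C) F t Ω) 2 hypVol)
        atTop (𝓝 0) := by
    refine ⟨gaussianWaveLp ha, _, ?_, (isRadialFourier_gaussianProfile C ha).congr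
      (MemLp.coeFn_toLp _).symm, tendsto_gaussianWave hC ha⟩
    rw [radialLift_gaussianProfile]
    exact isStrongSolution_gaussianWave ha
  induction hv using Submodule.span_induction with
  | mem v hv =>
    obtain ⟨a, ha, rfl⟩ := hv
    exact hgauss ha
  | zero =>
    -- The zero vector is treated as zero times a Gaussian.
    have := hsmul 0 _ (hgauss one_pos)
    rwa [zero_smul] at this
  | add v w _ _ hv hw =>
    obtain ⟨u, F, hu, hF, h⟩ := hv
    obtain ⟨u', F', hu', hF', h'⟩ := hw
    refine ⟨u + u', F + F', ?_, ((hF.add (Lp.memLp v) (Lp.memLp w) hF').congr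
      (Lp.coeFn_add v w).symm), ?_⟩
    · rw [map_add]
      exact hu.add hu'
    · have hs := h.add h'
      rw [add_zero] at hs
      refine tendsto_of_tendsto_of_tendsto_of_le_of_le' tendsto_const_nhds hs
        (Eventually.of_forall fun t => zero_le) ?_
      filter_upwards [eventually_gt_atTop 0] with t ht
      refine le_trans (le_of_eq ?_) (eLpNorm_add_le
        (aestronglyMeasurable_sub_asymptoticProfile (u t) (profileConst C) hF.1 ht)
        (aestronglyMeasurable_sub_asymptoticProfile (u' t) (profileConst C) hF'.1 ht)
        one_le_two)
      refine eLpNorm_congr_ae ?_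
      filter_upwards [Lp.coeFn_add (u t) (u' t)] with Ω hΩ
      rw [Pi.add_apply u u', hΩ, asymptoticProfile_add]
      simp only [Pi.add_apply]
      ring
  | smul b v _ hv => exact hsmul b v hv

/-- Bound of the asymptotic profile of a radial function by its norm. -/
theorem eLpNorm_asymptoticProfile_le (C c : ℂ) : ∃ K : ENNReal, K ≠ ⊤ ∧
    ∀ (v : Lp ℂ 2 radialMeasure) (F : ℝ → ℂ), IsRadialFourier C v F → ∀ t : ℝ, 0 < t →
      eLpNorm (asymptoticProfile c F t) 2 hypVol ^ 2 ≤ K * ‖v‖ₑ ^ 2 := by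
  refine ⟨8 * ‖c‖ₑ ^ 2 * sineConst C ^ 2, ENNReal.mul_ne_top (ENNReal.mul_ne_top (by simp)
    (ENNReal.pow_ne_top enorm_ne_top)) (ENNReal.pow_ne_top (sineConst_ne_top C)),
    fun v F hF t ht => ?_⟩
  rw [eLpNorm_asymptoticProfile_sq c hF.1 ht, Lp.enorm_def, ← eLpNorm_sinhWeight_sq]
  calc _ ≤ sphereArea * (8 * ‖c‖ₑ ^ 2) *
        (sineConst C * eLpNorm (sinhWeight v) 2 volume) ^ 2 := by
        gcongr
        exact hF.eLpNorm_le (Lp.memLp v)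
    _ = _ := by ring

/-- The difference is a free evolution with radial datum, so by uniqueness it is the isometric one
obtained from strong solutions. -/
theorem IsFreeEvolution.enorm_sub_eq {h k : Lp ℂ 2 radialMeasure} {u w : ℝ → L2Hyp3}
    (hu : IsFreeEvolution (radialLift h) u) (hw : IsFreeEvolution (radialLift k) w) (t : ℝ) :
    ‖u t - w t‖ₑ = ‖h - k‖ₑ := by
  obtain ⟨z, hz, hn⟩ := exists_isFreeEvolution (radialLift_mem_closure_strongData (h - k))
  have hd := hu.sub hw
  rw [← map_sub] at hd
  have := hn t
  rw [hz.unique hd, LinearIsometry.norm_map] at this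
  rw [← ofReal_norm, ← ofReal_norm, ← this]
  rfl

/-- Approximate `h` by `v` in the Gaussian span. The errors in the evolution and in the asymptotic
profile are small uniformly in `t > 0`, and the asymptotics of `v` are known. -/
theorem tendsto_sub_asymptoticProfile {C : ℂ} (hC : C ≠ 0) {h : Lp ℂ 2 radialMeasure}
    {u : ℝ → L2Hyp3} {F : ℝ → ℂ} (hu : IsFreeEvolution (radialLift h) u)
    (hF : IsRadialFourier C h F) :
    Tendsto (fun t => eLpNorm (fun Ω => u t Ω - asymptoticProfile (profileConst C) F t Ω) 2 hypVol)
      atTop (𝓝 0) := by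
  set c := profileConst C
  obtain ⟨K, hK, hb⟩ := eLpNorm_asymptoticProfile_le C c
  rw [ENNReal.tendsto_nhds_zero]
  intro ε hε
  have hlim : Tendsto (fun v : Lp ℂ 2 radialMeasure => K * ‖v - h‖ₑ ^ 2) (𝓝 h) (𝓝 0) := by
    have h1 : Tendsto (fun v : Lp ℂ 2 radialMeasure => ‖v - h‖ₑ ^ 2) (𝓝 h) (𝓝 0) := by
      have : Continuous fun v : Lp ℂ 2 radialMeasure => ‖v - h‖ₑ ^ 2 := by fun_prop
      simpa using this.tendsto h
    simpa using ENNReal.Tendsto.const_mul (a := K) h1 (Or.inr hK)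
  have hlim' : Tendsto (fun v : Lp ℂ 2 radialMeasure => ‖h - v‖ₑ) (𝓝 h) (𝓝 0) := by
    have : Continuous fun v : Lp ℂ 2 radialMeasure => ‖h - v‖ₑ := by fun_prop
    simpa using this.tendsto h
  have hε3 : 0 < ε / 3 := ENNReal.div_pos hε.ne' (by simp)
  have hmem : h ∈ closure (gaussianSpan : Set (Lp ℂ 2 radialMeasure)) := by
    rw [← Submodule.topologicalClosure_coe, gaussianSpan_dense]
    trivial
  -- The threshold `(ε / 3) ^ 2` is squared because the bound on the asymptotic profile controls the
  -- square of its norm.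
  obtain ⟨v, ⟨hv1, hv2⟩, hv⟩ := mem_closure_iff_nhds.1 hmem _
    ((hlim.eventually_lt_const (show 0 < (ε / 3) ^ 2 by positivity)).and
      (hlim'.eventually_lt_const hε3))
  obtain ⟨w, G, hw, hG, hlimG⟩ := exists_isStrongSolution_tendsto hC hv
  rw [ENNReal.tendsto_nhds_zero] at hlimG
  filter_upwards [hlimG _ hε3, eventually_gt_atTop 0] with t ht htpos
  have hGF : IsRadialFourier C (v - h : Lp ℂ 2 radialMeasure) (G + (-1 : ℂ) • F) := by
    refine (hG.add (Lp.memLp v) ((Lp.memLp h).const_smul (-1 : ℂ)) (hF.smul (-1))).congr ?_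
    filter_upwards [Lp.coeFn_sub v h] with r hr
    rw [hr]
    simp [sub_eq_add_neg]
  have e1 : eLpNorm (u t - w t : L2Hyp3) 2 hypVol ≤ ε / 3 := by
    rw [← Lp.enorm_def, hu.enorm_sub_eq hw.isFreeEvolution]
    exact hv2.le
  have e3 : eLpNorm (asymptoticProfile c (G + (-1 : ℂ) • F) t) 2 hypVol ≤ ε / 3 := by
    have := (hb _ _ hGF t htpos).trans hv1.le
    exact (ENNReal.pow_right_strictMono two_ne_zero).le_iff_le.1 this
  have m1 := Lp.aestronglyMeasurable (u t - w t)
  have m2 := aestronglyMeasurable_sub_asymptoticProfile (w t) c hG.1 htpos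
  have m3 := aestronglyMeasurable_asymptoticProfile c hGF.1 htpos
  calc _ = eLpNorm (⇑(u t - w t) + (fun Ω => w t Ω - asymptoticProfile c G t Ω) +
        asymptoticProfile c (G + (-1 : ℂ) • F) t) 2 hypVol := by
        refine eLpNorm_congr_ae ?_
        filter_upwards [Lp.coeFn_sub (u t) (w t)] with Ω hΩ
        simp only [Pi.add_apply, hΩ, Pi.sub_apply, asymptoticProfile_add, asymptoticProfile_smul,
          Pi.smul_apply, smul_eq_mul]
        ring
    _ ≤ ε / 3 + ε / 3 + ε / 3 :=
        (eLpNorm_add_le (m1.add m2) m3 one_le_two).trans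
          (add_le_add ((eLpNorm_add_le m1 m2 one_le_two).trans (add_le_add e1 ht)) e3)
    _ = ε := ENNReal.add_thirds ε

end

theorem lemmaB1 (C : ℂ) (hC : C ≠ 0) :
    ∃ c : ℂ, c ≠ 0 ∧
      ∀ (u₀ : L2Hyp3) (f : ℝ → ℂ), (u₀ =ᵐ[hypVol] fun Ω => f (hypRadius Ω)) →
        (∃! u : ℝ → L2Hyp3, IsFreeEvolution u₀ u) ∧
        (∃ F : ℝ → ℂ, IsRadialFourier C f F) ∧
        ∀ (u : ℝ → L2Hyp3) (F : ℝ → ℂ), IsFreeEvolution u₀ u → IsRadialFourier C f F →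
          Tendsto
            (fun t : ℝ => eLpNorm (fun Ω => u t Ω - asymptoticProfile c F t Ω) 2 hypVol)
            atTop (𝓝 0) := by
  refine ⟨profileConst C, profileConst_ne_zero hC, fun u₀ f hf => ?_⟩
  have hm : AEStronglyMeasurable f radialMeasure :=
    aestronglyMeasurable_profile (Lp.aestronglyMeasurable u₀) hf
  have hL : MemLp f 2 radialMeasure :=
    (memLp_radialMeasure_iff hm).2 ((memLp_congr_ae hf).1 (Lp.memLp u₀))
  -- Every radial datum is the lift of its profile, which places it in the closure of the strong
  -- data.
  have hu₀ : u₀ = radialLift hL.toLp := by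
    refine Lp.ext ((hf.trans ?_).trans (coeFn_radialLift _).symm)
    exact measurePreserving_hypRadius.quasiMeasurePreserving.ae (MemLp.coeFn_toLp hL).symm
  subst hu₀
  obtain ⟨u, hu, -⟩ := exists_isFreeEvolution (radialLift_mem_closure_strongData hL.toLp)
  obtain ⟨F, hF, -⟩ := exists_isRadialFourier C hL
  exact ⟨⟨u, hu, fun w hw => hw.unique hu⟩, ⟨F, hF⟩, fun w G hw hG =>
    tendsto_sub_asymptoticProfile hC hw (hG.congr (MemLp.coeFn_toLp hL).symm)⟩
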